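/- **Setting.** For each sample size $n$ we observe independent (not necessarily identically distributed) triples $(Y_i,X_i,Z_i)$, $1\le i\le n$, with $Y_i,X_i\in\{0,1\}$ and $Z_i\in\mathbb R^{d}$, $d=d_n$. Assume that $$P(Y_i=1\mid X_i,Z_i)=\frac{\exp(X_i\theta_0+Z_i^T\beta_0)}{1+\exp(X_i\theta_0+Z_i^T\beta_0)},$$ where $\theta_0\in\mathbb R$ is fixed and $\beta_0=\beta_{0,n}\in\mathbb R^{d}$, and that the propensity scores $e_i=P(X_i=1\mid Z_i)$ lie in $(0,1)$ almost surely. Write $\Lambda(t)=e^t/(1+e^t)$ and $v=\Lambda(1-\Lambda)$. Define $$\mathrm h(\theta,l,e)=\Big(1+\frac{v(l)(1-e)}{v(\theta+l)\,e}\Big)^{-1},\qquad h_0(Z_i)=\mathrm h(\theta_0,Z_i^T\beta_0,e_i).$$ **Posterior.** Let $\pi$ be a probability density on $\mathbb R$, and let $\Pi_\beta,\Pi_\gamma$ be prior distributions on $\mathbb R^{d}$ (which may depend on $n$). Given $(Y,X,Z)$, draw independently * $(\tilde\theta,\beta)$ from the distribution with density proportional to $\prod_i \exp(X_i\tilde\theta+Z_i^T\beta)^{Y_i}/(1+\exp(X_i\tilde\theta+Z_i^T\beta))$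 with respect to $\pi(\tilde\theta)\,d\tilde\theta\otimes\Pi_\beta$; * $\gamma$ from the distribution with density proportional to $\prod_i \exp(Z_i^T\gamma)^{X_i}/(1+\exp(Z_i^T\gamma))$ with respect to $\Pi_\gamma$. Put $h(Z_i)=\mathrm h(\tilde\theta,Z_i^T\beta,\Lambda(Z_i^T\gamma))$ and $\phi_i=\tilde\theta h(Z_i)+Z_i^T\beta$, and let the conditional density of $\theta$ be proportional to $$\pi(\theta)\prod_i \frac{\exp\{(X_i-h(Z_i))\theta+\phi_i\}^{Y_i}}{1+\exp\{(X_i-h(Z_i))\theta+\phi_i\}},\qquad \theta\in\mathbb R.$$ The marginal posterior $f(\theta\mid Y,X,Z)$ is the average of these conditional densities over the draws of $(\tilde\theta,\beta)$ and $\gamma$. **Assumptions.** Let $s=s_n\ge 1$ (for all large $n$) be the number of nonzero coordinates of $\beta_0$. 1. $\log d=o(n)$. 2. There is a constant $C$ with $|Z_{ij}|\le C$ almost surely for all $n,i,j$. 3. $s^2\log(d\vee n)=o(\sqrt n)$. 4. There are constants $M,C,c_1>0$ such that, for all large $n$, on an event of probability at least $1-(d\vee n)^{-c_1}$, the conditional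 posterior probability of $$\max\Big\{\frac{\|(\tilde\theta,\beta)-(\theta_0,\beta_0)\|_1}{s},\ \frac{\|(\tilde\theta,\beta)-(\theta_0,\beta_0)\|_2}{s^{1/2}}\Big\}\ge M\sqrt{\frac{\log(d\vee n)}{n}}$$ is at most $C(d\vee n)^{-c_1}$. 5. There are constants $M,C,c_2>0$ such that, for all large $n$, on an event of probability at least $1-(d\vee n)^{-c_2}$, the conditional posterior probability (under $\gamma$) of $$\max_{i\le n}\Big|\log\frac{\Lambda(Z_i^T\gamma)/(1-\Lambda(Z_i^T\gamma))}{e_i/(1-e_i)}\Big|\ge M\sqrt{\frac{\log(d\vee n)}{n}}$$ is at most $C(d\vee n)^{-c_2}$. 6. $\pi$ is continuous at $\theta_0$ and $\pi(\theta_0)>0$. 7. The average Fisher information about $\theta$ in the model with oracle nuisance quantities does not degenerate: $$\liminf_{n\to\infty}\frac1n\sum_{i=1}^n E\big[v(X_i\theta_0+Z_i^T\beta_0)\,(X_i-h_0(Z_i))^2\big]>0.$$ **Corollary 1.** Let $\alpha\in(0,1)$, and let $\hat q_{\alpha/2}$ and $\hat q_{1-\alpha/2}$ be the $\alpha/2$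 and $1-\alpha/2$ quantiles of the marginal posterior $f(\theta\mid Y,X,Z)$. Then the equal-tailed $(1-\alpha)$ credible interval has asymptotically correct frequentist coverage, both given the covariates and unconditionally: as $n\to\infty$, $$\Big|P\big[\theta_0\in(\hat q_{\alpha/2},\hat q_{1-\alpha/2})\mid X,Z\big]-(1-\alpha)\Big|\to 0\ \text{ in probability},\qquad P\big[\theta_0\in(\hat q_{\alpha/2},\hat q_{1-\alpha/2})\big]\to 1-\alpha .$$ -/

import Mathlib

open MeasureTheory ProbabilityTheory Filter Topology Asymptotics
open scoped ENNReal

namespace CondPosterior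

noncomputable section

/-! ### Logistic likelihoods and posteriors -/

/-- Logistic log-likelihood of binary responses `y` with linear predictors `η`:
`∑ i, (y i * η i - log (1 + exp (η i)))`. -/
def logLik {n : ℕ} (y η : Fin n → ℝ) : ℝ :=
  ∑ i, (y i * η i - Real.log (1 + Real.exp (η i)))

/-- The prior distribution on `ℝ` with Lebesgue density `π`. -/
def densityPrior (π : ℝ → ℝ) : Measure ℝ :=
  volume.withDensity fun t => ENNReal.ofReal (π t)

/-- Conditional posterior of `(θ̃, β)` given `(y, x, z)`: the prior `π(θ̃) π(β)` reweighted by the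
likelihood of the logistic regression of `y` on `(x, z)`, and normalized. -/
def outcomePosterior {n d : ℕ} (π : ℝ → ℝ) (priorβ : Measure (Fin d → ℝ))
    (y x : Fin n → ℝ) (z : Fin n → Fin d → ℝ) : Measure (ℝ × (Fin d → ℝ)) :=
  ((densityPrior π).prod priorβ).tilted fun u => logLik y fun i => x i * u.1 + z i ⬝ᵥ u.2

/-- Conditional posterior of `γ` given `(x, z)`: the prior `π(γ)` reweighted by the likelihood of
the working logistic regression of `x` on `z`, and normalized. -/
def propensityPosterior {n d : ℕ} (priorγ : Measure (Fin d → ℝ))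
    (x : Fin n → ℝ) (z : Fin n → Fin d → ℝ) : Measure (Fin d → ℝ) :=
  priorγ.tilted fun γ => logLik x fun i => z i ⬝ᵥ γ

/-! ### Variance-weighted projection -/

/-- Variance of a Bernoulli variable whose log-odds are `t`. -/
def bernoulliVar (t : ℝ) : ℝ := Real.sigmoid t * (1 - Real.sigmoid t)

/-- Variance-weighted projection `1 / (1 + R)`, where
`R = Var(Y | X = 0) P(X = 0) / (Var(Y | X = 1) P(X = 1))`, for one observation whose response has
log-odds `x * θ + l` at `X = x` and whose propensity score `P(X = 1)` is `e`. -/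
def varProj (θ l e : ℝ) : ℝ :=
  1 / (1 + bernoulliVar l * (1 - e) / (bernoulliVar (θ + l) * e))

/-- The estimated projections `h(Z_i)` obtained from a draw `((θ̃, β), γ)`. -/
def projEst {n d : ℕ} (z : Fin n → Fin d → ℝ) (u : (ℝ × (Fin d → ℝ)) × (Fin d → ℝ)) :
    Fin n → ℝ :=
  fun i => varProj u.1.1 (z i ⬝ᵥ u.1.2) (Real.sigmoid (z i ⬝ᵥ u.2))

/-- The nuisance quantities `φ_i = θ̃ h(Z_i) + Z_iᵀ β` obtained from a draw `((θ̃, β), γ)`. -/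
def phiEst {n d : ℕ} (z : Fin n → Fin d → ℝ) (u : (ℝ × (Fin d → ℝ)) × (Fin d → ℝ)) :
    Fin n → ℝ :=
  fun i => u.1.1 * projEst z u i + z i ⬝ᵥ u.1.2

/-! ### Posterior of the parameter of interest -/

/-- The working log-likelihood `L_n(θ | h, φ)`. -/
def condLogLik {n : ℕ} (y x h φ : Fin n → ℝ) (θ : ℝ) : ℝ :=
  logLik y fun i => θ * (x i - h i) + φ i

/-- Density `f(θ | y, x, z, h, φ)` of the conditional posterior of `θ`. -/
def condDensity {n : ℕ} (π : ℝ → ℝ) (y x h φ : Fin n → ℝ) (θ : ℝ) : ℝ :=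
  π θ * Real.exp (condLogLik y x h φ θ) / ∫ t, π t * Real.exp (condLogLik y x h φ t)

/-- Density `f(θ | y, x, z)` of the marginal posterior of `θ`: the conditional posterior density is
averaged over `(θ̃, β)` and `γ`, drawn from their conditional posteriors. -/
def marginalDensity {n d : ℕ} (π : ℝ → ℝ) (priorβ priorγ : Measure (Fin d → ℝ))
    (y x : Fin n → ℝ) (z : Fin n → Fin d → ℝ) (θ : ℝ) : ℝ≥0∞ :=
  ∫⁻ u, ENNReal.ofReal (condDensity π y x (projEst z u) (phiEst z u) θ)
    ∂((outcomePosterior π priorβ y x z).prod (propensityPosterior priorγ x z))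

/-- The marginal posterior distribution of `θ` given `(y, x, z)`. -/
def marginalPosterior {n d : ℕ} (π : ℝ → ℝ) (priorβ priorγ : Measure (Fin d → ℝ))
    (y x : Fin n → ℝ) (z : Fin n → Fin d → ℝ) : Measure ℝ :=
  volume.withDensity (marginalDensity π priorβ priorγ y x z)

/-- The `p`-quantile of a distribution on the real line. -/
def quantile (ν : Measure ℝ) (p : ℝ) : ℝ := sInf {t : ℝ | p ≤ ν.real (Set.Iic t)}

/-- The equal-tailed `(1 - α)` credible interval of the marginal posterior of `θ`. -/
def credibleInterval {n d : ℕ} (π : ℝ → ℝ) (priorβ priorγ : Measure (Fin d → ℝ)) (α : ℝ)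
    (y x : Fin n → ℝ) (z : Fin n → Fin d → ℝ) : Set ℝ :=
  Set.Ioo (quantile (marginalPosterior π priorβ priorγ y x z) (α / 2))
    (quantile (marginalPosterior π priorβ priorγ y x z) (1 - α / 2))

/-! ### The sampling model -/

section Sampling

variable {Ω : Type*} [MeasurableSpace Ω]

/-- The true propensity score `P(X = 1 | Z)`, a random variable. -/
def propensity {d : ℕ} (P : Measure Ω) (X : Ω → ℝ) (Z : Ω → Fin d → ℝ) : Ω → ℝ :=
  P⟦{ω | X ω = 1} | MeasurableSpace.comap Z inferInstance⟧

/-- The oracle projection `h₀(Z)` of one observation. -/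
def oracleProj {d : ℕ} (P : Measure Ω) (X : Ω → ℝ) (Z : Ω → Fin d → ℝ)
    (θ₀ : ℝ) (β₀ : Fin d → ℝ) (ω : Ω) : ℝ :=
  varProj θ₀ (Z ω ⬝ᵥ β₀) (propensity P X Z ω)

/-- Fisher information about `θ` at `θ₀`, carried by one observation, of the logistic model with
oracle nuisance quantities: `E[W (X - h₀(Z))²]`, where `W = Var(Y | X, Z)`. -/
def fisherInfo {d : ℕ} (P : Measure Ω) (X : Ω → ℝ) (Z : Ω → Fin d → ℝ)
    (θ₀ : ℝ) (β₀ : Fin d → ℝ) : ℝ :=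
  ∫ ω, bernoulliVar (X ω * θ₀ + Z ω ⬝ᵥ β₀) * (X ω - oracleProj P X Z θ₀ β₀ ω) ^ 2 ∂P

/-- A sample of `n` independent (not necessarily identically distributed) observations
`(Y_i, X_i, Z_i)` with `Y_i, X_i ∈ {0, 1}`, propensity scores in `(0, 1)`, and
`P(Y_i = 1 | X_i, Z_i) = exp(X_i θ₀ + Z_iᵀ β₀) / (1 + exp(X_i θ₀ + Z_iᵀ β₀))`. -/
structure IsLogisticSample {n d : ℕ} (P : Measure Ω) (Y X : Fin n → Ω → ℝ)
    (Z : Fin n → Ω → Fin d → ℝ) (θ₀ : ℝ) (β₀ : Fin d → ℝ) : Prop where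
  measurable_Y : ∀ i, Measurable (Y i)
  measurable_X : ∀ i, Measurable (X i)
  measurable_Z : ∀ i, Measurable (Z i)
  binary_Y : ∀ i ω, Y i ω = 0 ∨ Y i ω = 1
  binary_X : ∀ i ω, X i ω = 0 ∨ X i ω = 1
  indep : iIndepFun (fun i ω => (Y i ω, X i ω, Z i ω)) P
  propensity_mem : ∀ i, ∀ᵐ ω ∂P, propensity P (X i) (Z i) ω ∈ Set.Ioo (0 : ℝ) 1
  outcome : ∀ i,
    P⟦{ω | Y i ω = 1} | MeasurableSpace.comap (fun ω => (X i ω, Z i ω)) inferInstance⟧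
      =ᵐ[P] fun ω => Real.sigmoid (X i ω * θ₀ + Z i ω ⬝ᵥ β₀)

/-- The data at sample size `n`, as a function of the sample point. -/
def col {n : ℕ} {E : Type*} (V : Fin n → Ω → E) (ω : Ω) : Fin n → E := fun i => V i ω

end Sampling

/-- The number of nonzero coordinates. -/
def sparsity {d : ℕ} (β : Fin d → ℝ) : ℕ := Set.ncard {j | β j ≠ 0}

/-- The `ℓ¹` distance between `(θ, β)` and `(θ', β')`. -/
def l1Dist {d : ℕ} (u v : ℝ × (Fin d → ℝ)) : ℝ := |u.1 - v.1| + ∑ j, |u.2 j - v.2 j|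

/-- The `ℓ²` distance between `(θ, β)` and `(θ', β')`. -/
def l2Dist {d : ℕ} (u v : ℝ × (Fin d → ℝ)) : ℝ :=
  √((u.1 - v.1) ^ 2 + ∑ j, (u.2 j - v.2 j) ^ 2)

/-- `d ∨ n` as a real number. -/
def dmax (d n : ℕ) : ℝ := ((max d n : ℕ) : ℝ)

section Assumptions

variable {Ω : Type*} [MeasurableSpace Ω]

/-- Concentration of the conditional posterior of `(θ̃, β)` around `(θ₀, β₀)`. -/
def OutcomeConcentration (P : Measure Ω) (d : ℕ → ℕ) (Y X : (n : ℕ) → Fin n → Ω → ℝ)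
    (Z : (n : ℕ) → Fin n → Ω → Fin (d n) → ℝ) (π : ℝ → ℝ)
    (priorβ : (n : ℕ) → Measure (Fin (d n) → ℝ))
    (θ₀ : ℝ) (β₀ : (n : ℕ) → Fin (d n) → ℝ) : Prop :=
  ∃ M > 0, ∃ C > 0, ∃ c > 0, ∀ᶠ n : ℕ in atTop, ∃ E : Set Ω, MeasurableSet E ∧
    1 - dmax (d n) n ^ (-c : ℝ) ≤ P.real E ∧
    ∀ ω ∈ E,
      (outcomePosterior π (priorβ n) (col (Y n) ω) (col (X n) ω) (col (Z n) ω)).real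
        {u | M * √(Real.log (dmax (d n) n) / n) ≤
          max (l1Dist u (θ₀, β₀ n) / sparsity (β₀ n))
            (l2Dist u (θ₀, β₀ n) / √(sparsity (β₀ n)))}
        ≤ C * dmax (d n) n ^ (-c : ℝ)

/-- Concentration of the estimated propensity odds around the true ones, under the conditional
posterior of `γ`. -/
def PropensityConcentration (P : Measure Ω) (d : ℕ → ℕ) (X : (n : ℕ) → Fin n → Ω → ℝ)
    (Z : (n : ℕ) → Fin n → Ω → Fin (d n) → ℝ)
    (priorγ : (n : ℕ) → Measure (Fin (d n) → ℝ)) : Prop :=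
  ∃ M > 0, ∃ C > 0, ∃ c > 0, ∀ᶠ n : ℕ in atTop, ∃ E : Set Ω, MeasurableSet E ∧
    1 - dmax (d n) n ^ (-c : ℝ) ≤ P.real E ∧
    ∀ ω ∈ E,
      (propensityPosterior (priorγ n) (col (X n) ω) (col (Z n) ω)).real
        {γ | ∃ i, M * √(Real.log (dmax (d n) n) / n) ≤
          |Real.log
            ((Real.sigmoid (Z n i ω ⬝ᵥ γ) / (1 - Real.sigmoid (Z n i ω ⬝ᵥ γ))) /
              (propensity P (X n i) (Z n i) ω / (1 - propensity P (X n i) (Z n i) ω)))|}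
        ≤ C * dmax (d n) n ^ (-c : ℝ)

end Assumptions

end

end CondPosterior

open CondPosterior

namespace CondPosterior

/-! ### Calculus of the logistic function -/

/-! Let `F` be the marginal posterior mass of `(-∞, θ₀]`. Up to boundary cases, `θ₀` lies in the
credible interval exactly when `F` lies between `α/2` and `1 - α/2`, so it suffices that `F` is
asymptotically uniform given the covariates. Put `W = S / √I`, with `S = ∑ (X_i - h₀)(Y_i - σ_i)`
the oracle efficient score and `I = ∑ (X_i - h₀)² v_i` its conditional variance. Two approximations
give the claim: `F ≈ Φ(-W)`, and `W` is nearly standard normal given the covariates, so that `Φ(-W)`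
is nearly uniform.

The second is a central limit theorem for weighted Bernoulli sums (`stdScore_clt`). The weights are
bounded and `I` is at least of order `n` with high probability, so characteristic functions converge
at rate `1/√I`, whatever the design. That the responses are independent Bernoulli variables given
the covariates is `IsLogisticSample.lintegral_eq`.

For the first, fix a draw of the nuisance parameters. The working log-likelihood is concave in `θ`
and quadratic near `θ₀`, so a one-dimensional Bernstein-von Mises theorem (`condDensity_cdf_approx`)
applies as soon as its score and information at `θ₀` agree with `S` and `I` up to `o(√n)` and
`o(n)`. The limit `Φ(-W)` does not depend on the draw, so averaging over draws preserves it, apart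
from a set of draws of small posterior mass.

The score is the delicate point, because the nuisance errors are larger than `n^(-1/2)`. Expanding
one term of the score (`score_expansion`), every first-order coefficient has mean zero. Part of it
is an outcome residual times a function of `(X, Z)`; the rest is `(X - h₀) v` times a function of
`Z`, which is centred given `Z` by the definition of the variance-weighted projection
(`varProj_balance`, `IsLogisticSample.integral_residual_mul`). The three kinds of error are then
treated as follows, with `L = log (d ∨ n)`.

Errors in `(θ̃, β)` enter linearly. Hölder's inequality pairs their `ℓ¹` size, of order `s √(L/n)`,
with the largest of `d + 1` centred sums, of order `√(n L)`, for a total of order `s L`.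

Errors in the propensity log-odds are controlled only in supremum norm and have no linear structure
to pair with. But the posterior of `γ` does not involve the responses: given the covariates, each
`γ` yields a centred sum with coefficients of size at most `r`, and Hoeffding, Fubini over `γ` and
Markov show that most draws contribute `o(√n)` (`lintegral_oddsBad_le`).

Second-order terms total `n r²` with `r` of order `s √(L/n)`, that is `s² L`. The sparsity
assumption makes all of this `o(√n)`. -/

lemma abs_sub_le_of_hasDerivAt {f f' : ℝ → ℝ} {K : ℝ} (hf : ∀ x, HasDerivAt f (f' x) x)
    (hK : ∀ x, |f' x| ≤ K) (a k : ℝ) : |f (a + k) - f a| ≤ K * |k| := by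
  have := convex_univ.norm_image_sub_le_of_norm_hasDerivWithin_le (𝕜 := ℝ) (f := f) (f' := f')
    (C := K) (fun x _ => (hf x).hasDerivWithinAt) (fun x _ => hK x) (Set.mem_univ a)
    (Set.mem_univ (a + k))
  simpa using this

/-- The mean value inequality for `x ↦ f x - f' a * x` on the segment from `a` to `a + k`, where its
derivative is at most `K * |k|`. The factor `1/2` is lost, which does not matter below. -/
lemma abs_taylor_le {f f' : ℝ → ℝ} {K : ℝ} (hK0 : 0 ≤ K) (hf : ∀ x, HasDerivAt f (f' x) x)
    (hK : ∀ a k, |f' (a + k) - f' a| ≤ K * |k|) (a k : ℝ) :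
    |f (a + k) - f a - f' a * k| ≤ K * k ^ 2 := by
  have h := (convex_uIcc a (a + k)).norm_image_sub_le_of_norm_hasDerivWithin_le (𝕜 := ℝ)
    (f := fun x => f x - f' a * x) (f' := fun x => f' x - f' a)
    (C := K * |k|) (fun x _ => ?_) (fun x hx => ?_) Set.left_mem_uIcc Set.right_mem_uIcc
  · have e : f (a + k) - f a - f' a * k = f (a + k) - f' a * (a + k) - (f a - f' a * a) := by ring
    rw [e]
    refine h.trans (le_of_eq ?_)
    simp [mul_assoc, ← sq]
  · have h1 := (hf x).sub ((hasDerivAt_id' x).const_mul (f' a))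
    rw [mul_one] at h1
    exact h1.hasDerivWithinAt
  · have h1 := hK a (x - a)
    have h2 := Set.abs_sub_left_of_mem_uIcc hx
    rw [add_sub_cancel] at h1
    refine h1.trans (mul_le_mul_of_nonneg_left ?_ hK0)
    simpa [abs_sub_comm] using h2

lemma bernoulliVar_pos (t : ℝ) : 0 < bernoulliVar t :=
  mul_pos (Real.sigmoid_pos t) (sub_pos.2 (Real.sigmoid_lt_one t))

lemma bernoulliVar_le (t : ℝ) : bernoulliVar t ≤ 1 / 4 := by
  unfold bernoulliVar; nlinarith [sq_nonneg (Real.sigmoid t - 1 / 2)]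

lemma continuous_bernoulliVar : Continuous bernoulliVar :=
  continuous_sigmoid.mul (continuous_const.sub continuous_sigmoid)

lemma abs_one_sub_two_sigmoid_le (t : ℝ) : |1 - 2 * Real.sigmoid t| ≤ 1 := by
  rw [abs_le]; constructor <;> linarith [Real.sigmoid_pos t, Real.sigmoid_lt_one t]

lemma hasDerivAt_bernoulliVar (t : ℝ) :
    HasDerivAt bernoulliVar (bernoulliVar t * (1 - 2 * Real.sigmoid t)) t := by
  have h := Real.hasDerivAt_sigmoid t
  refine (h.mul (h.const_sub 1)).congr_deriv ?_
  unfold bernoulliVar; ring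

lemma hasDerivAt_log_bernoulliVar (t : ℝ) :
    HasDerivAt (fun t => Real.log (bernoulliVar t)) (1 - 2 * Real.sigmoid t) t := by
  convert (hasDerivAt_bernoulliVar t).log (bernoulliVar_pos t).ne' using 1
  field_simp [(bernoulliVar_pos t).ne']

lemma abs_sigmoid_sub_le (a k : ℝ) : |Real.sigmoid (a + k) - Real.sigmoid a| ≤ |k| := by
  have := abs_sub_le_of_hasDerivAt (K := 1) Real.hasDerivAt_sigmoid (fun x => ?_) a k
  · simpa using this
  · change |bernoulliVar x| ≤ 1
    rw [abs_of_pos (bernoulliVar_pos x)]; linarith [bernoulliVar_le x]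

lemma abs_bernoulliVar_sub_le (a k : ℝ) : |bernoulliVar (a + k) - bernoulliVar a| ≤ |k| := by
  have := abs_sub_le_of_hasDerivAt (K := 1) hasDerivAt_bernoulliVar (fun x => ?_) a k
  · simpa using this
  · rw [abs_mul, abs_of_pos (bernoulliVar_pos x)]
    nlinarith [bernoulliVar_le x, abs_one_sub_two_sigmoid_le x, bernoulliVar_pos x,
      abs_nonneg (1 - 2 * Real.sigmoid x)]

lemma abs_log_bernoulliVar_sub_le (a k : ℝ) :
    |Real.log (bernoulliVar (a + k)) - Real.log (bernoulliVar a)| ≤ |k| := by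
  have := abs_sub_le_of_hasDerivAt (K := 1) hasDerivAt_log_bernoulliVar
    abs_one_sub_two_sigmoid_le a k
  simpa using this

lemma abs_sigmoid_taylor_le (a k : ℝ) :
    |Real.sigmoid (a + k) - Real.sigmoid a - bernoulliVar a * k| ≤ k ^ 2 := by
  simpa [bernoulliVar] using abs_taylor_le (K := 1) zero_le_one Real.hasDerivAt_sigmoid
    (fun a k => by rw [one_mul]; exact abs_bernoulliVar_sub_le a k) a k

lemma abs_log_bernoulliVar_taylor_le (a k : ℝ) :
    |Real.log (bernoulliVar (a + k)) - Real.log (bernoulliVar a)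
      - (1 - 2 * Real.sigmoid a) * k| ≤ 2 * k ^ 2 := by
  refine abs_taylor_le (K := 2) zero_le_two hasDerivAt_log_bernoulliVar (fun a k => ?_) a k
  have := abs_sigmoid_sub_le a k
  have e : 1 - 2 * Real.sigmoid (a + k) - (1 - 2 * Real.sigmoid a)
    = -2 * (Real.sigmoid (a + k) - Real.sigmoid a) := by ring
  rw [e, abs_mul]; norm_num; linarith

/-- Self-concordance: `log ∘ bernoulliVar` is 1-Lipschitz, so shifting the log-odds by `k` changes
the variance by a factor between `exp (-|k|)` and `exp |k|`. Relative bounds of this kind are what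
allow linear predictors that are unbounded and variances arbitrarily close to `0`. -/
lemma bernoulliVar_add_le (a k : ℝ) :
    bernoulliVar (a + k) ≤ bernoulliVar a * Real.exp |k| := by
  have h := (abs_le.1 (abs_log_bernoulliVar_sub_le a k)).2
  calc bernoulliVar (a + k) = Real.exp (Real.log (bernoulliVar (a + k))) :=
        (Real.exp_log (bernoulliVar_pos _)).symm
    _ ≤ Real.exp (Real.log (bernoulliVar a) + |k|) := Real.exp_le_exp.2 (by linarith)
    _ = _ := by rw [Real.exp_add, Real.exp_log (bernoulliVar_pos a)]

lemma bernoulliVar_mul_exp_le (a k : ℝ) :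
    bernoulliVar a * Real.exp (-|k|) ≤ bernoulliVar (a + k) := by
  have h := bernoulliVar_add_le (a + k) (-k)
  rw [add_neg_cancel_right, abs_neg] at h
  calc _ ≤ bernoulliVar (a + k) * Real.exp |k| * Real.exp (-|k|) := by gcongr
    _ = _ := by rw [mul_assoc, ← Real.exp_add]; simp

/-! ### The variance-weighted projection -/

/-- On the log-odds scale the projection is additive in the two log-variances and the propensity
log-odds. Its perturbation bounds thus follow from those of `sigmoid` and of `log ∘ bernoulliVar`,
uniformly in `e`, with no margin from `0` or `1`. -/
lemma varProj_eq_sigmoid (θ l : ℝ) {e : ℝ} (he : e ∈ Set.Ioo (0 : ℝ) 1) :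
    varProj θ l e = Real.sigmoid (Real.log (bernoulliVar (θ + l)) - Real.log (bernoulliVar l)
      + Real.log (e / (1 - e))) := by
  have h1 := bernoulliVar_pos l
  have h2 := bernoulliVar_pos (θ + l)
  have he0 := he.1
  have he1 : 0 < 1 - e := sub_pos.2 he.2
  have hR : 0 < bernoulliVar l * (1 - e) / (bernoulliVar (θ + l) * e) := by positivity
  rw [varProj, Real.sigmoid_def, one_div]
  congr 2
  rw [← Real.exp_log hR]
  congr 1
  rw [Real.log_div (by positivity) (by positivity), Real.log_mul (by positivity) (by positivity),
    Real.log_mul (by positivity) (by positivity), Real.log_div (by positivity) (by positivity)]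
  ring

lemma varProj_mem_Ioo (θ l : ℝ) {e : ℝ} (he : e ∈ Set.Ioo (0 : ℝ) 1) :
    varProj θ l e ∈ Set.Ioo (0 : ℝ) 1 := by
  rw [varProj_eq_sigmoid θ l he]
  exact ⟨Real.sigmoid_pos _, Real.sigmoid_lt_one _⟩

/-- The normal equation of the weighted projection: for `X` Bernoulli with mean `e`, the two sides
are the contributions of `X = 1` and `X = 0` to `E[(X - h) v(Xθ + l)] = 0`. The orthogonality of the
score to the nuisance errors rests on it. -/
lemma varProj_balance (θ l : ℝ) {e : ℝ} (he : e ∈ Set.Ioo (0 : ℝ) 1) :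
    (1 - varProj θ l e) * bernoulliVar (θ + l) * e = varProj θ l e * bernoulliVar l * (1 - e) := by
  have h1 := bernoulliVar_pos l
  have h2 := bernoulliVar_pos (θ + l)
  have he0 := he.1
  have he1 : 0 < 1 - e := sub_pos.2 he.2
  have : 0 < bernoulliVar (θ + l) * e + bernoulliVar l * (1 - e) := by positivity
  rw [varProj]
  field_simp
  ring

/-- First-order expansion of the variance-weighted projection in its three arguments. -/
lemma varProj_expansion {θ l e θ' l' e' r : ℝ} (he : e ∈ Set.Ioo (0 : ℝ) 1)
    (he' : e' ∈ Set.Ioo (0 : ℝ) 1) (hτ : |θ' - θ| ≤ r) (hk : |l' - l| ≤ r)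
    (hb : |Real.log (e' / (1 - e')) - Real.log (e / (1 - e))| ≤ r) :
    |varProj θ' l' e' - varProj θ l e| ≤ 4 * r ∧
    |varProj θ' l' e' - varProj θ l e - varProj θ l e * (1 - varProj θ l e) *
      ((1 - 2 * Real.sigmoid (θ + l)) * (θ' - θ)
        + (2 * Real.sigmoid l - 2 * Real.sigmoid (θ + l)) * (l' - l)
        + (Real.log (e' / (1 - e')) - Real.log (e / (1 - e))))| ≤ 26 * r ^ 2 := by
  have hr : 0 ≤ r := (abs_nonneg _).trans hτ
  rw [varProj_eq_sigmoid θ l he, varProj_eq_sigmoid θ' l' he']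
  set b := Real.log (e' / (1 - e')) - Real.log (e / (1 - e)) with hbdef
  obtain ⟨τ, rfl⟩ : ∃ τ, θ' = θ + τ := ⟨θ' - θ, by ring⟩
  obtain ⟨k, rfl⟩ : ∃ k, l' = l + k := ⟨l' - l, by ring⟩
  rw [add_sub_cancel_left] at hτ hk
  rw [add_sub_cancel_left, add_sub_cancel_left]
  set t := Real.log (bernoulliVar (θ + l)) - Real.log (bernoulliVar l) + Real.log (e / (1 - e))
  set a := Real.log (bernoulliVar (θ + l + (τ + k))) - Real.log (bernoulliVar (θ + l))
    - (Real.log (bernoulliVar (l + k)) - Real.log (bernoulliVar l)) with ha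
  have e1 : Real.log (bernoulliVar (θ + τ + (l + k))) - Real.log (bernoulliVar (l + k))
      + Real.log (e' / (1 - e')) = t + (a + b) := by
    rw [show θ + τ + (l + k) = θ + l + (τ + k) by ring]; simp only [t, a, b]; ring
  rw [e1]
  have hτk : |τ + k| ≤ 2 * r := (abs_add_le _ _).trans (by linarith)
  have a1 : |a| ≤ 3 * r := (abs_sub _ _).trans (by
    linarith [abs_log_bernoulliVar_sub_le (θ + l) (τ + k), abs_log_bernoulliVar_sub_le l k])
  have ab : |a + b| ≤ 4 * r := (abs_add_le _ _).trans (by linarith)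
  refine ⟨(abs_sigmoid_sub_le _ _).trans ab, ?_⟩
  have s1 := abs_sigmoid_taylor_le t (a + b)
  have s2 := abs_log_bernoulliVar_taylor_le (θ + l) (τ + k)
  have s3 := abs_log_bernoulliVar_taylor_le l k
  have q1 : (a + b) ^ 2 ≤ (4 * r) ^ 2 := sq_le_sq' (abs_le.1 ab).1 (abs_le.1 ab).2
  have q2 : (τ + k) ^ 2 ≤ (2 * r) ^ 2 := sq_le_sq' (abs_le.1 hτk).1 (abs_le.1 hτk).2
  have q3 : k ^ 2 ≤ r ^ 2 := sq_le_sq' (abs_le.1 hk).1 (abs_le.1 hk).2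
  -- The second-order remainder of the difference of log-variances: `2 (2r)²` from the shift `τ + k`
  -- and `2 r²` from the shift `k` give `10 r²`.
  set ρ := a - ((1 - 2 * Real.sigmoid (θ + l)) * (τ + k) - (1 - 2 * Real.sigmoid l) * k) with hρ
  have r1 : |ρ| ≤ 10 * r ^ 2 := by
    have : ρ = (Real.log (bernoulliVar (θ + l + (τ + k))) - Real.log (bernoulliVar (θ + l))
        - (1 - 2 * Real.sigmoid (θ + l)) * (τ + k))
        - (Real.log (bernoulliVar (l + k)) - Real.log (bernoulliVar l)
          - (1 - 2 * Real.sigmoid l) * k) := by rw [hρ, ha]; ring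
    rw [this]
    exact (abs_sub _ _).trans (by nlinarith)
  have v1 := bernoulliVar_le t
  have v0 := bernoulliVar_pos t
  have : Real.sigmoid (t + (a + b)) - Real.sigmoid t - Real.sigmoid t * (1 - Real.sigmoid t) *
      ((1 - 2 * Real.sigmoid (θ + l)) * τ
        + (2 * Real.sigmoid l - 2 * Real.sigmoid (θ + l)) * k + b)
      = (Real.sigmoid (t + (a + b)) - Real.sigmoid t - bernoulliVar t * (a + b))
        + bernoulliVar t * ρ := by
    rw [hρ]; unfold bernoulliVar; ring
  rw [this]
  refine (abs_add_le _ _).trans ?_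
  rw [abs_mul, abs_of_pos v0]
  nlinarith [abs_nonneg ρ]

/-- Expansion of one term of the efficient score around the oracle nuisance quantities. -/
lemma score_expansion {θ l e θ' l' e' r x y : ℝ} (he : e ∈ Set.Ioo (0 : ℝ) 1)
    (he' : e' ∈ Set.Ioo (0 : ℝ) 1) (hx : x ∈ Set.Icc (0 : ℝ) 1) (hy : y ∈ Set.Icc (0 : ℝ) 1)
    (hτ : |θ' - θ| ≤ r) (hk : |l' - l| ≤ r)
    (hb : |Real.log (e' / (1 - e')) - Real.log (e / (1 - e))| ≤ r) :
    |(x - varProj θ' l' e') *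
        (y - Real.sigmoid (θ * (x - varProj θ' l' e') + (θ' * varProj θ' l' e' + l')))
      - (x - varProj θ l e) * (y - Real.sigmoid (x * θ + l))
      + ((θ' - θ) * ((y - Real.sigmoid (x * θ + l)) * (varProj θ l e * (1 - varProj θ l e) *
            (1 - 2 * Real.sigmoid (θ + l)))
          + (x - varProj θ l e) * bernoulliVar (x * θ + l) * varProj θ l e)
        + (l' - l) * ((y - Real.sigmoid (x * θ + l)) * (varProj θ l e * (1 - varProj θ l e) *
            (2 * Real.sigmoid l - 2 * Real.sigmoid (θ + l)))
          + (x - varProj θ l e) * bernoulliVar (x * θ + l))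
        + (Real.log (e' / (1 - e')) - Real.log (e / (1 - e))) *
            ((y - Real.sigmoid (x * θ + l)) * (varProj θ l e * (1 - varProj θ l e))))|
      ≤ 42 * r ^ 2 := by
  have hr : 0 ≤ r := (abs_nonneg _).trans hτ
  obtain ⟨g1, g2⟩ := varProj_expansion he he' hτ hk hb
  obtain ⟨h00, h01⟩ := varProj_mem_Ioo θ l he
  obtain ⟨h10, h11⟩ := varProj_mem_Ioo θ' l' he'
  set h := varProj θ' l' e'
  set h₀ := varProj θ l e
  set b := Real.log (e' / (1 - e')) - Real.log (e / (1 - e))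
  set τ := θ' - θ with hτd
  set k := l' - l with hkd
  set η := x * θ + l
  -- At the true `θ` the fitted `φ` restores the true predictor up to `τ * h + k`, so the error in
  -- `h` does not enter the predictor at first order.
  have eη : θ * (x - h) + (θ' * h + l') = η + (τ * h + k) := by
    simp only [hτd, hkd, η]; ring
  rw [eη]
  set δ := τ * h + k
  set c := h₀ * (1 - h₀) * ((1 - 2 * Real.sigmoid (θ + l)) * τ
    + (2 * Real.sigmoid l - 2 * Real.sigmoid (θ + l)) * k + b) with hc
  have hδ : |δ| ≤ 2 * r := by
    refine (abs_add_le _ _).trans ?_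
    rw [abs_mul, abs_of_pos h10]
    nlinarith [abs_nonneg τ]
  have s1 := abs_sigmoid_taylor_le η δ
  have q1 : δ ^ 2 ≤ (2 * r) ^ 2 := sq_le_sq' (abs_le.1 hδ).1 (abs_le.1 hδ).2
  have v0 := bernoulliVar_pos η
  have v1 := bernoulliVar_le η
  have y1 : |y - Real.sigmoid η| ≤ 1 := by
    rw [abs_le]; constructor <;>
      linarith [hy.1, hy.2, Real.sigmoid_pos η, Real.sigmoid_lt_one η]
  have x1 : |x - h| ≤ 1 := by rw [abs_le]; constructor <;> linarith [hx.1, hx.2]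
  have x2 : |x - h₀| ≤ 1 := by rw [abs_le]; constructor <;> linarith [hx.1, hx.2]
  have key : ∀ A B : ℝ, |A| ≤ 1 → ∀ C, |B| ≤ C → |A * B| ≤ C := fun A B hA C hB => by
    rw [abs_mul]; nlinarith [abs_nonneg A, abs_nonneg B]
  have t1 := key _ _ y1 _ g2
  have t2 := key _ _ x1 _ (s1.trans q1)
  have t3 : |bernoulliVar η * ((h - h₀) * δ)| ≤ 8 * r ^ 2 := by
    refine key _ _ (by rw [abs_of_pos v0]; linarith) _ ?_
    rw [abs_mul]
    nlinarith [abs_nonneg (h - h₀), abs_nonneg δ]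
  have t4 : |bernoulliVar η * ((x - h₀) * (τ * (h - h₀)))| ≤ 4 * r ^ 2 := by
    refine key _ _ (by rw [abs_of_pos v0]; linarith) _ (key _ _ x2 _ ?_)
    rw [abs_mul]
    nlinarith [abs_nonneg (h - h₀), abs_nonneg τ]
  -- After removing the first-order part, four second-order pieces remain: the Taylor remainders of
  -- the projection (`26 r²`) and of the sigmoid (`4 r²`), and two products of first-order errors
  -- (`8 r²` and `4 r²`). They add up to `42 r²`.
  have : (x - h) * (y - Real.sigmoid (η + δ)) - (x - h₀) * (y - Real.sigmoid η)
      + (τ * ((y - Real.sigmoid η) * (h₀ * (1 - h₀) * (1 - 2 * Real.sigmoid (θ + l)))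
          + (x - h₀) * bernoulliVar η * h₀)
        + k * ((y - Real.sigmoid η) * (h₀ * (1 - h₀) *
            (2 * Real.sigmoid l - 2 * Real.sigmoid (θ + l))) + (x - h₀) * bernoulliVar η)
        + b * ((y - Real.sigmoid η) * (h₀ * (1 - h₀))))
      = -((y - Real.sigmoid η) * (h - h₀ - c))
        - (x - h) * (Real.sigmoid (η + δ) - Real.sigmoid η - bernoulliVar η * δ)
        + bernoulliVar η * ((h - h₀) * δ) - bernoulliVar η * ((x - h₀) * (τ * (h - h₀))) := by
    simp only [hc, δ]; ring
  rw [this]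
  rw [abs_le] at t1 t2 t3 t4 ⊢
  constructor <;> linarith [t1.1, t1.2, t2.1, t2.2, t3.1, t3.2, t4.1, t4.2]

/-- Perturbation bound for one term of the information. -/
lemma info_perturbation {θ l e θ' l' e' r x : ℝ} (he : e ∈ Set.Ioo (0 : ℝ) 1)
    (he' : e' ∈ Set.Ioo (0 : ℝ) 1) (hx : x ∈ Set.Icc (0 : ℝ) 1)
    (hτ : |θ' - θ| ≤ r) (hk : |l' - l| ≤ r)
    (hb : |Real.log (e' / (1 - e')) - Real.log (e / (1 - e))| ≤ r) :
    |(x - varProj θ' l' e') ^ 2 *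
        bernoulliVar (θ * (x - varProj θ' l' e') + (θ' * varProj θ' l' e' + l'))
      - (x - varProj θ l e) ^ 2 * bernoulliVar (x * θ + l)| ≤ 10 * r := by
  have hr : 0 ≤ r := (abs_nonneg _).trans hτ
  obtain ⟨g1, -⟩ := varProj_expansion he he' hτ hk hb
  obtain ⟨h00, h01⟩ := varProj_mem_Ioo θ l he
  obtain ⟨h10, h11⟩ := varProj_mem_Ioo θ' l' he'
  set h := varProj θ' l' e'
  set h₀ := varProj θ l e
  set τ := θ' - θ with hτd
  set k := l' - l with hkd
  set η := x * θ + l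
  have eη : θ * (x - h) + (θ' * h + l') = η + (τ * h + k) := by
    simp only [hτd, hkd, η]; ring
  rw [eη]
  set δ := τ * h + k
  have hδ : |δ| ≤ 2 * r := by
    refine (abs_add_le _ _).trans ?_
    rw [abs_mul, abs_of_pos h10]
    nlinarith [abs_nonneg τ]
  have s1 := (abs_bernoulliVar_sub_le η δ).trans hδ
  have v0 := bernoulliVar_pos η
  have v1 := bernoulliVar_le η
  have x1 : |x - h| ≤ 1 := by rw [abs_le]; constructor <;> linarith [hx.1, hx.2]
  have x2 : |x - h₀| ≤ 1 := by rw [abs_le]; constructor <;> linarith [hx.1, hx.2]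
  have x3 : |(x - h) + (x - h₀)| ≤ 2 := (abs_add_le _ _).trans (by linarith)
  have : (x - h) ^ 2 * bernoulliVar (η + δ) - (x - h₀) ^ 2 * bernoulliVar η
      = (x - h) ^ 2 * (bernoulliVar (η + δ) - bernoulliVar η)
        - bernoulliVar η * (((x - h) + (x - h₀)) * (h - h₀)) := by ring
  rw [this]
  refine (abs_sub _ _).trans ?_
  have A : |(x - h) ^ 2 * (bernoulliVar (η + δ) - bernoulliVar η)| ≤ 2 * r := by
    rw [abs_mul, abs_pow]
    have : |x - h| ^ 2 ≤ 1 := pow_le_one₀ (abs_nonneg _) x1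
    nlinarith [abs_nonneg (bernoulliVar (η + δ) - bernoulliVar η)]
  have B : |((x - h) + (x - h₀)) * (h - h₀)| ≤ 8 * r := by
    rw [abs_mul]; nlinarith [abs_nonneg (h - h₀)]
  have B' : |bernoulliVar η * (((x - h) + (x - h₀)) * (h - h₀))| ≤ 8 * r := by
    rw [abs_mul, abs_of_pos v0]; nlinarith [abs_nonneg (((x - h) + (x - h₀)) * (h - h₀))]
  linarith

/-! ### Second-order bounds for the logistic log-likelihood -/

lemma taylor_upper_of_nonneg {f f' f'' : ℝ → ℝ} (hf : ∀ x, HasDerivAt f (f' x) x)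
    (hf' : ∀ x, HasDerivAt f' (f'' x) x) {a k C : ℝ} (hk : 0 ≤ k)
    (hC : ∀ t ∈ Set.Icc 0 k, f'' (a + t) ≤ C) :
    f (a + k) ≤ f a + f' a * k + C * k ^ 2 / 2 := by
  have h1 : ∀ t ∈ Set.Icc 0 k, f' (a + t) - f' a ≤ C * t := fun t ht => by
    have := (convex_Icc a (a + k)).image_sub_le_mul_sub_of_deriv_le (f := f')
      (fun x _ => (hf' x).continuousAt.continuousWithinAt)
      (fun x _ => (hf' x).differentiableAt.differentiableWithinAt) (C := C)
      (fun x hx => by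
        rw [interior_Icc] at hx
        rw [(hf' x).deriv, show x = a + (x - a) by ring]
        exact hC _ ⟨by linarith [hx.1], by linarith [hx.2]⟩)
      a ⟨le_rfl, by linarith⟩ (a + t) ⟨by linarith [ht.1], by linarith [ht.2]⟩ (by linarith [ht.1])
    simpa using this
  have hg : ∀ x, HasDerivAt (fun x => f x - f' a * x - C / 2 * (x - a) ^ 2)
      (f' x - f' a - C * (x - a)) x := fun x => by
    have h2 := (((hasDerivAt_id' x).sub_const a).fun_pow 2).const_mul (C / 2)
    have h3 := ((hf x).fun_sub ((hasDerivAt_id' x).const_mul (f' a))).fun_sub h2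
    refine h3.congr_deriv ?_
    norm_num; ring
  have := (convex_Icc a (a + k)).image_sub_le_mul_sub_of_deriv_le
      (f := fun x => f x - f' a * x - C / 2 * (x - a) ^ 2)
      (fun x _ => (hg x).continuousAt.continuousWithinAt)
      (fun x _ => (hg x).differentiableAt.differentiableWithinAt) (C := 0)
      (fun x hx => by
        rw [interior_Icc] at hx
        rw [(hg x).deriv]
        have := h1 (x - a) ⟨by linarith [hx.1], by linarith [hx.2]⟩
        rw [add_sub_cancel] at this
        linarith)
      a ⟨le_rfl, by linarith⟩ (a + k) ⟨by linarith, le_rfl⟩ (by linarith)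
  simp only [add_sub_cancel_left, sub_self] at this
  nlinarith

lemma taylor_upper {f f' f'' : ℝ → ℝ} (hf : ∀ x, HasDerivAt f (f' x) x)
    (hf' : ∀ x, HasDerivAt f' (f'' x) x) {a k C : ℝ}
    (hC : ∀ t, |t| ≤ |k| → f'' (a + t) ≤ C) :
    f (a + k) ≤ f a + f' a * k + C * k ^ 2 / 2 := by
  rcases le_total 0 k with hk | hk
  · exact taylor_upper_of_nonneg hf hf' hk fun t ht => hC t (by
      rw [abs_of_nonneg ht.1, abs_of_nonneg hk]; exact ht.2)
  · have h1 : ∀ x, HasDerivAt (fun x => f (-x)) (-f' (-x)) x := fun x => by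
      exact ((hf (-x)).comp x (hasDerivAt_neg x)).congr_deriv (by ring)
    have h2 : ∀ x, HasDerivAt (fun x => -f' (-x)) (f'' (-x)) x := fun x => by
      exact ((hf' (-x)).comp x (hasDerivAt_neg x)).neg.congr_deriv (by ring)
    have := taylor_upper_of_nonneg h1 h2 (a := -a) (k := -k) (C := C) (by linarith)
      (fun t ht => by
        have := hC (-t) (by rw [abs_neg, abs_of_nonneg ht.1, abs_of_nonpos hk]; exact ht.2)
        rwa [show -(-a + t) = a + -t by ring])
    simpa [neg_add, add_comm k a] using this

lemma hasDerivAt_log_one_add_exp (t : ℝ) :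
    HasDerivAt (fun t => Real.log (1 + Real.exp t)) (Real.sigmoid t) t := by
  have h := ((Real.hasDerivAt_exp t).const_add 1).log (by positivity)
  refine h.congr_deriv ?_
  rw [Real.sigmoid_def, Real.exp_neg]
  field_simp
  ring

lemma log_one_add_exp_taylor_upper (η k : ℝ) :
    Real.log (1 + Real.exp (η + k)) ≤ Real.log (1 + Real.exp η) + Real.sigmoid η * k
      + bernoulliVar η * Real.exp |k| * k ^ 2 / 2 :=
  taylor_upper hasDerivAt_log_one_add_exp Real.hasDerivAt_sigmoid fun t ht =>
    (bernoulliVar_add_le η t).trans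
      (mul_le_mul_of_nonneg_left (Real.exp_le_exp.2 ht) (bernoulliVar_pos η).le)

lemma log_one_add_exp_taylor_lower (η k : ℝ) :
    Real.log (1 + Real.exp η) + Real.sigmoid η * k + bernoulliVar η * Real.exp (-|k|) * k ^ 2 / 2
      ≤ Real.log (1 + Real.exp (η + k)) := by
  have := taylor_upper (fun x => (hasDerivAt_log_one_add_exp x).neg)
    (fun x => (Real.hasDerivAt_sigmoid x).neg) (a := η) (k := k)
    (C := -(bernoulliVar η * Real.exp (-|k|))) fun t ht => neg_le_neg <|
      (mul_le_mul_of_nonneg_left (Real.exp_le_exp.2 (neg_le_neg ht)) (bernoulliVar_pos η).le).trans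
        (bernoulliVar_mul_exp_le η t)
  simp only [Pi.neg_apply] at this
  linarith

lemma hasDerivAt_condLogLik {n : ℕ} (y x h φ : Fin n → ℝ) (θ : ℝ) :
    HasDerivAt (condLogLik y x h φ)
      (∑ i, (x i - h i) * (y i - Real.sigmoid (θ * (x i - h i) + φ i))) θ := by
  unfold condLogLik logLik
  refine HasDerivAt.fun_sum fun i _ => ?_
  have h1 : HasDerivAt (fun θ : ℝ => θ * (x i - h i) + φ i) (x i - h i) θ := by
    simpa using ((hasDerivAt_id' θ).mul_const (x i - h i)).add_const (φ i)
  have h2 := (h1.const_mul (y i)).fun_sub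
    (HasDerivAt.comp θ (hasDerivAt_log_one_add_exp (θ * (x i - h i) + φ i)) h1)
  exact h2.congr_deriv (by ring)

lemma continuous_condLogLik {n : ℕ} (y x h φ : Fin n → ℝ) : Continuous (condLogLik y x h φ) :=
  continuous_iff_continuousAt.2 fun θ => (hasDerivAt_condLogLik y x h φ θ).continuousAt

lemma concaveOn_condLogLik {n : ℕ} (y x h φ : Fin n → ℝ) :
    ConcaveOn ℝ Set.univ (condLogLik y x h φ) := by
  have h1 : deriv (condLogLik y x h φ)
      = fun θ => ∑ i, (x i - h i) * (y i - Real.sigmoid (θ * (x i - h i) + φ i)) :=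
    funext fun θ => (hasDerivAt_condLogLik y x h φ θ).deriv
  have h2 : ∀ θ, HasDerivAt (deriv (condLogLik y x h φ))
      (∑ i, -((x i - h i) ^ 2 * bernoulliVar (θ * (x i - h i) + φ i))) θ := fun θ => by
    rw [h1]
    refine HasDerivAt.fun_sum fun i _ => ?_
    have h1 : HasDerivAt (fun θ : ℝ => θ * (x i - h i) + φ i) (x i - h i) θ := by
      simpa using ((hasDerivAt_id' θ).mul_const (x i - h i)).add_const (φ i)
    have h2 := ((HasDerivAt.comp θ (Real.hasDerivAt_sigmoid _) h1).const_sub (y i)).const_mul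
      (x i - h i)
    exact h2.congr_deriv (by unfold bernoulliVar; ring)
  refine concaveOn_univ_of_deriv2_nonpos
    (fun θ => (hasDerivAt_condLogLik y x h φ θ).differentiableAt)
    (fun θ => (h2 θ).differentiableAt) fun θ => ?_
  simp only [Function.iterate_succ, Function.iterate_zero, Function.comp, id]
  rw [(h2 θ).deriv]
  exact Finset.sum_nonpos fun i _ => neg_nonpos.2 (mul_nonneg (sq_nonneg _) (bernoulliVar_pos _).le)

/-- Self-concordance applied to each term; weights of size at most `1` let `exp |(x i - h i) * k|`
be replaced by `exp |k|`. Together with concavity, this sandwich through the score and the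
information at a single point is all that the Bernstein-von Mises argument needs from the
likelihood. -/
lemma condLogLik_bounds {n : ℕ} {y x h φ : Fin n → ℝ} (ha : ∀ i, |x i - h i| ≤ 1) (θ k : ℝ) :
    (∑ i, (x i - h i) * (y i - Real.sigmoid (θ * (x i - h i) + φ i))) * k
        - (∑ i, (x i - h i) ^ 2 * bernoulliVar (θ * (x i - h i) + φ i)) * Real.exp |k| * k ^ 2 / 2
      ≤ condLogLik y x h φ (θ + k) - condLogLik y x h φ θ ∧
    condLogLik y x h φ (θ + k) - condLogLik y x h φ θ ≤
      (∑ i, (x i - h i) * (y i - Real.sigmoid (θ * (x i - h i) + φ i))) * k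
        - (∑ i, (x i - h i) ^ 2 * bernoulliVar (θ * (x i - h i) + φ i))
          * Real.exp (-|k|) * k ^ 2 / 2 := by
  unfold condLogLik logLik
  simp only [Finset.sum_mul, Finset.sum_div]
  rw [← Finset.sum_sub_distrib, ← Finset.sum_sub_distrib, ← Finset.sum_sub_distrib]
  constructor
  · refine Finset.sum_le_sum fun i _ => ?_
    have h1 := log_one_add_exp_taylor_upper (θ * (x i - h i) + φ i) ((x i - h i) * k)
    have h2 : Real.exp |(x i - h i) * k| ≤ Real.exp |k| := Real.exp_le_exp.2 (by
      rw [abs_mul]; exact mul_le_of_le_one_left (abs_nonneg _) (ha i))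
    have h3 : bernoulliVar (θ * (x i - h i) + φ i) * Real.exp |(x i - h i) * k|
        * ((x i - h i) * k) ^ 2 ≤ bernoulliVar (θ * (x i - h i) + φ i) * Real.exp |k|
        * ((x i - h i) * k) ^ 2 := by
      have := (bernoulliVar_pos (θ * (x i - h i) + φ i)).le
      gcongr
    rw [show (θ + k) * (x i - h i) + φ i = θ * (x i - h i) + φ i + (x i - h i) * k by ring]
    nlinarith
  · refine Finset.sum_le_sum fun i _ => ?_
    have h1 := log_one_add_exp_taylor_lower (θ * (x i - h i) + φ i) ((x i - h i) * k)
    have h2 : Real.exp (-|k|) ≤ Real.exp (-|(x i - h i) * k|) := Real.exp_le_exp.2 (neg_le_neg (by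
      rw [abs_mul]; exact mul_le_of_le_one_left (abs_nonneg _) (ha i)))
    have h3 : bernoulliVar (θ * (x i - h i) + φ i) * Real.exp (-|k|)
        * ((x i - h i) * k) ^ 2 ≤ bernoulliVar (θ * (x i - h i) + φ i)
        * Real.exp (-|(x i - h i) * k|) * ((x i - h i) * k) ^ 2 := by
      have := (bernoulliVar_pos (θ * (x i - h i) + φ i)).le
      gcongr
    rw [show (θ + k) * (x i - h i) + φ i = θ * (x i - h i) + φ i + (x i - h i) * k by ring]
    nlinarith

/-! ### One-dimensional Bernstein-von Mises theorem -/

/-- The point at distance `δ` in the direction of `h` is a convex combination of `x` and `x + h`, so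
a drop reached at distance `δ` is not undone farther out. This controls the tails of the likelihood,
where the quadratic bound is useless. -/
lemma ConcaveOn.le_of_le_at_dist {f : ℝ → ℝ} (hf : ConcaveOn ℝ Set.univ f) {x δ m : ℝ}
    (hδ : 0 < δ) (hm : 0 ≤ m) (h1 : f (x + δ) - f x ≤ -m) (h2 : f (x - δ) - f x ≤ -m)
    {h : ℝ} (hh : δ ≤ |h|) : f (x + h) - f x ≤ -m := by
  have hpos : 0 < |h| := hδ.trans_le hh
  have hq : δ / |h| ≤ 1 := (div_le_one hpos).2 hh
  have hq0 : 0 < δ / |h| := by positivity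
  have := hf.2 (Set.mem_univ (x + h)) (Set.mem_univ x) hq0.le (sub_nonneg.2 hq) (by ring)
  simp only [smul_eq_mul] at this
  have e : δ / |h| * (x + h) + (1 - δ / |h|) * x = x + δ / |h| * h := by ring
  rw [e] at this
  have h3 : f (x + δ / |h| * h) - f x ≤ -m := by
    rcases le_total 0 h with h0 | h0
    · rw [abs_of_nonneg h0] at hpos ⊢
      rwa [div_mul_cancel₀ _ hpos.ne']
    · rw [abs_of_nonpos h0] at hpos ⊢
      rw [div_neg, neg_mul, div_mul_cancel₀ _ (by linarith), ← sub_eq_add_neg]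
      exact h2
  by_contra! hc
  have : δ / |h| * (f (x + h) - f x) ≤ -m := by linarith
  nlinarith

section Limit

variable {π : ℝ → ℝ} {θ₀ : ℝ} {ℓ : ℕ → ℝ → ℝ} {S J I : ℕ → ℝ} {W : ℝ} {A : Set ℝ}

/-- Laplace's method near `θ₀`: rescale by `√I`, squeeze the integrand between two expressions with
the same limit, and dominate it by a Gaussian. The set `A` is invariant under positive scaling, so
rescaling does not move it; it will be `Set.Iic 0` for the numerator and `Set.univ` for the
normalizing constant. -/
lemma tendsto_integral_local_posterior (hπ_meas : Measurable π) (hπ_nonneg : ∀ t, 0 ≤ π t)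
    (hπ_cont : ContinuousAt π θ₀)
    (hℓ : ∀ k, Continuous (ℓ k))
    (hlow : ∀ k h, S k * h - J k * Real.exp |h| * h ^ 2 / 2 ≤ ℓ k (θ₀ + h) - ℓ k θ₀)
    (hup : ∀ k h, ℓ k (θ₀ + h) - ℓ k θ₀ ≤ S k * h - J k * Real.exp (-|h|) * h ^ 2 / 2)
    (hI : Tendsto I atTop atTop) (hJ : Tendsto (fun k => J k / I k) atTop (𝓝 1))
    (hS : Tendsto (fun k => S k / √(I k)) atTop (𝓝 W))
    (hA : MeasurableSet A) (hAc : ∀ c > 0, ∀ t, t / c ∈ A ↔ t ∈ A)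
    {δ : ℝ} (hδ : 0 < δ) (hδ1 : δ ≤ 1) (hπδ : ∀ h, |h| ≤ δ → π (θ₀ + h) ≤ π θ₀ + 1) :
    Tendsto (fun k => √(I k) * ∫ h, {h | h ∈ A ∧ |h| ≤ δ}.indicator
        (fun h => π (θ₀ + h) * Real.exp (ℓ k (θ₀ + h) - ℓ k θ₀)) h) atTop
      (𝓝 (∫ t, A.indicator (fun t => π θ₀ * Real.exp (W * t - t ^ 2 / 2)) t)) := by
  have hI0 : ∀ᶠ k in atTop, 0 < I k := hI.eventually_gt_atTop 0
  have hsq : Tendsto (fun k => √(I k)) atTop atTop := Real.tendsto_sqrt_atTop.comp hI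
  have hset : MeasurableSet {h | h ∈ A ∧ |h| ≤ δ} :=
    hA.inter (measurableSet_le continuous_abs.measurable measurable_const)
  have hmeas : ∀ k, Measurable ({h | h ∈ A ∧ |h| ≤ δ}.indicator
        (fun h => π (θ₀ + h) * Real.exp (ℓ k (θ₀ + h) - ℓ k θ₀))) := fun k => by
    have := (hℓ k).measurable
    exact Measurable.indicator (by fun_prop) hset
  have e1 : ∀ᶠ k in atTop, ∫ t, {h | h ∈ A ∧ |h| ≤ δ}.indicator
        (fun h => π (θ₀ + h) * Real.exp (ℓ k (θ₀ + h) - ℓ k θ₀)) (t / √(I k))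
      = √(I k) * ∫ h, {h | h ∈ A ∧ |h| ≤ δ}.indicator
        (fun h => π (θ₀ + h) * Real.exp (ℓ k (θ₀ + h) - ℓ k θ₀)) h := by
    filter_upwards with k
    rw [Measure.integral_comp_div, abs_of_nonneg (Real.sqrt_nonneg _), smul_eq_mul]
  refine Tendsto.congr' e1 ?_
  set K := |W| + 1
  -- For `|h| ≤ δ ≤ 1` and `J / I ≥ 1/2` the quadratic term is at least `c t²`. Half of it absorbs
  -- the linear term `K |t|` at the price of `K² / (2c)`, and the other half is the Gaussian
  -- envelope.
  set c := Real.exp (-1) / 4 with hc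
  have hcpos : 0 < c := by positivity
  have key : ∀ k, 0 < I k → ∀ t, S k * (t / √(I k)) = S k / √(I k) * t ∧
      J k * (t / √(I k)) ^ 2 = J k / I k * t ^ 2 := fun k hk t => by
    constructor
    · ring
    · rw [div_pow, Real.sq_sqrt hk.le]; ring
  refine tendsto_integral_filter_of_dominated_convergence
    (fun t => (π θ₀ + 1) * Real.exp (K ^ 2 / (2 * c)) * Real.exp (-(c / 2) * t ^ 2)) ?_ ?_ ?_ ?_
  · exact Eventually.of_forall fun k =>
      ((hmeas k).comp (measurable_id.div_const _)).aestronglyMeasurable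
  · have hK : ∀ᶠ k in atTop, |S k / √(I k)| < K :=
      (hS.abs).eventually_lt_const (by simp [K])
    have hJ2 : ∀ᶠ k in atTop, 1 / 2 < J k / I k := hJ.eventually_const_lt (by norm_num)
    filter_upwards [hI0, hK, hJ2] with k h0 h1 h2
    refine Eventually.of_forall fun t => ?_
    have hπ1 : 0 ≤ π θ₀ + 1 := by linarith [hπ_nonneg θ₀]
    by_cases ht : t / √(I k) ∈ {h | h ∈ A ∧ |h| ≤ δ}
    · rw [Set.indicator_of_mem ht, Real.norm_of_nonneg (mul_nonneg (hπ_nonneg _)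
        (Real.exp_pos _).le), mul_assoc, ← Real.exp_add]
      refine mul_le_mul (hπδ _ ht.2) (Real.exp_le_exp.2 ((hup k _).trans ?_))
        (Real.exp_pos _).le hπ1
      obtain ⟨k1, k2⟩ := key k h0 t
      have hexp : Real.exp (-1) ≤ Real.exp (-|t / √(I k)|) :=
        Real.exp_le_exp.2 (by linarith [ht.2])
      have hsqn : 0 ≤ J k / I k * t ^ 2 := by nlinarith [sq_nonneg t]
      have a1 : S k / √(I k) * t ≤ K * |t| := (le_abs_self _).trans (by
        rw [abs_mul]; gcongr)
      have a2 : c * t ^ 2 ≤ J k * Real.exp (-|t / √(I k)|) * (t / √(I k)) ^ 2 / 2 := by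
        have : J k * Real.exp (-|t / √(I k)|) * (t / √(I k)) ^ 2
          = Real.exp (-|t / √(I k)|) * (J k / I k * t ^ 2) := by rw [← k2]; ring
        rw [this]
        have := mul_le_mul_of_nonneg_right hexp hsqn
        have h4 : 1 / 2 * t ^ 2 ≤ J k / I k * t ^ 2 := by gcongr
        have := mul_le_mul_of_nonneg_left h4 (Real.exp_pos (-1)).le
        rw [hc]; linarith
      have a3 : K * |t| ≤ K ^ 2 / (2 * c) + c / 2 * t ^ 2 := by
        have : 0 ≤ (K - c * |t|) ^ 2 / (2 * c) := by positivity
        have e : (K - c * |t|) ^ 2 / (2 * c) = K ^ 2 / (2 * c) - K * |t| + c / 2 * |t| ^ 2 := by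
          field_simp; ring
        rw [e, sq_abs] at this; linarith
      rw [k1]; linarith
    · rw [Set.indicator_of_notMem ht, norm_zero]; positivity
  · exact (integrable_exp_neg_mul_sq (by positivity)).const_mul _
  · refine Eventually.of_forall fun t => ?_
    have hlim0 : Tendsto (fun k => t / √(I k)) atTop (𝓝 0) := hsq.const_div_atTop t
    have hsmall : ∀ᶠ k in atTop, |t / √(I k)| ≤ δ :=
      ((hlim0.abs).eventually_lt_const (by simpa using hδ)).mono fun k hk => hk.le
    by_cases ht : t ∈ A
    · rw [Set.indicator_of_mem ht]
      have hev : ∀ᶠ k in atTop, π (θ₀ + t / √(I k)) *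
            Real.exp (ℓ k (θ₀ + t / √(I k)) - ℓ k θ₀) = {h | h ∈ A ∧ |h| ≤ δ}.indicator
            (fun h => π (θ₀ + h) * Real.exp (ℓ k (θ₀ + h) - ℓ k θ₀)) (t / √(I k)) := by
        filter_upwards [hsmall, hI0] with k hk h0
        rw [Set.indicator_of_mem]
        exact ⟨(hAc _ (Real.sqrt_pos.2 h0) t).2 ht, hk⟩
      refine Tendsto.congr' hev (Tendsto.mul ?_ ?_)
      · exact hπ_cont.tendsto.comp (by simpa using hlim0.const_add θ₀)
      · refine (Real.continuous_exp.tendsto _).comp ?_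
        -- The lower and upper bounds differ only in the sign `s` of the exponent, so one limit
        -- serves both sides of the squeeze.
        have lim : ∀ s : ℝ, Tendsto (fun k => S k / √(I k) * t -
            J k / I k * t ^ 2 * Real.exp (s * |t / √(I k)|) / 2) atTop
            (𝓝 (W * t - t ^ 2 / 2)) := fun s => by
          have h1 := hlim0.abs.const_mul s
          have h2 := (Real.continuous_exp.tendsto _).comp h1
          have h3 := (hS.mul_const t).sub (((hJ.mul_const (t ^ 2)).mul h2).div_const 2)
          simpa using h3
        refine tendsto_of_tendsto_of_tendsto_of_le_of_le' (lim 1) (lim (-1)) ?_ ?_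
        · filter_upwards [hI0] with k h0
          obtain ⟨k1, k2⟩ := key k h0 t
          have := hlow k (t / √(I k))
          rw [k1] at this
          rw [← k2, one_mul]; linarith
        · filter_upwards [hI0] with k h0
          obtain ⟨k1, k2⟩ := key k h0 t
          have := hup k (t / √(I k))
          rw [k1] at this
          rw [← k2, neg_one_mul]; linarith
    · rw [Set.indicator_of_notMem ht]
      refine tendsto_const_nhds.congr' ?_
      filter_upwards [hI0] with k h0
      rw [Set.indicator_of_notMem]
      exact fun h => ht ((hAc _ (Real.sqrt_pos.2 h0) t).1 h.1)

/-- Beyond distance `δ`, concavity keeps the log-likelihood ratio below `-c I`. That region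
contributes at most `√I * exp (-c I)` times the prior mass, which vanishes, so only the local
integral survives. -/
lemma tendsto_integral_posterior (hπ_meas : Measurable π) (hπ_nonneg : ∀ t, 0 ≤ π t)
    (hπ_int : Integrable π) (hπ_cont : ContinuousAt π θ₀)
    (hℓ : ∀ k, Continuous (ℓ k)) (hconc : ∀ k, ConcaveOn ℝ Set.univ (ℓ k))
    (hlow : ∀ k h, S k * h - J k * Real.exp |h| * h ^ 2 / 2 ≤ ℓ k (θ₀ + h) - ℓ k θ₀)
    (hup : ∀ k h, ℓ k (θ₀ + h) - ℓ k θ₀ ≤ S k * h - J k * Real.exp (-|h|) * h ^ 2 / 2)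
    (hI : Tendsto I atTop atTop) (hJ : Tendsto (fun k => J k / I k) atTop (𝓝 1))
    (hS : Tendsto (fun k => S k / √(I k)) atTop (𝓝 W))
    (hA : MeasurableSet A) (hAc : ∀ c > 0, ∀ t, t / c ∈ A ↔ t ∈ A) :
    Tendsto (fun k => √(I k) * ∫ h, A.indicator
        (fun h => π (θ₀ + h) * Real.exp (ℓ k (θ₀ + h) - ℓ k θ₀)) h) atTop
      (𝓝 (∫ t, A.indicator (fun t => π θ₀ * Real.exp (W * t - t ^ 2 / 2)) t)) := by
  obtain ⟨δ, hδ, hδ1, hπδ⟩ : ∃ δ > 0, δ ≤ 1 ∧ ∀ h, |h| ≤ δ → π (θ₀ + h) ≤ π θ₀ + 1 := by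
    obtain ⟨ε, hε, h⟩ := Metric.continuousAt_iff.1 hπ_cont 1 one_pos
    refine ⟨min (ε / 2) 1, by positivity, min_le_right _ _, fun k hk => ?_⟩
    have := h (x := θ₀ + k) (by
      simpa using (hk.trans (min_le_left _ _)).trans_lt (half_lt_self hε))
    rw [Real.dist_eq] at this
    linarith [(abs_lt.1 this).2]
  have hloc := tendsto_integral_local_posterior hπ_meas hπ_nonneg hπ_cont hℓ hlow hup hI hJ hS hA
    hAc hδ hδ1 hπδ
  have hsq : Tendsto (fun k => √(I k)) atTop atTop := Real.tendsto_sqrt_atTop.comp hI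
  -- At distance `δ` the quadratic term is at least `2 c I` once `J / I ≥ 1/2`, while the linear
  -- term is at most `K δ √I ≤ c I` for large `I`; a drop of `c I` is left.
  set c := Real.exp (-1) * δ ^ 2 / 8 with hc
  have hcpos : 0 < c := by positivity
  set K := |W| + 1
  have hK : ∀ᶠ k in atTop, |S k / √(I k)| < K := (hS.abs).eventually_lt_const (by simp [K])
  have hJ2 : ∀ᶠ k in atTop, 1 / 2 < J k / I k := hJ.eventually_const_lt (by norm_num)
  have htail : ∀ᶠ k in atTop, ∀ h, δ ≤ |h| → ℓ k (θ₀ + h) - ℓ k θ₀ ≤ -(c * I k) := by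
    filter_upwards [hI.eventually_gt_atTop 0, hK, hJ2, hsq.eventually_ge_atTop (K * δ / c)]
      with k h0 h1 h2 h3 h hh
    have hs0 : 0 < √(I k) := Real.sqrt_pos.2 h0
    have hJk : I k / 2 ≤ J k := by rw [lt_div_iff₀ h0] at h2; linarith
    have hJ0 : 0 ≤ J k := by linarith
    have hSk : |S k| ≤ K * √(I k) := by
      rw [abs_div, abs_of_pos hs0, div_lt_iff₀ hs0] at h1; exact h1.le
    have hexp : Real.exp (-1) ≤ Real.exp (-δ) := Real.exp_le_exp.2 (by linarith)
    have hKδ : K * δ * √(I k) ≤ c * I k := by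
      rw [div_le_iff₀ hcpos] at h3
      calc K * δ * √(I k) ≤ √(I k) * c * √(I k) := by gcongr
        _ = c * (√(I k) * √(I k)) := by ring
        _ = _ := by rw [Real.mul_self_sqrt h0.le]
    have hq : c * I k * 2 ≤ J k * Real.exp (-δ) * δ ^ 2 / 2 := by
      calc c * I k * 2 = (I k / 2) * Real.exp (-1) * δ ^ 2 / 2 := by rw [hc]; ring
        _ ≤ _ := by gcongr
    refine ConcaveOn.le_of_le_at_dist (hconc k) hδ (by positivity) ?_ ?_ hh
    · have := hup k δ
      rw [abs_of_pos hδ] at this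
      have h5 : S k * δ ≤ K * √(I k) * δ := by
        gcongr; exact (le_abs_self _).trans hSk
      nlinarith
    · have := hup k (-δ)
      rw [abs_neg, abs_of_pos hδ, ← sub_eq_add_neg, neg_sq] at this
      have h5 : S k * (-δ) ≤ K * √(I k) * δ := by
        have : -S k ≤ K * √(I k) := (neg_le_abs _).trans hSk
        nlinarith
      nlinarith
  have hset1 : MeasurableSet {h : ℝ | h ∈ A ∧ |h| ≤ δ} :=
    hA.inter (measurableSet_le continuous_abs.measurable measurable_const)
  have hset2 : MeasurableSet {h : ℝ | h ∈ A ∧ δ < |h|} :=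
    hA.inter (measurableSet_lt measurable_const continuous_abs.measurable)
  have hπs : Integrable fun h => π (θ₀ + h) := hπ_int.comp_add_left θ₀
  have hfm : ∀ k, Measurable fun h => π (θ₀ + h) * Real.exp (ℓ k (θ₀ + h) - ℓ k θ₀) := fun k => by
    have := (hℓ k).measurable
    fun_prop
  have hfar : Tendsto (fun k => √(I k) * ∫ h, {h | h ∈ A ∧ δ < |h|}.indicator
        (fun h => π (θ₀ + h) * Real.exp (ℓ k (θ₀ + h) - ℓ k θ₀)) h) atTop (𝓝 0) := by
    have hbound : Tendsto (fun k => (√(I k) * Real.exp (-(c * I k))) * ∫ h, π (θ₀ + h))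
        atTop (𝓝 0) := by
      have h1 : Tendsto (fun x : ℝ => x ^ ((1 : ℝ) / 2) * Real.exp (-c * x)) atTop (𝓝 0) :=
        tendsto_rpow_mul_exp_neg_mul_atTop_nhds_zero _ _ hcpos
      have h2 := (h1.comp hI).mul_const (∫ h, π (θ₀ + h))
      rw [zero_mul] at h2
      refine h2.congr fun k => ?_
      simp only [Function.comp, Real.sqrt_eq_rpow, neg_mul]
    refine squeeze_zero' (Eventually.of_forall fun k => mul_nonneg (Real.sqrt_nonneg _)
      (integral_nonneg fun h => Set.indicator_nonneg (fun _ _ => mul_nonneg (hπ_nonneg _)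
        (Real.exp_pos _).le) _)) ?_ hbound
    filter_upwards [htail] with k hk
    rw [mul_assoc]
    refine mul_le_mul_of_nonneg_left ?_ (Real.sqrt_nonneg _)
    rw [← integral_const_mul]
    refine integral_mono_of_nonneg (Eventually.of_forall fun h =>
      Set.indicator_nonneg (fun _ _ => mul_nonneg (hπ_nonneg _) (Real.exp_pos _).le) _)
      (hπs.const_mul _) (Eventually.of_forall fun h => ?_)
    refine Set.indicator_apply_le' (fun hh => ?_) fun _ => mul_nonneg (Real.exp_pos _).le
      (hπ_nonneg _)
    rw [mul_comm]
    exact mul_le_mul_of_nonneg_right (Real.exp_le_exp.2 (hk h hh.2.le)) (hπ_nonneg _)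
  have := hloc.add hfar
  rw [add_zero] at this
  refine this.congr' ?_
  filter_upwards [htail, hI.eventually_gt_atTop 0, hJ2] with k hk h0 h2
  have hJk : 0 ≤ J k := by
    rw [lt_div_iff₀ h0] at h2; linarith
  rw [← mul_add, ← integral_add]
  · congr 2
    ext h
    by_cases hh : h ∈ A
    · rcases le_or_gt |h| δ with h1 | h1
      · rw [Set.indicator_of_mem (s := {h | h ∈ A ∧ |h| ≤ δ}) ⟨hh, h1⟩,
          Set.indicator_of_notMem (s := {h | h ∈ A ∧ δ < |h|}) (fun h2 => absurd h2.2 h1.not_gt),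
          Set.indicator_of_mem hh, add_zero]
      · rw [Set.indicator_of_notMem (s := {h | h ∈ A ∧ |h| ≤ δ}) (fun h2 => absurd h2.2 h1.not_ge),
          Set.indicator_of_mem (s := {h | h ∈ A ∧ δ < |h|}) ⟨hh, h1⟩,
          Set.indicator_of_mem hh, zero_add]
    · rw [Set.indicator_of_notMem (s := {h | h ∈ A ∧ |h| ≤ δ}) (fun h2 => hh h2.1),
        Set.indicator_of_notMem (s := {h | h ∈ A ∧ δ < |h|}) (fun h2 => hh h2.1),
        Set.indicator_of_notMem hh, add_zero]
  · refine (hπs.const_mul (Real.exp (|S k| * δ))).mono'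
      ((hfm k).indicator hset1).aestronglyMeasurable (Eventually.of_forall fun h => ?_)
    rw [Real.norm_of_nonneg (Set.indicator_nonneg (fun _ _ => mul_nonneg (hπ_nonneg _)
        (Real.exp_pos _).le) _)]
    refine Set.indicator_apply_le' (fun hh => ?_) fun _ => mul_nonneg (Real.exp_pos _).le
      (hπ_nonneg _)
    rw [mul_comm]
    refine mul_le_mul_of_nonneg_right (Real.exp_le_exp.2 ((hup k h).trans ?_)) (hπ_nonneg _)
    have a1 : S k * h ≤ |S k| * δ := (le_abs_self _).trans (by
      rw [abs_mul]; exact mul_le_mul_of_nonneg_left hh.2 (abs_nonneg _))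
    have a2 : 0 ≤ J k * Real.exp (-|h|) * h ^ 2 / 2 := by positivity
    linarith
  · refine (hπs.const_mul (Real.exp (-(c * I k)))).mono'
      ((hfm k).indicator hset2).aestronglyMeasurable (Eventually.of_forall fun h => ?_)
    rw [Real.norm_of_nonneg (Set.indicator_nonneg (fun _ _ => mul_nonneg (hπ_nonneg _)
        (Real.exp_pos _).le) _)]
    refine Set.indicator_apply_le' (fun hh => ?_) fun _ => mul_nonneg (Real.exp_pos _).le
      (hπ_nonneg _)
    rw [mul_comm]
    exact mul_le_mul_of_nonneg_right (Real.exp_le_exp.2 (hk h hh.2.le)) (hπ_nonneg _)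

end Limit

/-- The standard normal distribution function. -/
noncomputable def stdCdf (x : ℝ) : ℝ := (gaussianReal 0 1).real (Set.Iic x)

lemma exp_tilt_eq_gaussianPDFReal (W t : ℝ) :
    Real.exp (W * t - t ^ 2 / 2)
      = Real.exp (W ^ 2 / 2) * √(2 * Real.pi) * gaussianPDFReal W 1 t := by
  rw [gaussianPDFReal]
  have : √(2 * Real.pi) ≠ 0 := by positivity
  simp only [NNReal.coe_one, mul_one]
  field_simp
  rw [← Real.exp_add]
  congr 1
  ring

lemma setIntegral_gaussianPDFReal_Iic (W : ℝ) :
    ∫ t in Set.Iic 0, gaussianPDFReal W 1 t = stdCdf (-W) := by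
  have h := gaussianReal_apply_eq_integral W one_ne_zero (Set.Iic 0)
  have h2 : stdCdf (-W) = (gaussianReal W 1).real (Set.Iic 0) := by
    have := gaussianReal_map_add_const (μ := 0) (v := 1) W
    rw [zero_add] at this
    rw [← this, map_measureReal_apply (by fun_prop) measurableSet_Iic, stdCdf]
    congr 1
    ext t
    simp [le_neg_iff_add_nonpos_right]
  rw [h2, measureReal_def, h, ENNReal.toReal_ofReal]
  exact integral_nonneg fun t => gaussianPDFReal_nonneg _ _ _

/-- Completing the square, the rescaled limit posterior is normal with mean `W` and variance `1`;
its mass on the negative half-line is `Φ(-W)`. -/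
lemma tilted_gaussian_ratio {c : ℝ} (hc : 0 < c) (W : ℝ) :
    (∫ t, (Set.Iic 0).indicator (fun t => c * Real.exp (W * t - t ^ 2 / 2)) t) /
      ∫ t, (Set.univ).indicator (fun t => c * Real.exp (W * t - t ^ 2 / 2)) t = stdCdf (-W) := by
  rw [Set.indicator_univ]
  simp_rw [exp_tilt_eq_gaussianPDFReal]
  rw [integral_indicator measurableSet_Iic]
  simp_rw [integral_const_mul]
  rw [integral_gaussianPDFReal_eq_one _ one_ne_zero, setIntegral_gaussianPDFReal_Iic]
  have : √(2 * Real.pi) ≠ 0 := by positivity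
  field_simp

lemma tilted_gaussian_integral_pos {c : ℝ} (hc : 0 < c) (W : ℝ) :
    0 < ∫ t, (Set.univ).indicator (fun t => c * Real.exp (W * t - t ^ 2 / 2)) t := by
  rw [Set.indicator_univ]
  simp_rw [exp_tilt_eq_gaussianPDFReal]
  simp_rw [integral_const_mul]
  rw [integral_gaussianPDFReal_eq_one _ one_ne_zero]
  positivity

lemma continuous_measureReal_Iic (μ : Measure ℝ) [IsFiniteMeasure μ] (hμ : ∀ x, μ {x} = 0) :
    Continuous fun x => μ.real (Set.Iic x) := by
  have e : (fun x => μ.real (Set.Iic x)) = fun x => ∫ t, (Set.Iic x).indicator 1 t ∂μ :=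
    funext fun x => (integral_indicator_one measurableSet_Iic).symm
  rw [e, continuous_iff_continuousAt]
  intro x
  refine tendsto_integral_filter_of_dominated_convergence (fun _ => 1)
    (Eventually.of_forall fun y => (measurable_one.indicator measurableSet_Iic).aestronglyMeasurable)
    (Eventually.of_forall fun y => Eventually.of_forall fun t => ?_) (integrable_const 1) ?_
  · by_cases h : t ∈ Set.Iic y <;> simp [h]
  · have : ∀ᵐ t ∂μ, t ≠ x := by
      rw [ae_iff]; simpa using hμ x
    filter_upwards [this] with t ht
    refine tendsto_const_nhds.congr' ?_
    rcases lt_or_gt_of_ne ht with h | h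
    · filter_upwards [eventually_gt_nhds h] with y hy
      rw [Set.indicator_of_mem (Set.mem_Iic.2 h.le), Set.indicator_of_mem (Set.mem_Iic.2 hy.le)]
    · filter_upwards [eventually_lt_nhds h] with y hy
      rw [Set.indicator_of_notMem (by simpa using h), Set.indicator_of_notMem (by simpa using hy)]

lemma gaussianReal_singleton (x : ℝ) : gaussianReal 0 1 {x} = 0 := by
  rw [gaussianReal_apply _ one_ne_zero]; simp

lemma continuous_stdCdf : Continuous stdCdf :=
  continuous_measureReal_Iic _ gaussianReal_singleton

lemma gaussianReal_real_Ioc {a b : ℝ} (hab : a ≤ b) :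
    (gaussianReal 0 1).real (Set.Ioc a b) = stdCdf b - stdCdf a := by
  rw [stdCdf, stdCdf, ← measureReal_sdiff (Set.Iic_subset_Iic.2 hab) measurableSet_Iic]
  congr 1
  ext t
  simp [and_comm]

lemma strictMono_stdCdf : StrictMono stdCdf := by
  intro a b hab
  rw [← sub_pos, ← gaussianReal_real_Ioc hab.le, measureReal_def, ENNReal.toReal_pos_iff]
  refine ⟨pos_iff_ne_zero.2 fun h => ?_, measure_lt_top _ _⟩
  have h2 := gaussianReal_absolutelyContinuous' 0 one_ne_zero h
  rw [Real.volume_Ioc, ENNReal.ofReal_eq_zero] at h2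
  linarith

lemma exists_stdCdf_eq {p : ℝ} (hp : p ∈ Set.Ioo (0 : ℝ) 1) : ∃ z, stdCdf z = p := by
  have e : stdCdf = cdf (gaussianReal 0 1) := funext fun x => (cdf_eq_real _ x).symm
  have h0 : Tendsto stdCdf atBot (𝓝 0) := e ▸ tendsto_cdf_atBot _
  have h1 : Tendsto stdCdf atTop (𝓝 1) := e ▸ tendsto_cdf_atTop _
  obtain ⟨a, ha⟩ := (h0.eventually_lt_const hp.1).exists
  obtain ⟨b, hb⟩ := (h1.eventually_const_lt hp.2).exists
  exact mem_range_of_exists_le_of_exists_ge continuous_stdCdf ⟨a, ha.le⟩ ⟨b, hb.le⟩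

/-- Translate by `θ₀` and cancel `exp (ℓ θ₀)`. The free factor `c`, later `√I`, gives numerator and
denominator the normalization under which each has a limit. -/
lemma setIntegral_condDensity_eq {n : ℕ} (π : ℝ → ℝ) (y x h φ : Fin n → ℝ) (θ₀ : ℝ) {c : ℝ}
    (hc : c ≠ 0) :
    ∫ θ in Set.Iic θ₀, condDensity π y x h φ θ
      = (c * ∫ t, (Set.Iic 0).indicator (fun t => π (θ₀ + t) *
          Real.exp (condLogLik y x h φ (θ₀ + t) - condLogLik y x h φ θ₀)) t) /
        (c * ∫ t, (Set.univ).indicator (fun t => π (θ₀ + t) *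
          Real.exp (condLogLik y x h φ (θ₀ + t) - condLogLik y x h φ θ₀)) t) := by
  set ℓ := condLogLik y x h φ
  have key : ∀ A B : Set ℝ, MeasurableSet A → MeasurableSet B → (∀ t, θ₀ + t ∈ A ↔ t ∈ B) →
      ∫ θ in A, π θ * Real.exp (ℓ θ) = Real.exp (ℓ θ₀) * ∫ t, B.indicator (fun t => π (θ₀ + t) *
          Real.exp (ℓ (θ₀ + t) - ℓ θ₀)) t := by
    intro A B hA hB h
    rw [← integral_indicator hA, ← integral_const_mul,
      ← integral_add_left_eq_self (fun θ => A.indicator (fun θ => π θ * Real.exp (ℓ θ)) θ) θ₀]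
    refine integral_congr_ae (Eventually.of_forall fun t => ?_)
    by_cases ht : t ∈ B
    · simp only [Set.indicator_of_mem ht, Set.indicator_of_mem ((h t).2 ht)]
      rw [Real.exp_sub]
      field_simp
    · simp only [Set.indicator_of_notMem ht, Set.indicator_of_notMem (fun h1 => ht ((h t).1 h1)),
        mul_zero]
  unfold condDensity
  rw [integral_div, key _ (Set.Iic 0) measurableSet_Iic measurableSet_Iic (by simp)]
  have h2 := key Set.univ Set.univ MeasurableSet.univ MeasurableSet.univ (by simp)
  rw [setIntegral_univ] at h2
  rw [h2, mul_div_mul_left _ _ (Real.exp_pos _).ne', mul_div_mul_left _ _ hc]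

/-- The conditional posterior of `θ` is approximately normal, uniformly over the data and over the
values of the nuisance quantities. -/
theorem condDensity_cdf_approx {π : ℝ → ℝ} {θ₀ : ℝ} (hπ_meas : Measurable π)
    (hπ_nonneg : ∀ t, 0 ≤ π t) (hπ_int : Integrable π) (hπ_cont : ContinuousAt π θ₀)
    (hπ_pos : 0 < π θ₀) {ε : ℝ} (hε : 0 < ε) (K : ℝ) :
    ∃ δ > 0, ∀ (n : ℕ) (y x h φ : Fin n → ℝ) (I W : ℝ), (∀ i, |x i - h i| ≤ 1) → 1 / δ ≤ I →
      |(∑ i, (x i - h i) ^ 2 * bernoulliVar (θ₀ * (x i - h i) + φ i)) - I| ≤ δ * I →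
      |(∑ i, (x i - h i) * (y i - Real.sigmoid (θ₀ * (x i - h i) + φ i))) - W * √I| ≤ δ * √I →
      |W| ≤ K →
      |(∫ θ in Set.Iic θ₀, condDensity π y x h φ θ) - stdCdf (-W)| ≤ ε := by
  -- Uniformity comes from a contradiction: failures at every `δ = 1 / (k + 1)` form a sequence to
  -- which the limit theorem applies.
  by_contra! hcon
  have hpos : ∀ k : ℕ, (0 : ℝ) < 1 / ((k : ℝ) + 1) := fun k => by positivity
  choose n y x h φ I W h1 h2 h3 h4 h5 h6 using fun k : ℕ => hcon (1 / ((k : ℝ) + 1)) (hpos k)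
  -- The bound `|W| ≤ K` enters here: along a subsequence the standardized score converges, which
  -- fixes the limit law.
  obtain ⟨W₀, -, ψ, hψ, hW⟩ := (isCompact_Icc (a := -K) (b := K)).tendsto_subseq
    (x := W) (fun k => abs_le.1 (h5 k))
  have hI : Tendsto I atTop atTop := by
    refine tendsto_atTop_mono (fun k => ?_) tendsto_natCast_atTop_atTop
    have := h2 k
    rw [one_div_one_div] at this
    linarith
  have hI0 : ∀ k, 0 < I k := fun k => (one_div_pos.2 (hpos k)).trans_le (h2 k)
  have hδ0 : Tendsto (fun k : ℕ => 1 / ((k : ℝ) + 1)) atTop (𝓝 0) :=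
    tendsto_one_div_add_atTop_nhds_zero_nat
  set J : ℕ → ℝ := fun k => ∑ i, (x k i - h k i) ^ 2 *
    bernoulliVar (θ₀ * (x k i - h k i) + φ k i) with hJdef
  set S : ℕ → ℝ := fun k => ∑ i, (x k i - h k i) *
    (y k i - Real.sigmoid (θ₀ * (x k i - h k i) + φ k i)) with hSdef
  have hJ : Tendsto (fun k => J k / I k) atTop (𝓝 1) := by
    rw [tendsto_iff_dist_tendsto_zero]
    refine squeeze_zero (fun _ => dist_nonneg) (fun k => ?_) hδ0
    rw [Real.dist_eq, div_sub_one (hI0 k).ne', abs_div, abs_of_pos (hI0 k), div_le_iff₀ (hI0 k)]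
    exact h3 k
  have hS0 : Tendsto (fun k => S k / √(I k) - W k) atTop (𝓝 0) := by
    refine squeeze_zero_norm (fun k => ?_) hδ0
    have := Real.sqrt_pos.2 (hI0 k)
    rw [Real.norm_eq_abs, div_sub' this.ne', abs_div, abs_of_pos this, div_le_iff₀ this, mul_comm _ (W k)]
    exact h4 k
  have hS : Tendsto (fun k => S (ψ k) / √(I (ψ k))) atTop (𝓝 W₀) := by
    have := (hS0.comp hψ.tendsto_atTop).add hW
    simpa using this
  have lim := fun A hA hAc => tendsto_integral_posterior (A := A) (θ₀ := θ₀)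
    (ℓ := fun k => condLogLik (y (ψ k)) (x (ψ k)) (h (ψ k)) (φ (ψ k))) hπ_meas hπ_nonneg hπ_int
    hπ_cont (fun k => continuous_condLogLik _ _ _ _) (fun k => concaveOn_condLogLik _ _ _ _)
    (fun k t => (condLogLik_bounds (h1 (ψ k)) θ₀ t).1)
    (fun k t => (condLogLik_bounds (h1 (ψ k)) θ₀ t).2)
    (hI.comp hψ.tendsto_atTop) (hJ.comp hψ.tendsto_atTop) hS hA hAc
  have l1 := lim (Set.Iic 0) measurableSet_Iic fun c hc t => by simp [div_nonpos_iff, hc.le, hc.not_ge]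
  have l2 := lim Set.univ MeasurableSet.univ fun c hc t => by simp
  have l3 := l1.div l2 (tilted_gaussian_integral_pos hπ_pos W₀).ne'
  rw [tilted_gaussian_ratio hπ_pos] at l3
  have l4 : Tendsto (fun k => (∫ θ in Set.Iic θ₀,
      condDensity π (y (ψ k)) (x (ψ k)) (h (ψ k)) (φ (ψ k)) θ) - stdCdf (-W (ψ k))) atTop
      (𝓝 0) := by
    have := l3.sub ((continuous_stdCdf.tendsto _).comp hW.neg)
    rw [sub_self] at this
    refine this.congr fun k => ?_
    rw [setIntegral_condDensity_eq π _ _ _ _ θ₀ (Real.sqrt_pos.2 (hI0 (ψ k))).ne']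
    rfl
  have := (l4.abs).eventually_lt_const (by simpa using hε)
  obtain ⟨k, hk⟩ := this.exists
  exact (h6 (ψ k)).not_gt hk

/-! ### Independent Bernoulli responses -/

/-- The Bernoulli distribution with log-odds `t`. -/
noncomputable def bernLaw (t : ℝ) : Measure Bool :=
  ENNReal.ofReal (Real.sigmoid t) • Measure.dirac true
    + ENNReal.ofReal (1 - Real.sigmoid t) • Measure.dirac false

/-- The real value `0` or `1` of a Boolean response. -/
def bval (b : Bool) : ℝ := if b then 1 else 0

/-- The law of independent Bernoulli responses with log-odds `η`. -/
noncomputable def outcomeLaw {n : ℕ} (η : Fin n → ℝ) : Measure (Fin n → Bool) :=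
  Measure.pi fun i => bernLaw (η i)

instance (t : ℝ) : IsProbabilityMeasure (bernLaw t) where
  measure_univ := by
    simp only [bernLaw, Measure.add_apply, Measure.smul_apply, measure_univ, smul_eq_mul, mul_one]
    rw [← ENNReal.ofReal_add (Real.sigmoid_nonneg t) (sub_nonneg.2 (Real.sigmoid_le_one t))]
    simp

instance {n : ℕ} (η : Fin n → ℝ) : IsProbabilityMeasure (outcomeLaw η) := by
  unfold outcomeLaw; infer_instance

lemma integral_bernLaw {E : Type*} [NormedAddCommGroup E] [NormedSpace ℝ E] [CompleteSpace E]
    (t : ℝ) (f : Bool → E) :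
    ∫ b, f b ∂bernLaw t = Real.sigmoid t • f true + (1 - Real.sigmoid t) • f false := by
  unfold bernLaw
  have := (Measure.dirac true : Measure Bool).smul_finite
    (ENNReal.ofReal_ne_top (r := Real.sigmoid t))
  have := (Measure.dirac false : Measure Bool).smul_finite
    (ENNReal.ofReal_ne_top (r := 1 - Real.sigmoid t))
  rw [integral_add_measure (.of_finite) (.of_finite), integral_smul_measure,
    integral_smul_measure, integral_dirac, integral_dirac,
    ENNReal.toReal_ofReal (Real.sigmoid_nonneg t),
    ENNReal.toReal_ofReal (sub_nonneg.2 (Real.sigmoid_le_one t))]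

/-! ### Central limit theorem for weighted sums of independent Bernoulli responses -/

lemma norm_prod_sub_prod_le {ι : Type*} (s : Finset ι) (f g : ι → ℂ) (hf : ∀ i ∈ s, ‖f i‖ ≤ 1)
    (hg : ∀ i ∈ s, ‖g i‖ ≤ 1) :
    ‖∏ i ∈ s, f i - ∏ i ∈ s, g i‖ ≤ ∑ i ∈ s, ‖f i - g i‖ := by
  classical
  induction s using Finset.induction_on with
  | empty => simp
  | insert j s hj ih =>
    rw [Finset.prod_insert hj, Finset.prod_insert hj, Finset.sum_insert hj]
    have e : f j * ∏ i ∈ s, f i - g j * ∏ i ∈ s, g i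
      = (f j - g j) * ∏ i ∈ s, f i + g j * (∏ i ∈ s, f i - ∏ i ∈ s, g i) := by ring
    have h1 : ‖∏ i ∈ s, f i‖ ≤ 1 := by
      rw [norm_prod]
      exact Finset.prod_le_one (fun _ _ => norm_nonneg _)
        fun i hi => hf i (Finset.mem_insert_of_mem hi)
    have h2 := ih (fun i hi => hf i (Finset.mem_insert_of_mem hi))
      fun i hi => hg i (Finset.mem_insert_of_mem hi)
    have h3 := hg j (Finset.mem_insert_self _ _)
    rw [e]
    refine (norm_add_le _ _).trans (add_le_add ?_ ?_)
    · rw [norm_mul]; exact mul_le_of_le_one_right (norm_nonneg _) h1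
    · rw [norm_mul]; exact (mul_le_of_le_one_left (norm_nonneg _) h3).trans h2

lemma norm_exp_mul_I_taylor_le {x : ℝ} (hx : |x| ≤ 1) :
    ‖Complex.exp (x * Complex.I) - (1 + x * Complex.I - x ^ 2 / 2)‖ ≤ |x| ^ 3 := by
  have hn : ‖(x : ℂ) * Complex.I‖ = |x| := by simp
  have h := Complex.exp_bound (x := x * Complex.I) (by rwa [hn]) (n := 3) (by norm_num)
  rw [hn] at h
  have e : ∑ m ∈ Finset.range 3, ((x : ℂ) * Complex.I) ^ m / (m.factorial : ℂ)
      = 1 + x * Complex.I - x ^ 2 / 2 := by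
    simp [Finset.sum_range_succ, mul_pow, Nat.factorial]
    ring
  rw [e] at h
  refine h.trans ?_
  have : 0 ≤ |x| ^ 3 := by positivity
  norm_num [Nat.factorial]
  linarith

/-- Mean and variance match, so the difference is of third order. The factor `bernoulliVar t` in the
bound is essential: it makes the errors add up to a multiple of the variance of the sum and not of
the number of terms. -/
lemma norm_charFun_bernoulli_sub_le (t : ℝ) {u : ℝ} (hu : |u| ≤ 1) :
    ‖(∫ b, Complex.exp ((u * (bval b - Real.sigmoid t) : ℝ) * Complex.I) ∂bernLaw t)
      - Complex.exp (-(u ^ 2 * bernoulliVar t / 2 : ℝ))‖ ≤ 2 * |u| ^ 3 * bernoulliVar t := by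
  rw [integral_bernLaw]
  simp only [bval, if_true, Complex.real_smul]
  set p := Real.sigmoid t with hp
  have hp0 : 0 < p := Real.sigmoid_pos t
  have hp1 : p < 1 := Real.sigmoid_lt_one t
  have hv : bernoulliVar t = p * (1 - p) := rfl
  have hv0 := bernoulliVar_pos t
  have hv1 := bernoulliVar_le t
  have x1 : |u * (1 - p)| ≤ |u| := by
    rw [abs_mul, abs_of_pos (sub_pos.2 hp1)]; nlinarith [abs_nonneg u]
  have x2 : |u * (0 - p)| ≤ |u| := by
    rw [abs_mul, zero_sub, abs_neg, abs_of_pos hp0]; nlinarith [abs_nonneg u]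
  have f1 := norm_exp_mul_I_taylor_le (x1.trans hu)
  have f2 := norm_exp_mul_I_taylor_le (x2.trans hu)
  set A := Complex.exp ((u * (1 - p) : ℝ) * Complex.I) - (1 + (u * (1 - p) : ℝ) * Complex.I
    - (u * (1 - p) : ℝ) ^ 2 / 2)
  set B := Complex.exp ((u * (0 - p) : ℝ) * Complex.I) - (1 + (u * (0 - p) : ℝ) * Complex.I
    - (u * (0 - p) : ℝ) ^ 2 / 2)
  have hw1 : |-(u ^ 2 * bernoulliVar t / 2)| ≤ 1 := by
    have : u ^ 2 ≤ 1 := by rw [← sq_abs]; exact pow_le_one₀ (abs_nonneg _) hu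
    rw [abs_neg, abs_of_nonneg (by positivity)]; nlinarith
  have f3 := Real.abs_exp_sub_one_sub_id_le hw1
  set D : ℝ := Real.exp (-(u ^ 2 * bernoulliVar t / 2)) - 1 - -(u ^ 2 * bernoulliVar t / 2) with hD
  -- The first-order terms cancel because the variable is centred, and the second-order terms
  -- combine to `u² p (1 - p) / 2`; only the remainders `A`, `B` and `D` survive.
  have e : (p : ℂ) * Complex.exp ((u * (1 - p) : ℝ) * Complex.I)
      + ((1 - p : ℝ) : ℂ) * Complex.exp ((u * ((if false = true then 1 else 0) - p) : ℝ) * Complex.I)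
      - Complex.exp (-(u ^ 2 * bernoulliVar t / 2 : ℝ))
      = (p : ℂ) * A + ((1 - p : ℝ) : ℂ) * B - (D : ℂ) := by
    simp only [A, B, hD, hv]
    push_cast
    ring
  rw [e]
  have n1 : ‖(p : ℂ) * A‖ ≤ |u| ^ 3 * (p * (1 - p)) / 1 * (1 - p) := by
    rw [norm_mul, Complex.norm_real, Real.norm_of_nonneg hp0.le]
    rw [abs_mul, abs_of_pos (sub_pos.2 hp1), mul_pow] at f1
    have : (1 - p) ^ 3 ≤ (1 - p) ^ 2 := pow_le_pow_of_le_one (by linarith) (by linarith) (by norm_num)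
    calc p * ‖A‖ ≤ p * (|u| ^ 3 * (1 - p) ^ 3) := by gcongr
      _ ≤ p * (|u| ^ 3 * (1 - p) ^ 2) := by gcongr
      _ = _ := by ring
  have n2 : ‖((1 - p : ℝ) : ℂ) * B‖ ≤ |u| ^ 3 * (p * (1 - p)) * p := by
    rw [norm_mul, Complex.norm_real, Real.norm_of_nonneg (by linarith)]
    rw [abs_mul, zero_sub, abs_neg, abs_of_pos hp0, mul_pow] at f2
    have : p ^ 3 ≤ p ^ 2 := pow_le_pow_of_le_one (by linarith) (by linarith) (by norm_num)
    have h1p : 0 ≤ 1 - p := by linarith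
    calc (1 - p) * ‖B‖ ≤ (1 - p) * (|u| ^ 3 * p ^ 3) := by gcongr
      _ ≤ (1 - p) * (|u| ^ 3 * p ^ 2) := by gcongr
      _ = _ := by ring
  have n3 : ‖(D : ℂ)‖ ≤ |u| ^ 3 * (p * (1 - p)) := by
    rw [Complex.norm_real, Real.norm_eq_abs]
    refine f3.trans ?_
    rw [neg_sq, ← hv]
    have h4 : (u ^ 2 * bernoulliVar t / 2) ^ 2 = |u| ^ 3 * bernoulliVar t * (|u| * bernoulliVar t / 4) := by
      rw [← sq_abs u]; ring
    rw [h4]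
    refine mul_le_of_le_one_right (by positivity) ?_
    nlinarith [abs_nonneg u]
  refine (norm_sub_le _ _).trans ((add_le_add_left (norm_add_le _ _) _).trans ?_)
  rw [hv]
  nlinarith

/-- The standardized weighted sum of centred responses. -/
noncomputable def stdScore {n : ℕ} (η a : Fin n → ℝ) (b : Fin n → Bool) : ℝ :=
  (∑ i, a i * (bval (b i) - Real.sigmoid (η i))) / √(∑ i, a i ^ 2 * bernoulliVar (η i))

/-- Both sides are products over the observations, compared factor by factor. Since `|a i| ≤ 1`,
cubes of weights are bounded by squares and the errors sum to `I / I^(3/2)`. The bound sees the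
design only through `I`, which makes the central limit theorem uniform. -/
lemma norm_charFun_stdScore_sub_le {n : ℕ} {η a : Fin n → ℝ} (ha : ∀ i, |a i| ≤ 1) {s : ℝ}
    (hI : 0 < ∑ i, a i ^ 2 * bernoulliVar (η i))
    (hs : |s| ≤ √(∑ i, a i ^ 2 * bernoulliVar (η i))) :
    ‖charFun ((outcomeLaw η).map (stdScore η a)) s - Complex.exp (-(s ^ 2 / 2 : ℝ))‖
      ≤ 2 * |s| ^ 3 / √(∑ i, a i ^ 2 * bernoulliVar (η i)) := by
  set I := ∑ i, a i ^ 2 * bernoulliVar (η i) with hIdef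
  have hr : 0 < √I := Real.sqrt_pos.2 hI
  set u : Fin n → ℝ := fun i => s / √I * a i
  have hsI : |s / √I| ≤ 1 := by
    rw [abs_div, abs_of_pos hr]; exact (div_le_one hr).2 hs
  have hu : ∀ i, |u i| ≤ |s / √I| := fun i => by
    rw [abs_mul]; exact mul_le_of_le_one_right (abs_nonneg _) (ha i)
  have e1 : charFun ((outcomeLaw η).map (stdScore η a)) s
      = ∏ i, ∫ b, Complex.exp ((u i * (bval b - Real.sigmoid (η i)) : ℝ) * Complex.I)
        ∂bernLaw (η i) := by
    rw [charFun_apply_real, integral_map (measurable_of_finite _).aemeasurable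
      (by fun_prop), outcomeLaw, ← integral_fintype_prod_eq_prod (μ := fun i => bernLaw (η i))
      (fun i b => Complex.exp ((u i * (bval b - Real.sigmoid (η i)) : ℝ) * Complex.I))]
    refine integral_congr_ae (Eventually.of_forall fun b => ?_)
    simp only
    rw [← Complex.exp_sum, ← Finset.sum_mul, ← Complex.ofReal_sum, ← Complex.ofReal_mul, stdScore]
    congr 3
    rw [← hIdef, mul_div_assoc', mul_div_right_comm, Finset.mul_sum]
    refine Finset.sum_congr rfl fun i _ => ?_
    simp only [u]; ring
  have e2 : Complex.exp (-(s ^ 2 / 2 : ℝ))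
      = ∏ i, Complex.exp (-(u i ^ 2 * bernoulliVar (η i) / 2 : ℝ)) := by
    rw [← Complex.exp_sum]
    congr 1
    rw [Finset.sum_neg_distrib, ← Complex.ofReal_sum]
    congr 2
    have : ∀ i, u i ^ 2 * bernoulliVar (η i) / 2
      = s ^ 2 / I / 2 * (a i ^ 2 * bernoulliVar (η i)) := fun i => by
      simp only [u]; rw [mul_pow, div_pow, Real.sq_sqrt hI.le]; ring
    simp_rw [this]
    rw [← Finset.mul_sum, ← hIdef]
    field_simp
  rw [e1, e2]
  refine (norm_prod_sub_prod_le _ _ _ (fun i _ => ?_) fun i _ => ?_).trans ?_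
  · refine (norm_integral_le_of_norm_le_const (C := 1) (Eventually.of_forall fun b => ?_)).trans
      (by simp)
    rw [Complex.norm_exp_ofReal_mul_I]
  · rw [← Complex.ofReal_neg, ← Complex.ofReal_exp, Complex.norm_real,
      Real.norm_of_nonneg (Real.exp_pos _).le, Real.exp_le_one_iff]
    have := bernoulliVar_pos (η i)
    exact neg_nonpos.2 (by positivity)
  · have hle : ∀ i ∈ Finset.univ, ‖(∫ b, Complex.exp ((u i * (bval b - Real.sigmoid (η i)) : ℝ)
        * Complex.I) ∂bernLaw (η i)) - Complex.exp (-(u i ^ 2 * bernoulliVar (η i) / 2 : ℝ))‖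
        ≤ 2 * (|s| ^ 3 / √I ^ 3) * (a i ^ 2 * bernoulliVar (η i)) := fun i _ => by
      refine (norm_charFun_bernoulli_sub_le (η i) ((hu i).trans hsI)).trans ?_
      have h1 := bernoulliVar_pos (η i)
      have h2 : |u i| ^ 3 ≤ |s| ^ 3 / √I ^ 3 * a i ^ 2 := by
        simp only [u]
        rw [abs_mul, abs_div, abs_of_pos hr, mul_pow, div_pow]
        gcongr
        rw [← sq_abs (a i)]
        exact pow_le_pow_of_le_one (abs_nonneg _) (ha i) (by norm_num)
      calc 2 * |u i| ^ 3 * bernoulliVar (η i)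
          ≤ 2 * (|s| ^ 3 / √I ^ 3 * a i ^ 2) * bernoulliVar (η i) := by gcongr
        _ = _ := by ring
    refine (Finset.sum_le_sum hle).trans (le_of_eq ?_)
    rw [← Finset.mul_sum, ← hIdef]
    have : √I ^ 3 = I * √I := by rw [pow_succ, Real.sq_sqrt hI.le]
    rw [this]
    field_simp

/-- A failure for every `δ` would give a triangular array with information tending to infinity. Its
characteristic functions converge, Lévy's theorem gives weak convergence, and the normal law does
not charge the endpoints of the interval. -/
theorem stdScore_clt {ε : ℝ} (hε : 0 < ε) {p q : ℝ} (hpq : p < q) :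
    ∃ δ > 0, ∀ (n : ℕ) (η a : Fin n → ℝ), (∀ i, |a i| ≤ 1) →
      1 / δ ≤ ∑ i, a i ^ 2 * bernoulliVar (η i) →
      |(outcomeLaw η).real {b | stdScore η a b ∈ Set.Ioo p q} - (stdCdf q - stdCdf p)| ≤ ε := by
  by_contra! hcon
  have hpos : ∀ k : ℕ, (0 : ℝ) < 1 / ((k : ℝ) + 1) := fun k => by positivity
  choose n η a h1 h2 h3 using fun k : ℕ => hcon (1 / ((k : ℝ) + 1)) (hpos k)
  set I : ℕ → ℝ := fun k => ∑ i, a k i ^ 2 * bernoulliVar (η k i)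
  have hI : Tendsto I atTop atTop := by
    refine tendsto_atTop_mono (fun k => ?_) tendsto_natCast_atTop_atTop
    have := h2 k
    rw [one_div_one_div] at this
    linarith
  have hsq : Tendsto (fun k => √(I k)) atTop atTop := Real.tendsto_sqrt_atTop.comp hI
  let μ : ℕ → ProbabilityMeasure ℝ := fun k =>
    ⟨(outcomeLaw (η k)).map (stdScore (η k) (a k)),
      Measure.isProbabilityMeasure_map (measurable_of_finite _).aemeasurable⟩
  let μ₀ : ProbabilityMeasure ℝ := ⟨gaussianReal 0 1, inferInstance⟩
  have lim : Tendsto μ atTop (𝓝 μ₀) := by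
    rw [ProbabilityMeasure.tendsto_iff_tendsto_charFun]
    intro s
    change Tendsto (fun k => charFun ((outcomeLaw (η k)).map (stdScore (η k) (a k))) s) atTop
      (𝓝 (charFun (gaussianReal 0 1) s))
    rw [charFun_gaussianReal]
    have e : Complex.exp (s * (0 : ℝ) * Complex.I - (1 : NNReal) * s ^ 2 / 2)
        = Complex.exp (-(s ^ 2 / 2 : ℝ)) := by
      congr 1; push_cast; ring
    rw [e, tendsto_iff_norm_sub_tendsto_zero]
    refine squeeze_zero' (Eventually.of_forall fun _ => norm_nonneg _) ?_
      (hsq.const_div_atTop (2 * |s| ^ 3))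
    filter_upwards [hI.eventually_gt_atTop 0, hsq.eventually_ge_atTop |s|] with k k1 k2
    exact norm_charFun_stdScore_sub_le (h1 k) k1 k2
  have hfr : (μ₀ : Measure ℝ) (frontier (Set.Ioo p q)) = 0 := by
    change gaussianReal 0 1 _ = 0
    rw [frontier_Ioo hpq]
    exact (measure_union_null (gaussianReal_singleton p) (gaussianReal_singleton q))
  have h4 := ProbabilityMeasure.tendsto_measure_of_null_frontier_of_tendsto' lim hfr
  have h5 := (ENNReal.tendsto_toReal (measure_ne_top _ _)).comp h4
  have e5 : ((μ₀ : Measure ℝ) (Set.Ioo p q)).toReal = stdCdf q - stdCdf p := by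
    rw [← gaussianReal_real_Ioc hpq.le, measureReal_def]
    congr 1
    refine measure_congr ?_
    have := nullSingletonClass_gaussianReal (μ := 0) (v := 1) one_ne_zero
    exact Ioo_ae_eq_Ioc (μ := gaussianReal 0 1)
  rw [e5] at h5
  have h6 := ((h5.sub_const (stdCdf q - stdCdf p)).abs).eventually_lt_const (by simpa using hε)
  obtain ⟨k, hk⟩ := h6.exists
  refine (h3 k).not_gt (lt_of_eq_of_lt ?_ hk)
  congr 2
  change _ = ((outcomeLaw (η k)).map (stdScore (η k) (a k)) _).toReal
  rw [Measure.map_apply (measurable_of_finite _) measurableSet_Ioo]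
  rfl

/-! ### The conditional law of the responses given the covariates -/

/-- The covariates of a sample. -/
abbrev Cov (n d : ℕ) : Type := (Fin n → ℝ) × (Fin n → Fin d → ℝ)

/-- The log-odds of the responses at given parameters. -/
def logOdds {n d : ℕ} (θ : ℝ) (β : Fin d → ℝ) (w : Cov n d) : Fin n → ℝ :=
  fun i => w.1 i * θ + w.2 i ⬝ᵥ β

lemma measurable_dotProduct_const {d : ℕ} (β : Fin d → ℝ) :
    Measurable fun z : Fin d → ℝ => z ⬝ᵥ β := by
  unfold dotProduct; fun_prop

lemma measurable_logOdds {n d : ℕ} (θ : ℝ) (β : Fin d → ℝ) :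
    Measurable (logOdds (n := n) θ β) := by
  unfold logOdds dotProduct; fun_prop

lemma measurable_sigmoid_real : Measurable Real.sigmoid := continuous_sigmoid.measurable

lemma bernLaw_singleton (t : ℝ) (b : Bool) :
    bernLaw t {b} = ENNReal.ofReal (if b then Real.sigmoid t else 1 - Real.sigmoid t) := by
  cases b <;> simp [bernLaw]

lemma measurable_bernLaw_singleton (b : Bool) : Measurable fun t => bernLaw t {b} := by
  simp_rw [bernLaw_singleton]
  have := measurable_sigmoid_real
  cases b <;> simp <;> fun_prop

lemma outcomeLaw_singleton {n : ℕ} (η : Fin n → ℝ) (b : Fin n → Bool) :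
    outcomeLaw η {b} = ∏ i, bernLaw (η i) {b i} := by
  rw [outcomeLaw, ← Set.univ_pi_singleton, Measure.pi_pi]

lemma lintegral_outcomeLaw {n : ℕ} (η : Fin n → ℝ) (g : (Fin n → Bool) → ℝ≥0∞) :
    ∫⁻ b, g b ∂outcomeLaw η = ∑ b, g b * ∏ i, bernLaw (η i) {b i} := by
  rw [lintegral_fintype]
  simp_rw [outcomeLaw_singleton]

lemma measurable_lintegral_outcomeLaw {n : ℕ} {E : Type*} [MeasurableSpace E] {η : E → Fin n → ℝ}
    (hη : Measurable η) {g : (Fin n → Bool) → E → ℝ≥0∞} (hg : ∀ b, Measurable (g b)) :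
    Measurable fun w => ∫⁻ b, g b w ∂outcomeLaw (η w) := by
  simp_rw [lintegral_outcomeLaw]
  refine Finset.measurable_sum _ fun b _ => (hg b).mul (Finset.measurable_prod _ fun i _ => ?_)
  exact (measurable_bernLaw_singleton (b i)).comp ((measurable_pi_apply i).comp hη)

section Sample

variable {Ω : Type*} [MeasurableSpace Ω] {P : Measure Ω}
  {n d : ℕ} {Y X : Fin n → Ω → ℝ} {Z : Fin n → Ω → Fin d → ℝ} {θ₀ : ℝ} {β₀ : Fin d → ℝ}

/-- The responses of a sample, as Booleans. -/
noncomputable def ybool (Y : Fin n → Ω → ℝ) (ω : Ω) : Fin n → Bool := fun i => decide (Y i ω = 1)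

/-- The covariates of a sample, as a random variable. -/
def covar (X : Fin n → Ω → ℝ) (Z : Fin n → Ω → Fin d → ℝ) (ω : Ω) : Cov n d := (col X ω, col Z ω)

lemma IsLogisticSample.bval_ybool (hs : IsLogisticSample P Y X Z θ₀ β₀) (ω : Ω) :
    (fun i => bval (ybool Y ω i)) = col Y ω := by
  ext i
  rcases hs.binary_Y i ω with h | h <;> simp [bval, ybool, col, h]

lemma measurable_bool_decide : Measurable fun y : ℝ => decide (y = 1) :=
  measurable_to_bool (by
    have : (fun y : ℝ => decide (y = 1)) ⁻¹' {true} = {1} := by ext; simp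
    rw [this]; exact measurableSet_singleton 1)

lemma IsLogisticSample.measurable_ybool (hs : IsLogisticSample P Y X Z θ₀ β₀) :
    Measurable (ybool Y) :=
  measurable_pi_lambda _ fun i => measurable_bool_decide.comp (hs.measurable_Y i)

lemma IsLogisticSample.measurable_covar (hs : IsLogisticSample P Y X Z θ₀ β₀) :
    Measurable (covar X Z) :=
  (measurable_pi_lambda _ hs.measurable_X).prodMk (measurable_pi_lambda _ hs.measurable_Z)

lemma IsLogisticSample.iIndepFun_covar (hs : IsLogisticSample P Y X Z θ₀ β₀) :
    iIndepFun (fun i ω => (X i ω, Z i ω)) P :=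
  hs.indep.comp (fun _ v => v.2) fun _ => measurable_snd

lemma IsLogisticSample.measurableSet_event (hs : IsLogisticSample P Y X Z θ₀ β₀)
    {A : (Fin n → Bool) → Set (Cov n d)} (hA : ∀ b, MeasurableSet (A b)) :
    MeasurableSet {ω | covar X Z ω ∈ A (ybool Y ω)} := by
  have : {ω | covar X Z ω ∈ A (ybool Y ω)}
      = ⋃ b, {ω | ybool Y ω = b} ∩ covar X Z ⁻¹' A b := by
    ext ω; simp
  rw [this]
  exact MeasurableSet.iUnion fun b => (hs.measurable_ybool (measurableSet_singleton b)).inter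
    (hs.measurable_covar (hA b))

variable [IsProbabilityMeasure P]

lemma IsLogisticSample.measure_outcome_inter (hs : IsLogisticSample P Y X Z θ₀ β₀) (i : Fin n)
    (b : Bool) {s : Set (ℝ × (Fin d → ℝ))} (hsm : MeasurableSet s) :
    P {ω | ybool Y ω i = b ∧ (X i ω, Z i ω) ∈ s}
      = ∫⁻ ω, s.indicator (fun u => bernLaw (u.1 * θ₀ + u.2 ⬝ᵥ β₀) {b}) (X i ω, Z i ω) ∂P := by
  have hU : Measurable fun ω => (X i ω, Z i ω) := (hs.measurable_X i).prodMk (hs.measurable_Z i)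
  set A := (fun ω => (X i ω, Z i ω)) ⁻¹' s
  have hA : MeasurableSet A := hU hsm
  have hA' : MeasurableSet[MeasurableSpace.comap (fun ω => (X i ω, Z i ω)) inferInstance] A :=
    ⟨s, hsm, rfl⟩
  have hY : MeasurableSet {ω | Y i ω = 1} := hs.measurable_Y i (measurableSet_singleton 1)
  have hη : Measurable fun ω => X i ω * θ₀ + Z i ω ⬝ᵥ β₀ :=
    ((hs.measurable_X i).mul_const _).add
      ((measurable_dotProduct_const β₀).comp (hs.measurable_Z i))
  have hσ : Measurable fun ω => Real.sigmoid (X i ω * θ₀ + Z i ω ⬝ᵥ β₀) :=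
    measurable_sigmoid_real.comp hη
  have hσi : Integrable (fun ω => Real.sigmoid (X i ω * θ₀ + Z i ω ⬝ᵥ β₀)) P :=
    Integrable.of_bound hσ.aestronglyMeasurable 1 (Eventually.of_forall fun ω => by
      rw [Real.norm_of_nonneg (Real.sigmoid_nonneg _)]; exact Real.sigmoid_le_one _)
  have h1 : P.real ({ω | Y i ω = 1} ∩ A)
      = ∫ ω in A, Real.sigmoid (X i ω * θ₀ + Z i ω ⬝ᵥ β₀) ∂P := by
    have e := setIntegral_condExp (μ := P) hU.comap_le
      (f := {ω | Y i ω = 1}.indicator fun _ => (1 : ℝ))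
      ((integrable_const 1).indicator hY) hA'
    rw [setIntegral_congr_ae hA ((hs.outcome i).mono fun ω h _ => h)] at e
    rw [e, setIntegral_indicator hY, setIntegral_const, smul_eq_mul, mul_one, Set.inter_comm]
  have e0 : {ω | ybool Y ω i = b ∧ (X i ω, Z i ω) ∈ s}
      = (if b then {ω | Y i ω = 1} ∩ A else A \ ({ω | Y i ω = 1} ∩ A)) := by
    ext ω
    cases b <;> simp [ybool, A, and_comm]
  have e1 : ∫⁻ ω, s.indicator (fun u => bernLaw (u.1 * θ₀ + u.2 ⬝ᵥ β₀) {b}) (X i ω, Z i ω) ∂P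
      = ∫⁻ ω in A, bernLaw (X i ω * θ₀ + Z i ω ⬝ᵥ β₀) {b} ∂P := by
    rw [← lintegral_indicator hA]
    rfl
  rw [e0, e1]
  cases b
  · simp only [Bool.false_eq_true, if_false, bernLaw_singleton]
    have hi : Integrable (fun ω => 1 - Real.sigmoid (X i ω * θ₀ + Z i ω ⬝ᵥ β₀)) P :=
      (integrable_const 1).sub hσi
    rw [← ofReal_integral_eq_lintegral_ofReal hi.integrableOn
        (Eventually.of_forall fun ω => sub_nonneg.2 (Real.sigmoid_le_one _)),
      integral_sub (integrable_const 1) hσi.integrableOn, ← h1,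
      setIntegral_const, smul_eq_mul, mul_one, ← measureReal_sdiff Set.inter_subset_right (hY.inter hA),
      ofReal_measureReal]
  · simp only [if_true, bernLaw_singleton]
    rw [← ofReal_integral_eq_lintegral_ofReal hσi.integrableOn
        (Eventually.of_forall fun ω => Real.sigmoid_nonneg _), ← h1, ofReal_measureReal]

/-- Two measures on covariate space are compared: the law restricted to the responses being `b`, and
the law weighted by the Bernoulli probabilities of `b`. Independence across observations makes both
the product measure with marginals `ν i`, by comparison on rectangles. -/
lemma IsLogisticSample.lintegral_ybool_eq (hs : IsLogisticSample P Y X Z θ₀ β₀)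
    (b : Fin n → Bool) {G : Cov n d → ℝ≥0∞} (hG : Measurable G) :
    ∫⁻ ω in {ω | ybool Y ω = b}, G (covar X Z ω) ∂P
      = ∫⁻ ω, G (covar X Z ω) * outcomeLaw (logOdds θ₀ β₀ (covar X Z ω)) {b} ∂P := by
  have hUi : ∀ i, Measurable fun ω => (X i ω, Z i ω) := fun i =>
    (hs.measurable_X i).prodMk (hs.measurable_Z i)
  set U : Ω → Fin n → ℝ × (Fin d → ℝ) := fun ω i => (X i ω, Z i ω)
  have hU : Measurable U := measurable_pi_lambda _ hUi
  set k : Fin n → ℝ × (Fin d → ℝ) → ℝ≥0∞ := fun i u => bernLaw (u.1 * θ₀ + u.2 ⬝ᵥ β₀) {b i}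
  have hk : ∀ i, Measurable (k i) := fun i =>
    (measurable_bernLaw_singleton (b i)).comp
      ((measurable_fst.mul_const _).add ((measurable_dotProduct_const β₀).comp measurable_snd))
  set ν : Fin n → Measure (ℝ × (Fin d → ℝ)) := fun i =>
    (P.restrict {ω | ybool Y ω i = b i}).map fun ω => (X i ω, Z i ω)
  have hYb : ∀ i, MeasurableSet {ω | ybool Y ω i = b i} := fun i =>
    ((measurable_pi_apply i).comp hs.measurable_ybool) (measurableSet_singleton (b i))
  have hν : ∀ i s, MeasurableSet s → ν i s = P {ω | ybool Y ω i = b i ∧ (X i ω, Z i ω) ∈ s} :=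
    fun i s hsm => by
      rw [Measure.map_apply (hUi i) hsm, Measure.restrict_apply (hUi i hsm), Set.inter_comm]
      rfl
  have hνfin : ∀ i, IsFiniteMeasure (ν i) := fun i => by simp only [ν]; infer_instance
  have m1 : Measure.pi ν = (P.restrict {ω | ybool Y ω = b}).map U := by
    refine Measure.pi_eq fun s hsm => ?_
    rw [Measure.map_apply hU (MeasurableSet.univ_pi hsm),
      Measure.restrict_apply (hU (MeasurableSet.univ_pi hsm))]
    have h := hs.indep.measure_inter_preimage_eq_mul Finset.univ
      (sets := fun i => {v | decide (v.1 = 1) = b i ∧ v.2 ∈ s i}) (fun i _ =>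
        ((measurable_bool_decide.comp measurable_fst) (measurableSet_singleton (b i))).inter
          (measurable_snd (hsm i)))
    simp_rw [hν _ _ (hsm _)]
    refine Eq.trans (congrArg P ?_) h
    ext ω
    simp only [Set.mem_inter_iff, Set.mem_preimage, Set.mem_univ_pi, Set.mem_ofPred_eq,
      Set.mem_iInter, Finset.mem_univ, true_imp_iff, U, funext_iff, ybool]
    exact ⟨fun h i => ⟨h.2 i, h.1 i⟩, fun h => ⟨fun i => (h i).2, fun i => (h i).1⟩⟩
  have m2 : Measure.pi ν = (P.withDensity fun ω => ∏ i, k i (X i ω, Z i ω)).map U := by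
    refine Measure.pi_eq fun s hsm => ?_
    have hpre : MeasurableSet (U ⁻¹' Set.univ.pi s) := hU (MeasurableSet.univ_pi hsm)
    rw [Measure.map_apply hU (MeasurableSet.univ_pi hsm), withDensity_apply _ hpre,
      ← lintegral_indicator hpre]
    have h := lintegral_prod_eq_prod_lintegral_of_indepFun (μ := P) Finset.univ
      (fun i ω => (s i).indicator (k i) (X i ω, Z i ω))
      (hs.iIndepFun_covar.comp (fun i => (s i).indicator (k i))
        fun i => (hk i).indicator (hsm i))
      (fun i => ((hk i).indicator (hsm i)).comp (hUi i))
    simp_rw [hν _ _ (hsm _), hs.measure_outcome_inter _ _ (hsm _)]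
    rw [← h]
    refine lintegral_congr fun ω => ?_
    by_cases hω : ∀ i, (X i ω, Z i ω) ∈ s i
    · rw [Set.indicator_of_mem (by simpa [U] using hω)]
      exact Finset.prod_congr rfl fun i _ => (Set.indicator_of_mem (hω i) _).symm
    · rw [Set.indicator_of_notMem (by simpa [U] using hω)]
      push Not at hω
      obtain ⟨i, hi⟩ := hω
      exact (Finset.prod_eq_zero (Finset.mem_univ i) (Set.indicator_of_notMem hi _)).symm
  have hG' : Measurable fun v : Fin n → ℝ × (Fin d → ℝ) => G (fun i => (v i).1, fun i => (v i).2) :=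
    hG.comp (by fun_prop)
  have e1 := lintegral_map hG' hU (μ := P.restrict {ω | ybool Y ω = b})
  have e2 := lintegral_map hG' hU (μ := P.withDensity fun ω => ∏ i, k i (X i ω, Z i ω))
  rw [← m1] at e1
  rw [← m2, e1] at e2
  have hprod : Measurable fun ω => ∏ i, k i (X i ω, Z i ω) :=
    Finset.measurable_prod _ fun i _ => (hk i).comp (hUi i)
  have hGU : Measurable fun ω => G (fun i => (U ω i).1, fun i => (U ω i).2) := hG'.comp hU
  rw [lintegral_withDensity_eq_lintegral_mul _ hprod hGU] at e2
  refine e2.trans (lintegral_congr fun ω => ?_)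
  rw [Pi.mul_apply, mul_comm, outcomeLaw_singleton]
  rfl

/-- Given the covariates, the responses are independent Bernoulli variables. -/
theorem IsLogisticSample.lintegral_eq (hs : IsLogisticSample P Y X Z θ₀ β₀)
    {g : (Fin n → Bool) → Cov n d → ℝ≥0∞} (hg : ∀ b, Measurable (g b)) :
    ∫⁻ ω, g (ybool Y ω) (covar X Z ω) ∂P
      = ∫⁻ ω, ∫⁻ b, g b (covar X Z ω) ∂outcomeLaw (logOdds θ₀ β₀ (covar X Z ω)) ∂P := by
  simp_rw [lintegral_fintype]
  rw [lintegral_finsetSum' _ fun b _ => by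
    have h1 := (hg b).comp hs.measurable_covar
    have h2 : Measurable fun ω => outcomeLaw (logOdds θ₀ β₀ (covar X Z ω)) {b} := by
      simp_rw [outcomeLaw_singleton]
      exact Finset.measurable_prod _ fun i _ => (measurable_bernLaw_singleton (b i)).comp
        ((measurable_pi_apply i).comp ((measurable_logOdds θ₀ β₀).comp hs.measurable_covar))
    exact (h1.mul h2).aemeasurable]
  simp_rw [← hs.lintegral_ybool_eq _ (hg _)]
  have hb : ∀ b, MeasurableSet {ω | ybool Y ω = b} := fun b =>
    hs.measurable_ybool (measurableSet_singleton b)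
  have e : ∀ ω, g (ybool Y ω) (covar X Z ω)
      = ∑ b, {ω | ybool Y ω = b}.indicator (fun ω => g b (covar X Z ω)) ω := fun ω => by
    rw [Finset.sum_eq_single (ybool Y ω)]
    · rw [Set.indicator_of_mem]; rfl
    · intro b _ hb
      rw [Set.indicator_of_notMem]
      exact fun h => hb h.symm
    · simp
  simp_rw [e]
  have hgb : ∀ b, Measurable fun ω => g b (covar X Z ω) := fun b =>
    (hg b).comp hs.measurable_covar
  rw [lintegral_finsetSum' _ fun b _ => ((hgb b).indicator (hb b)).aemeasurable]
  simp_rw [lintegral_indicator (hb _)]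

lemma measurable_outcomeLaw_real (A : (Fin n → Bool) → Set (Cov n d))
    (hA : ∀ b, MeasurableSet (A b)) :
    Measurable fun w => (outcomeLaw (logOdds θ₀ β₀ w)).real {b | w ∈ A b} := by
  refine Measurable.ennreal_toReal ?_
  have : (fun w => outcomeLaw (logOdds θ₀ β₀ w) {b | w ∈ A b})
      = fun w => ∫⁻ b, (A b).indicator 1 w ∂outcomeLaw (logOdds θ₀ β₀ w) := by
    ext w
    rw [← lintegral_indicator_one (Set.toFinite _).measurableSet]
    rfl
  rw [this]
  exact measurable_lintegral_outcomeLaw (measurable_logOdds θ₀ β₀)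
    fun b => measurable_one.indicator (hA b)

lemma IsLogisticSample.measureReal_event (hs : IsLogisticSample P Y X Z θ₀ β₀)
    {A : (Fin n → Bool) → Set (Cov n d)} (hA : ∀ b, MeasurableSet (A b)) :
    P.real {ω | covar X Z ω ∈ A (ybool Y ω)}
      = ∫ ω, (outcomeLaw (logOdds θ₀ β₀ (covar X Z ω))).real {b | covar X Z ω ∈ A b} ∂P := by
  have h := hs.lintegral_eq (g := fun b => (A b).indicator 1) fun b => measurable_one.indicator (hA b)
  have e1 : ∫⁻ ω, (A (ybool Y ω)).indicator 1 (covar X Z ω) ∂P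
      = P {ω | covar X Z ω ∈ A (ybool Y ω)} := by
    rw [← lintegral_indicator_one (hs.measurableSet_event hA)]; rfl
  have e2 : ∀ ω, ∫⁻ b, (A b).indicator 1 (covar X Z ω) ∂outcomeLaw (logOdds θ₀ β₀ (covar X Z ω))
      = outcomeLaw (logOdds θ₀ β₀ (covar X Z ω)) {b | covar X Z ω ∈ A b} := fun ω => by
    rw [← lintegral_indicator_one (Set.toFinite _).measurableSet]; rfl
  simp_rw [e2] at h
  rw [e1] at h
  rw [measureReal_def, h, ← integral_toReal]
  · rfl
  · have := (measurable_outcomeLaw_real (θ₀ := θ₀) (β₀ := β₀) A hA).ennreal_ofReal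
    refine AEMeasurable.congr (this.comp hs.measurable_covar).aemeasurable
      (Eventually.of_forall fun ω => ofReal_measureReal)
  · exact Eventually.of_forall fun ω => measure_lt_top _ _

/-- The conditional probability of an event given the covariates. -/
theorem IsLogisticSample.condProb_eq (hs : IsLogisticSample P Y X Z θ₀ β₀)
    {A : (Fin n → Bool) → Set (Cov n d)} (hA : ∀ b, MeasurableSet (A b)) :
    (fun ω => (outcomeLaw (logOdds θ₀ β₀ (covar X Z ω))).real {b | covar X Z ω ∈ A b})
      =ᵐ[P] P⟦{ω | covar X Z ω ∈ A (ybool Y ω)} |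
        MeasurableSpace.comap (fun ω => (col X ω, col Z ω)) inferInstance⟧ := by
  have hm := measurable_outcomeLaw_real (θ₀ := θ₀) (β₀ := β₀) A hA
  have hev := hs.measurableSet_event hA
  have hbd : Integrable (fun ω =>
      (outcomeLaw (logOdds θ₀ β₀ (covar X Z ω))).real {b | covar X Z ω ∈ A b}) P :=
    Integrable.of_bound (hm.comp hs.measurable_covar).aestronglyMeasurable 1
      (Eventually.of_forall fun ω => by
        rw [Real.norm_of_nonneg measureReal_nonneg]; exact measureReal_le_one)
  refine ae_eq_condExp_of_forall_setIntegral_eq (m₀ := inferInstance) hs.measurable_covar.comap_le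
    ((integrable_const 1).indicator hev) (fun s _ _ => hbd.integrableOn) ?_ ?_
  · rintro _ ⟨B, hB, rfl⟩ -
    have hB' : MeasurableSet (covar X Z ⁻¹' B) := hs.measurable_covar hB
    change ∫ ω in covar X Z ⁻¹' B, _ ∂P = ∫ ω in covar X Z ⁻¹' B, _ ∂P
    rw [setIntegral_indicator hev, setIntegral_const, smul_eq_mul, mul_one,
      ← integral_indicator hB']
    have h := hs.measureReal_event (A := fun b => B ∩ A b) fun b => hB.inter (hA b)
    refine Eq.trans ?_ h.symm
    refine integral_congr_ae (Eventually.of_forall fun ω => ?_)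
    by_cases hω : covar X Z ω ∈ B
    · simp [Set.indicator, hω]
    · simp [Set.indicator, hω]
  · have h2 : Measurable[MeasurableSpace.comap (fun ω => (col X ω, col Z ω)) inferInstance]
        (covar X Z) := comap_measurable _
    exact (hm.comp h2).stronglyMeasurable.aestronglyMeasurable

end Sample

/-! ### Concentration of sums over the sample -/

/-- Hoeffding's inequality for centred bounded independent variables. -/
lemma measureReal_abs_sum_ge_le {Ω : Type*} [MeasurableSpace Ω] {P : Measure Ω}
    [IsProbabilityMeasure P] {n : ℕ} {ξ : Fin n → Ω → ℝ} (hind : iIndepFun ξ P)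
    (hm : ∀ i, Measurable (ξ i)) {B : ℝ} (hb : ∀ i, ∀ᵐ ω ∂P, |ξ i ω| ≤ B)
    (h0 : ∀ i, ∫ ω, ξ i ω ∂P = 0) {t : ℝ} (ht : 0 ≤ t) :
    P.real {ω | t ≤ |∑ i, ξ i ω|} ≤ 2 * Real.exp (-t ^ 2 / (2 * (n * B ^ 2))) := by
  have hc : (((‖B - -B‖₊ / 2) ^ 2 : NNReal) : ℝ) = B ^ 2 := by
    push_cast
    rw [Real.norm_eq_abs, show B - -B = 2 * B by ring, abs_mul, abs_two,
      mul_div_cancel_left₀ _ two_ne_zero, sq_abs]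
  have hsub : ∀ i ∈ Finset.univ, HasSubgaussianMGF (ξ i) ((‖B - -B‖₊ / 2) ^ 2) P := fun i _ =>
    hasSubgaussianMGF_of_mem_Icc_of_integral_eq_zero (hm i).aemeasurable
      ((hb i).mono fun ω h => abs_le.1 h) (h0 i)
  have e : ((∑ _i : Fin n, (‖B - -B‖₊ / 2) ^ 2 : NNReal) : ℝ) = n * B ^ 2 := by
    rw [Finset.sum_const, nsmul_eq_mul, NNReal.coe_mul, hc]; simp
  have h1 := HasSubgaussianMGF.measure_sum_ge_le_of_iIndepFun hind hsub ht
  have h2 := HasSubgaussianMGF.measure_sum_ge_le_of_iIndepFun (X := fun i ω => -ξ i ω)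
    (hind.comp (fun _ x => -x) fun _ => measurable_neg) (fun i hi => (hsub i hi).neg) ht
  rw [e] at h1 h2
  have hsubset : {ω | t ≤ |∑ i, ξ i ω|} ⊆ {ω | t ≤ ∑ i, ξ i ω} ∪ {ω | t ≤ ∑ i, -ξ i ω} := by
    intro ω hω
    simp only [Set.mem_ofPred_eq, le_abs, Set.mem_union, Finset.sum_neg_distrib] at hω ⊢
    exact hω
  calc _ ≤ P.real ({ω | t ≤ ∑ i, ξ i ω} ∪ {ω | t ≤ ∑ i, -ξ i ω}) := measureReal_mono hsubset
    _ ≤ _ := measureReal_union_le _ _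
    _ ≤ _ := by linarith

/-- Pulling `g` out of the conditional expectation. It is applied with the σ-algebra of `(X_i, Z_i)`
to the outcome residual and with that of `Z_i` to the residual of `X_i`. -/
lemma integral_indicator_sub_mul_eq_zero {Ω : Type*} {m m₀ : MeasurableSpace Ω} (hm : m ≤ m₀)
    {P : Measure[m₀] Ω} [IsProbabilityMeasure P] {A : Set Ω} (hA : MeasurableSet[m₀] A)
    {p g : Ω → ℝ} (hp : P⟦A | m⟧ =ᵐ[P] p) (hg : StronglyMeasurable[m] g) {B : ℝ}
    (hB : ∀ᵐ ω ∂P, |g ω| ≤ B) :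
    ∫ ω, (A.indicator (fun _ => (1 : ℝ)) ω - p ω) * g ω ∂P = 0 := by
  have hgi : Integrable g P := Integrable.of_bound (hg.mono hm).aestronglyMeasurable B hB
  have hf : Integrable (A.indicator fun _ => (1 : ℝ)) P := (integrable_const 1).indicator hA
  have hfg : Integrable (A.indicator (fun _ => (1 : ℝ)) * g) P :=
    hf.mul_bdd (hg.mono hm).aestronglyMeasurable hB
  have h1 := condExp_mul_of_stronglyMeasurable_right hg hfg hf
  have h2 : Integrable (fun ω => p ω * g ω) P :=
    (integrable_condExp (m := m) (f := A.indicator (fun _ => (1 : ℝ)) * g)).congr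
      (h1.trans (hp.mul (ae_eq_refl g)))
  simp_rw [sub_mul]
  have hfg' : Integrable (fun ω => A.indicator (fun _ => (1 : ℝ)) ω * g ω) P := hfg
  rw [integral_sub hfg' h2, sub_eq_zero]
  calc _ = ∫ ω, P[A.indicator (fun _ => (1 : ℝ)) * g | m] ω ∂P := (integral_condExp hm).symm
    _ = _ := integral_congr_ae (h1.trans (hp.mul (ae_eq_refl g)))

/-- Coefficient of the error in `θ` in the expansion of one term of the efficient score. -/
noncomputable def crossTheta (θ l e x y : ℝ) : ℝ :=
  (y - Real.sigmoid (x * θ + l)) * (varProj θ l e * (1 - varProj θ l e) *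
      (1 - 2 * Real.sigmoid (θ + l)))
    + (x - varProj θ l e) * bernoulliVar (x * θ + l) * varProj θ l e

/-- Coefficient of the error in the linear predictor in the expansion of one term of the efficient
score. -/
noncomputable def crossPred (θ l e x y : ℝ) : ℝ :=
  (y - Real.sigmoid (x * θ + l)) * (varProj θ l e * (1 - varProj θ l e) *
      (2 * Real.sigmoid l - 2 * Real.sigmoid (θ + l)))
    + (x - varProj θ l e) * bernoulliVar (x * θ + l)

/-- One term of the efficient score. -/
noncomputable def scoreTerm (θ l e x y : ℝ) : ℝ :=
  (x - varProj θ l e) * (y - Real.sigmoid (x * θ + l))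

/-- One term of the efficient information. -/
noncomputable def infoTerm (θ l e x : ℝ) : ℝ :=
  (x - varProj θ l e) ^ 2 * bernoulliVar (x * θ + l)

section Bounds

variable {θ l e x y : ℝ}

lemma abs_resp_sub_le (t : ℝ) (hy : y ∈ Set.Icc (0 : ℝ) 1) : |y - Real.sigmoid t| ≤ 1 := by
  rw [abs_le]; constructor <;>
    linarith [hy.1, hy.2, Real.sigmoid_pos t, Real.sigmoid_lt_one t]

lemma abs_sub_varProj_le (he : e ∈ Set.Ioo (0 : ℝ) 1) (hx : x ∈ Set.Icc (0 : ℝ) 1) :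
    |x - varProj θ l e| ≤ 1 := by
  obtain ⟨h0, h1⟩ := varProj_mem_Ioo θ l he
  rw [abs_le]; constructor <;> linarith [hx.1, hx.2]

lemma varProj_mul_one_sub_mem (he : e ∈ Set.Ioo (0 : ℝ) 1) :
    varProj θ l e * (1 - varProj θ l e) ∈ Set.Icc (0 : ℝ) 1 := by
  obtain ⟨h0, h1⟩ := varProj_mem_Ioo θ l he
  constructor <;> nlinarith

lemma abs_scoreTerm_le (he : e ∈ Set.Ioo (0 : ℝ) 1) (hx : x ∈ Set.Icc (0 : ℝ) 1)
    (hy : y ∈ Set.Icc (0 : ℝ) 1) : |scoreTerm θ l e x y| ≤ 1 := by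
  rw [scoreTerm, abs_mul]
  exact mul_le_one₀ (abs_sub_varProj_le he hx) (abs_nonneg _) (abs_resp_sub_le _ hy)

lemma infoTerm_mem (he : e ∈ Set.Ioo (0 : ℝ) 1) (hx : x ∈ Set.Icc (0 : ℝ) 1) :
    infoTerm θ l e x ∈ Set.Icc (0 : ℝ) 1 := by
  have h := abs_sub_varProj_le (θ := θ) (l := l) he hx
  have h1 := bernoulliVar_pos (x * θ + l)
  have h2 := bernoulliVar_le (x * θ + l)
  have h3 : (x - varProj θ l e) ^ 2 ≤ 1 := by
    rw [← sq_abs]; exact pow_le_one₀ (abs_nonneg _) h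
  unfold infoTerm
  exact ⟨by positivity, by nlinarith [sq_nonneg (x - varProj θ l e)]⟩

lemma abs_sub_varProj_mul_le (he : e ∈ Set.Ioo (0 : ℝ) 1) (hx : x ∈ Set.Icc (0 : ℝ) 1) :
    |(x - varProj θ l e) * bernoulliVar (x * θ + l)| ≤ 1 := by
  rw [abs_mul, abs_of_pos (bernoulliVar_pos _)]
  exact mul_le_one₀ (abs_sub_varProj_le he hx) (bernoulliVar_pos _).le
    ((bernoulliVar_le _).trans (by norm_num))

lemma abs_thetaWeight_le (he : e ∈ Set.Ioo (0 : ℝ) 1) :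
    |varProj θ l e * (1 - varProj θ l e) * (1 - 2 * Real.sigmoid (θ + l))| ≤ 1 := by
  obtain ⟨h0, h1⟩ := varProj_mul_one_sub_mem (θ := θ) (l := l) he
  rw [abs_mul, abs_of_nonneg h0]
  exact mul_le_one₀ h1 (abs_nonneg _) (abs_one_sub_two_sigmoid_le _)

lemma abs_predWeight_le (he : e ∈ Set.Ioo (0 : ℝ) 1) :
    |varProj θ l e * (1 - varProj θ l e) * (2 * Real.sigmoid l - 2 * Real.sigmoid (θ + l))|
      ≤ 2 := by
  obtain ⟨h0, h1⟩ := varProj_mul_one_sub_mem (θ := θ) (l := l) he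
  rw [abs_mul, abs_of_nonneg h0]
  have : |2 * Real.sigmoid l - 2 * Real.sigmoid (θ + l)| ≤ 2 := by
    rw [abs_le]; constructor <;> linarith [Real.sigmoid_pos l, Real.sigmoid_lt_one l,
      Real.sigmoid_pos (θ + l), Real.sigmoid_lt_one (θ + l)]
  nlinarith [abs_nonneg (2 * Real.sigmoid l - 2 * Real.sigmoid (θ + l))]

lemma abs_crossTheta_le (he : e ∈ Set.Ioo (0 : ℝ) 1) (hx : x ∈ Set.Icc (0 : ℝ) 1)
    (hy : y ∈ Set.Icc (0 : ℝ) 1) : |crossTheta θ l e x y| ≤ 3 := by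
  obtain ⟨h0, h1⟩ := varProj_mem_Ioo θ l he
  refine (abs_add_le _ _).trans ?_
  have a1 : |(y - Real.sigmoid (x * θ + l)) * (varProj θ l e * (1 - varProj θ l e) *
      (1 - 2 * Real.sigmoid (θ + l)))| ≤ 1 := by
    rw [abs_mul]
    exact mul_le_one₀ (abs_resp_sub_le _ hy) (abs_nonneg _) (abs_thetaWeight_le he)
  have a2 : |(x - varProj θ l e) * bernoulliVar (x * θ + l) * varProj θ l e| ≤ 1 := by
    rw [abs_mul, abs_of_pos h0]
    exact mul_le_one₀ (abs_sub_varProj_mul_le he hx) h0.le h1.le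
  linarith

lemma abs_crossPred_le (he : e ∈ Set.Ioo (0 : ℝ) 1) (hx : x ∈ Set.Icc (0 : ℝ) 1)
    (hy : y ∈ Set.Icc (0 : ℝ) 1) : |crossPred θ l e x y| ≤ 3 := by
  refine (abs_add_le _ _).trans ?_
  have a1 : |(y - Real.sigmoid (x * θ + l)) * (varProj θ l e * (1 - varProj θ l e) *
      (2 * Real.sigmoid l - 2 * Real.sigmoid (θ + l)))| ≤ 1 * 2 := by
    rw [abs_mul]
    exact mul_le_mul (abs_resp_sub_le _ hy) (abs_predWeight_le he) (abs_nonneg _) zero_le_one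
  have a2 := abs_sub_varProj_mul_le (θ := θ) (l := l) he hx
  linarith

/-- The weighted residual of a binary regressor is a multiple of its centred value. -/
lemma sub_varProj_mul_eq (he : e ∈ Set.Ioo (0 : ℝ) 1) (hx : x = 0 ∨ x = 1) :
    (x - varProj θ l e) * bernoulliVar (x * θ + l)
      = (x - e) * ((1 - varProj θ l e) * bernoulliVar (θ + l)
        + varProj θ l e * bernoulliVar l) := by
  have h := varProj_balance θ l he
  rcases hx with rfl | rfl
  · simp only [zero_mul, zero_add]; linarith
  · simp only [one_mul]; linarith

end Bounds

lemma measurable_varProj : Measurable fun v : ℝ × ℝ × ℝ => varProj v.1 v.2.1 v.2.2 := by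
  unfold varProj
  have := continuous_bernoulliVar.measurable
  fun_prop

section Sample

variable {Ω : Type*} [MeasurableSpace Ω] {P : Measure Ω}
  {n d : ℕ} {Y X : Fin n → Ω → ℝ} {Z : Fin n → Ω → Fin d → ℝ} {θ₀ : ℝ} {β₀ : Fin d → ℝ}

/-- A version of the propensity scores that is a measurable function of the covariates with values
in `(0, 1)`. -/
structure IsPropensityVersion (P : Measure Ω) (X : Fin n → Ω → ℝ) (Z : Fin n → Ω → Fin d → ℝ)
    (e : Fin n → (Fin d → ℝ) → ℝ) : Prop where
  measurable : ∀ i, Measurable (e i)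
  mem : ∀ i z, e i z ∈ Set.Ioo (0 : ℝ) 1
  ae_eq : ∀ i, ∀ᵐ ω ∂P, propensity P (X i) (Z i) ω = e i (Z i ω)

/-- The conditional probability factors through `Z_i`. Resetting the factor to `1/2` wherever it
leaves `(0, 1)` alters it only on a null event and makes all later pointwise bounds unconditional.
-/
lemma IsLogisticSample.exists_propensityVersion (hs : IsLogisticSample P Y X Z θ₀ β₀) :
    ∃ e, IsPropensityVersion P X Z e := by
  have h : ∀ i, ∃ g : (Fin d → ℝ) → ℝ, Measurable g ∧ propensity P (X i) (Z i) = g ∘ Z i :=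
    fun i => Measurable.exists_eq_measurable_comp stronglyMeasurable_condExp.measurable
  choose g hg hgz using h
  classical
  have hset : ∀ i, MeasurableSet (g i ⁻¹' Set.Ioo 0 1) := fun i => hg i measurableSet_Ioo
  refine ⟨fun i => (g i ⁻¹' Set.Ioo 0 1).piecewise (g i) fun _ => 1 / 2,
    fun i => (hg i).piecewise (hset i) measurable_const, fun i z => ?_, fun i => ?_⟩
  · by_cases hz : z ∈ g i ⁻¹' Set.Ioo 0 1
    · rw [Set.piecewise_eq_of_mem _ _ _ hz]; exact hz
    · rw [Set.piecewise_eq_of_notMem _ _ _ hz]; norm_num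
  · filter_upwards [hs.propensity_mem i] with ω hω
    rw [hgz i] at hω ⊢
    rw [Set.piecewise_eq_of_mem _ _ _ (show Z i ω ∈ g i ⁻¹' Set.Ioo 0 1 from hω)]
    rfl

lemma IsLogisticSample.mem_Icc_Y (hs : IsLogisticSample P Y X Z θ₀ β₀) (i : Fin n) (ω : Ω) :
    Y i ω ∈ Set.Icc (0 : ℝ) 1 := by
  rcases hs.binary_Y i ω with h | h <;> simp [h]

lemma IsLogisticSample.mem_Icc_X (hs : IsLogisticSample P Y X Z θ₀ β₀) (i : Fin n) (ω : Ω) :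
    X i ω ∈ Set.Icc (0 : ℝ) 1 := by
  rcases hs.binary_X i ω with h | h <;> simp [h]

variable [IsProbabilityMeasure P]

lemma IsLogisticSample.integral_outcome_sub_mul (hs : IsLogisticSample P Y X Z θ₀ β₀) (i : Fin n)
    {g : ℝ × (Fin d → ℝ) → ℝ} (hg : Measurable g) {B : ℝ}
    (hB : ∀ᵐ ω ∂P, |g (X i ω, Z i ω)| ≤ B) :
    ∫ ω, (Y i ω - Real.sigmoid (X i ω * θ₀ + Z i ω ⬝ᵥ β₀)) * g (X i ω, Z i ω) ∂P = 0 := by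
  have hU : Measurable fun ω => (X i ω, Z i ω) := (hs.measurable_X i).prodMk (hs.measurable_Z i)
  have h := integral_indicator_sub_mul_eq_zero hU.comap_le
    (hs.measurable_Y i (measurableSet_singleton 1)) (hs.outcome i)
    ((hg.comp (comap_measurable _)).stronglyMeasurable) hB
  rw [← h]
  refine integral_congr_ae (Eventually.of_forall fun ω => ?_)
  have : Y i ω = (Y i ⁻¹' {1}).indicator (fun _ => (1 : ℝ)) ω := by
    rcases hs.binary_Y i ω with h | h <;> simp [Set.indicator, h]
  simp only [Function.comp]
  rw [← this]

lemma IsLogisticSample.integral_propensity_sub_mul (hs : IsLogisticSample P Y X Z θ₀ β₀)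
    {e : Fin n → (Fin d → ℝ) → ℝ} (he : IsPropensityVersion P X Z e) (i : Fin n)
    {g : (Fin d → ℝ) → ℝ} (hg : Measurable g) {B : ℝ} (hB : ∀ᵐ ω ∂P, |g (Z i ω)| ≤ B) :
    ∫ ω, (X i ω - e i (Z i ω)) * g (Z i ω) ∂P = 0 := by
  have h := integral_indicator_sub_mul_eq_zero (hs.measurable_Z i).comap_le
    (hs.measurable_X i (measurableSet_singleton 1)) (he.ae_eq i)
    ((hg.comp (comap_measurable _)).stronglyMeasurable) hB
  rw [← h]
  refine integral_congr_ae (Eventually.of_forall fun ω => ?_)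
  have : X i ω = (X i ⁻¹' {1}).indicator (fun _ => (1 : ℝ)) ω := by
    rcases hs.binary_X i ω with h | h <;> simp [Set.indicator, h]
  simp only [Function.comp]
  rw [← this]

/-- By `sub_varProj_mul_eq` the weighted residual is `X_i - e_i` times a bounded function of `Z_i`,
hence centred given `Z_i`. This is the orthogonality that removes the first-order bias. -/
lemma IsLogisticSample.integral_residual_mul (hs : IsLogisticSample P Y X Z θ₀ β₀)
    {e : Fin n → (Fin d → ℝ) → ℝ} (he : IsPropensityVersion P X Z e) (i : Fin n)
    {g : (Fin d → ℝ) → ℝ} (hg : Measurable g) {B : ℝ} (hB : ∀ᵐ ω ∂P, |g (Z i ω)| ≤ B) :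
    ∫ ω, (X i ω - varProj θ₀ (Z i ω ⬝ᵥ β₀) (e i (Z i ω)))
      * bernoulliVar (X i ω * θ₀ + Z i ω ⬝ᵥ β₀) * g (Z i ω) ∂P = 0 := by
  have hdot := measurable_dotProduct_const β₀
  have hv := continuous_bernoulliVar.measurable
  have hei := he.measurable i
  have hh : Measurable fun z : Fin d → ℝ => varProj θ₀ (z ⬝ᵥ β₀) (e i z) :=
    measurable_varProj.comp (g := fun v : ℝ × ℝ × ℝ => varProj v.1 v.2.1 v.2.2)
      (f := fun z : Fin d → ℝ => (θ₀, z ⬝ᵥ β₀, e i z))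
      (measurable_const.prodMk (hdot.prodMk hei))
  have hG : Measurable fun z : Fin d → ℝ =>
      ((1 - varProj θ₀ (z ⬝ᵥ β₀) (e i z)) * bernoulliVar (θ₀ + z ⬝ᵥ β₀)
      + varProj θ₀ (z ⬝ᵥ β₀) (e i z) * bernoulliVar (z ⬝ᵥ β₀)) * g z :=
    (((hh.const_sub 1).mul (hv.comp (hdot.const_add θ₀))).add (hh.mul (hv.comp hdot))).mul hg
  refine Eq.trans ?_ (hs.integral_propensity_sub_mul he i hG (B := 2 * B) ?_)
  · refine integral_congr_ae (Eventually.of_forall fun ω => ?_)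
    simp only
    rw [sub_varProj_mul_eq (he.mem i _) (hs.binary_X i ω), mul_assoc]
  · filter_upwards [hB] with ω hω
    obtain ⟨h0, h1⟩ := varProj_mem_Ioo θ₀ (Z i ω ⬝ᵥ β₀) (he.mem i (Z i ω))
    have v0 := bernoulliVar_pos (Z i ω ⬝ᵥ β₀)
    have v1 := bernoulliVar_le (Z i ω ⬝ᵥ β₀)
    have v2 := bernoulliVar_pos (θ₀ + Z i ω ⬝ᵥ β₀)
    have v3 := bernoulliVar_le (θ₀ + Z i ω ⬝ᵥ β₀)
    have a0 := mul_nonneg (sub_nonneg.2 h1.le) v2.le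
    have a1 := mul_le_one₀ (sub_le_self 1 h0.le) v2.le (v3.trans (by norm_num))
    have b0 := mul_nonneg h0.le v0.le
    have b1 := mul_le_one₀ h1.le v0.le (v1.trans (by norm_num))
    rw [abs_mul]
    refine mul_le_mul ?_ hω (abs_nonneg _) zero_le_two
    rw [abs_of_nonneg (add_nonneg a0 b0)]
    linarith

end Sample

/-! ### Measurability and normalization of the posteriors -/

lemma measurable_tilted {E α : Type*} [MeasurableSpace E] [MeasurableSpace α] (μ : Measure α)
    [SFinite μ] {f : E → α → ℝ} (hf : Measurable (Function.uncurry f)) :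
    Measurable fun w => μ.tilted (f w) := by
  refine Measure.measurable_of_measurable_coe _ fun s hs => ?_
  simp_rw [tilted_apply' _ _ hs]
  have h1 : Measurable fun w => ∫ a, Real.exp (f w a) ∂μ :=
    (StronglyMeasurable.integral_prod_right (f := fun w a => Real.exp (f w a))
      (Real.measurable_exp.comp hf).stronglyMeasurable).measurable
  refine Measurable.lintegral_prod_right'
    (f := fun p : E × α => ENNReal.ofReal (Real.exp (f p.1 p.2) / ∫ x, Real.exp (f p.1 x) ∂μ)) ?_
  exact ((Real.measurable_exp.comp hf).div (h1.comp measurable_fst)).ennreal_ofReal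

/-- A family of exponentially tilted measures, as a kernel. -/
noncomputable def tiltedKernel {E α : Type*} [MeasurableSpace E] [MeasurableSpace α]
    (μ : Measure α) [SFinite μ] {f : E → α → ℝ} (hf : Measurable (Function.uncurry f)) :
    Kernel E α where
  toFun w := μ.tilted (f w)
  measurable' := measurable_tilted μ hf

instance {E α : Type*} [MeasurableSpace E] [MeasurableSpace α]
    (μ : Measure α) [SFinite μ] {f : E → α → ℝ} (hf : Measurable (Function.uncurry f)) :
    IsFiniteKernel (tiltedKernel μ hf) :=
  ⟨⟨1, ENNReal.one_lt_top, fun w => by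
    change μ.tilted (f w) Set.univ ≤ 1
    exact prob_le_one⟩⟩

instance (π : ℝ → ℝ) : SFinite (densityPrior π) := by unfold densityPrior; infer_instance

/-- A measurable probability density on the real line. -/
structure IsProbDensity (π : ℝ → ℝ) : Prop where
  measurable : Measurable π
  nonneg : ∀ t, 0 ≤ π t
  lintegral_eq_one : ∫⁻ t, ENNReal.ofReal (π t) = 1

lemma IsProbDensity.isProbabilityMeasure {π : ℝ → ℝ} (hπ : IsProbDensity π) :
    IsProbabilityMeasure (densityPrior π) :=
  ⟨by rw [densityPrior, withDensity_apply _ MeasurableSet.univ, Measure.restrict_univ,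
    hπ.lintegral_eq_one]⟩

lemma IsProbDensity.integrable {π : ℝ → ℝ} (hπ : IsProbDensity π) : Integrable π :=
  (lintegral_ofReal_ne_top_iff_integrable hπ.measurable.aestronglyMeasurable
    (Eventually.of_forall hπ.nonneg)).1 (by rw [hπ.lintegral_eq_one]; exact ENNReal.one_ne_top)

section LogLik

variable {n d : ℕ}

lemma measurable_logLik {E : Type*} [MeasurableSpace E] {y' : E → Fin n → ℝ}
    (hy' : Measurable y') {η : E → Fin n → ℝ} (hη : Measurable η) :
    Measurable fun w => logLik (y' w) (η w) := by
  unfold logLik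
  fun_prop

/-- `log (1 + exp η)` dominates both `0` and `η`, hence `y * η`. The likelihood is therefore bounded
by `1`, and every posterior built from a probability prior can be normalized. -/
lemma mul_sub_log_one_add_exp_nonpos {y : ℝ} (hy : y ∈ Set.Icc (0 : ℝ) 1) (η : ℝ) :
    y * η - Real.log (1 + Real.exp η) ≤ 0 := by
  have h0 : 0 ≤ Real.log (1 + Real.exp η) :=
    Real.log_nonneg (by linarith [Real.exp_pos η])
  have h1 : η ≤ Real.log (1 + Real.exp η) := by
    rw [Real.le_log_iff_exp_le (by positivity)]; linarith
  rcases le_total 0 η with h | h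
  · nlinarith [hy.2]
  · nlinarith [hy.1]

lemma logLik_nonpos {y : Fin n → ℝ} (hy : ∀ i, y i ∈ Set.Icc (0 : ℝ) 1) (η : Fin n → ℝ) :
    logLik y η ≤ 0 :=
  Finset.sum_nonpos fun i _ => mul_sub_log_one_add_exp_nonpos (hy i) (η i)

lemma integrable_exp_logLik {α : Type*} [MeasurableSpace α] (μ : Measure α) [IsFiniteMeasure μ]
    {y : Fin n → ℝ} (hy : ∀ i, y i ∈ Set.Icc (0 : ℝ) 1) {η : α → Fin n → ℝ} (hη : Measurable η) :
    Integrable (fun a => Real.exp (logLik y (η a))) μ :=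
  Integrable.of_bound (Real.measurable_exp.comp
    (measurable_logLik measurable_const hη)).aestronglyMeasurable 1
    (Eventually.of_forall fun a => by
      rw [Real.norm_of_nonneg (Real.exp_pos _).le]
      exact Real.exp_le_one_iff.2 (logLik_nonpos hy _))

lemma measurable_outcome_exponent (y : Fin n → ℝ) :
    Measurable (Function.uncurry fun (w : Cov n d) (u : ℝ × (Fin d → ℝ)) =>
      logLik y fun i => w.1 i * u.1 + w.2 i ⬝ᵥ u.2) := by
  refine measurable_logLik measurable_const (measurable_pi_lambda _ fun i => ?_)
  unfold dotProduct
  fun_prop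

lemma measurable_propensity_exponent :
    Measurable (Function.uncurry fun (w : Cov n d) (γ : Fin d → ℝ) =>
      logLik w.1 fun i => w.2 i ⬝ᵥ γ) := by
  refine measurable_logLik (by fun_prop) (measurable_pi_lambda _ fun i => ?_)
  unfold dotProduct
  fun_prop

lemma isProbabilityMeasure_outcomePosterior {π : ℝ → ℝ} (hπ : IsProbDensity π)
    (priorβ : Measure (Fin d → ℝ)) [IsProbabilityMeasure priorβ] {y : Fin n → ℝ}
    (hy : ∀ i, y i ∈ Set.Icc (0 : ℝ) 1) (x : Fin n → ℝ) (z : Fin n → Fin d → ℝ) :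
    IsProbabilityMeasure (outcomePosterior π priorβ y x z) := by
  have := hπ.isProbabilityMeasure
  exact isProbabilityMeasure_tilted (integrable_exp_logLik _ hy
    (measurable_pi_lambda _ fun i => by unfold dotProduct; fun_prop))

lemma isProbabilityMeasure_propensityPosterior (priorγ : Measure (Fin d → ℝ))
    [IsProbabilityMeasure priorγ] {x : Fin n → ℝ} (hx : ∀ i, x i ∈ Set.Icc (0 : ℝ) 1)
    (z : Fin n → Fin d → ℝ) : IsProbabilityMeasure (propensityPosterior priorγ x z) :=
  isProbabilityMeasure_tilted (integrable_exp_logLik _ hx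
    (measurable_pi_lambda _ fun i => by unfold dotProduct; fun_prop))

end LogLik

section Marginal

variable {n d : ℕ} {π : ℝ → ℝ}

/-- The type of draws of the nuisance parameters. -/
abbrev Draw (d : ℕ) : Type := (ℝ × (Fin d → ℝ)) × (Fin d → ℝ)

lemma measurable_projEst :
    Measurable fun p : (Fin n → Fin d → ℝ) × Draw d => projEst p.1 p.2 := by
  refine measurable_pi_lambda _ fun i => ?_
  have h1 : Measurable fun p : (Fin n → Fin d → ℝ) × Draw d => p.1 i ⬝ᵥ p.2.1.2 := by
    unfold dotProduct; fun_prop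
  have h2 : Measurable fun p : (Fin n → Fin d → ℝ) × Draw d => p.1 i ⬝ᵥ p.2.2 := by
    unfold dotProduct; fun_prop
  have h3 : Measurable fun p : (Fin n → Fin d → ℝ) × Draw d => p.2.1.1 := by fun_prop
  exact measurable_varProj.comp (g := fun v : ℝ × ℝ × ℝ => varProj v.1 v.2.1 v.2.2)
    (f := fun p : (Fin n → Fin d → ℝ) × Draw d =>
      (p.2.1.1, p.1 i ⬝ᵥ p.2.1.2, Real.sigmoid (p.1 i ⬝ᵥ p.2.2)))
    (h3.prodMk (h1.prodMk (measurable_sigmoid_real.comp h2)))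

lemma measurable_phiEst :
    Measurable fun p : (Fin n → Fin d → ℝ) × Draw d => phiEst p.1 p.2 := by
  refine measurable_pi_lambda _ fun i => ?_
  have h1 : Measurable fun p : (Fin n → Fin d → ℝ) × Draw d => p.1 i ⬝ᵥ p.2.1.2 := by
    unfold dotProduct; fun_prop
  have h2 := (measurable_pi_apply i).comp (measurable_projEst (n := n) (d := d))
  have h3 : Measurable fun p : (Fin n → Fin d → ℝ) × Draw d => p.2.1.1 := by fun_prop
  exact (h3.mul h2).add h1

lemma measurable_condDensity (hπ : IsProbDensity π) (y : Fin n → ℝ) :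
    Measurable fun p : (Cov n d × Draw d) × ℝ =>
      condDensity π y p.1.1.1 (projEst p.1.1.2 p.1.2) (phiEst p.1.1.2 p.1.2) p.2 := by
  have hnum : Measurable fun p : (Cov n d × Draw d) × ℝ =>
      π p.2 * Real.exp (condLogLik y p.1.1.1 (projEst p.1.1.2 p.1.2) (phiEst p.1.1.2 p.1.2) p.2) := by
    have h1 : Measurable fun p : (Cov n d × Draw d) × ℝ => projEst p.1.1.2 p.1.2 :=
      measurable_projEst.comp (g := fun p : (Fin n → Fin d → ℝ) × Draw d => projEst p.1 p.2)
        (f := fun p : (Cov n d × Draw d) × ℝ => (p.1.1.2, p.1.2)) (by fun_prop)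
    have h2 : Measurable fun p : (Cov n d × Draw d) × ℝ => phiEst p.1.1.2 p.1.2 :=
      measurable_phiEst.comp (g := fun p : (Fin n → Fin d → ℝ) × Draw d => phiEst p.1 p.2)
        (f := fun p : (Cov n d × Draw d) × ℝ => (p.1.1.2, p.1.2)) (by fun_prop)
    refine (hπ.measurable.comp measurable_snd).mul (Real.measurable_exp.comp ?_)
    refine measurable_logLik measurable_const (measurable_pi_lambda _ fun i => ?_)
    have h3 := (measurable_pi_apply i).comp h1
    have h4 := (measurable_pi_apply i).comp h2
    have h5 : Measurable fun p : (Cov n d × Draw d) × ℝ => p.1.1.1 i := by fun_prop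
    exact (measurable_snd.mul (h5.sub h3)).add h4
  exact hnum.div ((StronglyMeasurable.integral_prod_right' (ν := volume)
    hnum.stronglyMeasurable).measurable.comp measurable_fst)

lemma integrable_prior_mul_exp (hπ : IsProbDensity π) {y : Fin n → ℝ} (hy : ∀ i, y i ∈ Set.Icc (0 : ℝ) 1)
    (x h φ : Fin n → ℝ) : Integrable fun t => π t * Real.exp (condLogLik y x h φ t) := by
  refine hπ.integrable.mul_bdd (c := 1)
    ((Real.measurable_exp.comp (continuous_condLogLik y x h φ).measurable).aestronglyMeasurable)
    (Eventually.of_forall fun t => ?_)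
  rw [Real.norm_of_nonneg (Real.exp_pos _).le]
  exact Real.exp_le_one_iff.2 (logLik_nonpos hy _)

lemma integral_prior_mul_exp_pos (hπ : IsProbDensity π) {y : Fin n → ℝ} (hy : ∀ i, y i ∈ Set.Icc (0 : ℝ) 1)
    (x h φ : Fin n → ℝ) : 0 < ∫ t, π t * Real.exp (condLogLik y x h φ t) := by
  have hi := integrable_prior_mul_exp hπ hy x h φ
  rw [integral_pos_iff_support_of_nonneg (fun t => mul_nonneg (hπ.nonneg t) (Real.exp_pos _).le) hi]
  have : Function.support (fun t => π t * Real.exp (condLogLik y x h φ t)) = Function.support π := by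
    ext t; simp [(Real.exp_pos _).ne']
  rw [this, ← integral_pos_iff_support_of_nonneg hπ.nonneg
    hπ.integrable,
    integral_eq_lintegral_of_nonneg_ae (Eventually.of_forall hπ.nonneg) hπ.measurable.aestronglyMeasurable,
    hπ.lintegral_eq_one]
  simp

lemma condDensity_nonneg (hπ : IsProbDensity π) {y : Fin n → ℝ} (hy : ∀ i, y i ∈ Set.Icc (0 : ℝ) 1)
    (x h φ : Fin n → ℝ) (t : ℝ) : 0 ≤ condDensity π y x h φ t :=
  div_nonneg (mul_nonneg (hπ.nonneg t) (Real.exp_pos _).le)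
    (integral_prior_mul_exp_pos hπ hy x h φ).le

lemma integrable_condDensity (hπ : IsProbDensity π) {y : Fin n → ℝ} (hy : ∀ i, y i ∈ Set.Icc (0 : ℝ) 1)
    (x h φ : Fin n → ℝ) : Integrable (condDensity π y x h φ) :=
  (integrable_prior_mul_exp hπ hy x h φ).div_const _

lemma integral_condDensity (hπ : IsProbDensity π) {y : Fin n → ℝ} (hy : ∀ i, y i ∈ Set.Icc (0 : ℝ) 1)
    (x h φ : Fin n → ℝ) : ∫ t, condDensity π y x h φ t = 1 := by
  unfold condDensity
  rw [integral_div]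
  exact div_self (integral_prior_mul_exp_pos hπ hy x h φ).ne'

variable (priorβ priorγ : Measure (Fin d → ℝ))

lemma marginalPosterior_singleton (y x : Fin n → ℝ) (z : Fin n → Fin d → ℝ) (t : ℝ) :
    marginalPosterior π priorβ priorγ y x z {t} = 0 :=
  withDensity_absolutelyContinuous _ _ (Real.volume_singleton)

/-- The joint posterior of the nuisance parameters. -/
noncomputable def drawPosterior (π : ℝ → ℝ) (priorβ priorγ : Measure (Fin d → ℝ))
    (y x : Fin n → ℝ) (z : Fin n → Fin d → ℝ) : Measure (Draw d) :=
  (outcomePosterior π priorβ y x z).prod (propensityPosterior priorγ x z)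

/-- Posterior probability of `(-∞, t]` given a draw of the nuisance parameters. -/
noncomputable def condCdf (π : ℝ → ℝ) (y x : Fin n → ℝ) (z : Fin n → Fin d → ℝ) (t : ℝ)
    (u : Draw d) : ℝ :=
  ∫ θ in Set.Iic t, condDensity π y x (projEst z u) (phiEst z u) θ

instance (y x : Fin n → ℝ) (z : Fin n → Fin d → ℝ) :
    SFinite (outcomePosterior π priorβ y x z) := by
  unfold outcomePosterior; infer_instance

instance (x : Fin n → ℝ) (z : Fin n → Fin d → ℝ) :
    SFinite (propensityPosterior priorγ x z) := by
  unfold propensityPosterior; infer_instance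

lemma marginalPosterior_apply (hπ : IsProbDensity π) (y x : Fin n → ℝ) (z : Fin n → Fin d → ℝ) {s : Set ℝ}
    (hs : MeasurableSet s) :
    marginalPosterior π priorβ priorγ y x z s
      = ∫⁻ u, (∫⁻ θ in s, ENNReal.ofReal (condDensity π y x (projEst z u) (phiEst z u) θ))
          ∂drawPosterior π priorβ priorγ y x z := by
  rw [marginalPosterior, withDensity_apply _ hs]
  unfold marginalDensity drawPosterior
  rw [lintegral_lintegral_swap]
  have h := ((measurable_condDensity (d := d) hπ y).ennreal_ofReal.comp
    (f := fun p : ℝ × Draw d => ((((x, z) : Cov n d), p.2), p.1)) (by fun_prop))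
  exact h.aemeasurable

lemma condCdf_mem (hπ : IsProbDensity π) {y : Fin n → ℝ} (hy : ∀ i, y i ∈ Set.Icc (0 : ℝ) 1) (x : Fin n → ℝ)
    (z : Fin n → Fin d → ℝ) (t : ℝ) (u : Draw d) : condCdf π y x z t u ∈ Set.Icc (0 : ℝ) 1 := by
  have h0 := condDensity_nonneg hπ hy x (projEst z u) (phiEst z u)
  refine ⟨setIntegral_nonneg measurableSet_Iic fun θ _ => h0 θ, ?_⟩
  rw [← integral_condDensity hπ hy x (projEst z u) (phiEst z u)]
  exact setIntegral_le_integral (integrable_condDensity hπ hy _ _ _)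
    (Eventually.of_forall h0)

lemma measurable_condCdf (hπ : IsProbDensity π) (y x : Fin n → ℝ) (z : Fin n → Fin d → ℝ) (t : ℝ) :
    Measurable (condCdf (d := d) π y x z t) := by
  have h := ((measurable_condDensity (d := d) hπ y).comp
    (f := fun p : Draw d × ℝ => ((((x, z) : Cov n d), p.1), p.2)) (by fun_prop))
  exact (StronglyMeasurable.integral_prod_right' (ν := volume.restrict (Set.Iic t))
    h.stronglyMeasurable).measurable

lemma marginalPosterior_real_Iic (hπ : IsProbDensity π) {y x : Fin n → ℝ} (hy : ∀ i, y i ∈ Set.Icc (0 : ℝ) 1)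
    (z : Fin n → Fin d → ℝ) (t : ℝ) :
    (marginalPosterior π priorβ priorγ y x z).real (Set.Iic t)
      = ∫ u, condCdf π y x z t u ∂drawPosterior π priorβ priorγ y x z := by
  rw [integral_eq_lintegral_of_nonneg_ae (Eventually.of_forall fun u =>
    (condCdf_mem hπ hy x z t u).1)
    (measurable_condCdf hπ y x z t).aestronglyMeasurable, measureReal_def,
    marginalPosterior_apply _ _ hπ _ _ _ measurableSet_Iic]
  congr 1
  refine lintegral_congr fun u => ?_
  exact (ofReal_integral_eq_lintegral_ofReal
    (integrable_condDensity hπ hy _ _ _).integrableOn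
    (Eventually.of_forall (condDensity_nonneg hπ hy _ _ _))).symm

variable [IsProbabilityMeasure priorβ] [IsProbabilityMeasure priorγ]

lemma isProbabilityMeasure_marginalPosterior (hπ : IsProbDensity π) {y x : Fin n → ℝ}
    (hy : ∀ i, y i ∈ Set.Icc (0 : ℝ) 1) (hx : ∀ i, x i ∈ Set.Icc (0 : ℝ) 1)
    (z : Fin n → Fin d → ℝ) :
    IsProbabilityMeasure (marginalPosterior π priorβ priorγ y x z) := by
  have h1 := isProbabilityMeasure_outcomePosterior hπ priorβ hy x z
  have h2 := isProbabilityMeasure_propensityPosterior priorγ hx z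
  constructor
  rw [marginalPosterior_apply _ _ hπ _ _ _ MeasurableSet.univ]
  have : ∀ u : Draw d, ∫⁻ θ in Set.univ,
      ENNReal.ofReal (condDensity π y x (projEst z u) (phiEst z u) θ) = 1 := fun u => by
    rw [Measure.restrict_univ, ← ofReal_integral_eq_lintegral_ofReal
      (integrable_condDensity hπ hy _ _ _)
      (Eventually.of_forall (condDensity_nonneg hπ hy _ _ _)),
      integral_condDensity hπ hy, ENNReal.ofReal_one]
  simp_rw [this]
  unfold drawPosterior
  simp

/-- Conditioning on the covariates requires coverage events measurable in them. The nuisance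
posteriors are kernels in the covariates, and the mass is an integral against their product; the
responses can be held fixed because they take finitely many values. -/
lemma measurable_marginalPosterior_Iic (hπ : IsProbDensity π) (y : Fin n → ℝ) (t : ℝ) :
    Measurable fun w : Cov n d =>
      (marginalPosterior π priorβ priorγ y w.1 w.2).real (Set.Iic t) := by
  refine Measurable.ennreal_toReal ?_
  simp_rw [marginalPosterior_apply _ _ hπ _ _ _ measurableSet_Iic]
  let κ₁ := tiltedKernel ((densityPrior π).prod priorβ) (measurable_outcome_exponent (d := d) y)
  let κ₂ := tiltedKernel priorγ (measurable_propensity_exponent (n := n) (d := d))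
  have hκ : ∀ w : Cov n d, drawPosterior π priorβ priorγ y w.1 w.2 = (κ₁ ×ₖ κ₂) w := fun w =>
    (Kernel.prod_apply κ₁ κ₂ w).symm
  simp_rw [hκ]
  have h : Measurable fun p : Cov n d × Draw d => ∫⁻ θ in Set.Iic t, ENNReal.ofReal
      (condDensity π y p.1.1 (projEst p.1.2 p.2) (phiEst p.1.2 p.2) θ) :=
    Measurable.lintegral_prod_right' (ν := volume.restrict (Set.Iic t))
      (measurable_condDensity hπ y).ennreal_ofReal
  exact Measurable.lintegral_kernel_prod_right' h

end Marginal

/-! ### Quantiles -/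

section Quantile

variable {ν : Measure ℝ} [IsProbabilityMeasure ν] {p : ℝ}

lemma quantile_set_nonempty (hp : p < 1) : {t : ℝ | p ≤ ν.real (Set.Iic t)}.Nonempty := by
  have h1 : Tendsto (fun t => ν.real (Set.Iic t)) atTop (𝓝 1) :=
    (tendsto_cdf_atTop ν).congr fun t => cdf_eq_real ν t
  obtain ⟨a, ha⟩ := (h1.eventually_const_lt hp).exists
  exact ⟨a, ha.le⟩

lemma quantile_set_bddBelow (hp : 0 < p) : BddBelow {t : ℝ | p ≤ ν.real (Set.Iic t)} := by
  have h0 : Tendsto (fun t => ν.real (Set.Iic t)) atBot (𝓝 0) :=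
    (tendsto_cdf_atBot ν).congr fun t => cdf_eq_real ν t
  obtain ⟨a, ha⟩ := (h0.eventually_lt_const hp).exists
  refine ⟨a, fun t ht => ?_⟩
  by_contra! hlt
  exact absurd ((ht.trans (measureReal_mono (Set.Iic_subset_Iic.2 hlt.le)))) ha.not_ge

/-- Rational thresholds suffice by monotonicity, so the event that a quantile lies below `θ` is a
countable union of events on the distribution function, hence measurable. -/
lemma quantile_lt_iff (hp0 : 0 < p) (hp1 : p < 1) (θ : ℝ) :
    quantile ν p < θ ↔ ∃ q : ℚ, (q : ℝ) < θ ∧ p ≤ ν.real (Set.Iic (q : ℝ)) := by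
  constructor
  · intro h
    obtain ⟨t, ht, htθ⟩ := exists_lt_of_csInf_lt (quantile_set_nonempty hp1) h
    obtain ⟨q, hq1, hq2⟩ := exists_rat_btwn htθ
    exact ⟨q, hq2, le_trans ht (measureReal_mono (Set.Iic_subset_Iic.2 hq1.le))⟩
  · rintro ⟨q, hq, hpq⟩
    exact (csInf_le (quantile_set_bddBelow hp0) hpq).trans_lt hq

lemma lt_quantile_iff (hν : ∀ x, ν {x} = 0) (hp0 : 0 < p) (hp1 : p < 1) (θ : ℝ) :
    θ < quantile ν p ↔ ν.real (Set.Iic θ) < p := by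
  constructor
  · intro h
    by_contra! hle
    exact absurd (csInf_le (quantile_set_bddBelow hp0) hle) h.not_ge
  · intro h
    have hc := (continuous_measureReal_Iic ν hν).tendsto θ
    obtain ⟨δ, hδ, hball⟩ := Metric.eventually_nhds_iff.1 (hc.eventually_lt_const h)
    have hlt : ν.real (Set.Iic (θ + δ / 2)) < p := hball (by
      rw [Real.dist_eq, add_sub_cancel_left, abs_of_pos (half_pos hδ)]; exact half_lt_self hδ)
    refine (lt_add_of_pos_right θ (half_pos hδ)).trans_le
      (le_csInf (quantile_set_nonempty hp1) fun t ht => ?_)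
    by_contra! hlt2
    exact absurd (le_trans ht (measureReal_mono (Set.Iic_subset_Iic.2 hlt2.le))) hlt.not_ge

/-- Without atoms the distribution function is still above `p` slightly to the left of `θ`. Compared
with `le_of_quantile_lt`, only the case of equality at `θ` is left undecided, and the coverage
argument tolerates it. -/
lemma quantile_lt_of_lt (hν : ∀ x, ν {x} = 0) (hp0 : 0 < p) {θ : ℝ}
    (h : p < ν.real (Set.Iic θ)) : quantile ν p < θ := by
  have hc := (continuous_measureReal_Iic ν hν).tendsto θ
  obtain ⟨δ, hδ, hball⟩ := Metric.eventually_nhds_iff.1 (hc.eventually_const_lt h)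
  have hlt : p < ν.real (Set.Iic (θ - δ / 2)) := hball (by
    rw [Real.dist_eq, sub_sub_cancel_left, abs_neg, abs_of_pos (half_pos hδ)]
    exact half_lt_self hδ)
  exact (csInf_le (quantile_set_bddBelow hp0) hlt.le).trans_lt (by linarith)

lemma le_of_quantile_lt (hp0 : 0 < p) (hp1 : p < 1) {θ : ℝ} (h : quantile ν p < θ) :
    p ≤ ν.real (Set.Iic θ) := by
  obtain ⟨q, hq, hpq⟩ := (quantile_lt_iff hp0 hp1 θ).1 h
  exact hpq.trans (measureReal_mono (Set.Iic_subset_Iic.2 hq.le))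

end Quantile

/-! ### Perturbation of the efficient score by the nuisance parameters -/

/-- Log-odds of a probability. -/
noncomputable abbrev logit (p : ℝ) : ℝ := Real.log (p / (1 - p))

/-- Coefficient of the error in the propensity log-odds in the expansion of one term of the
efficient score. -/
noncomputable def crossOdds (θ l e x y : ℝ) : ℝ :=
  (y - Real.sigmoid (x * θ + l)) * (varProj θ l e * (1 - varProj θ l e))

section Deterministic

variable {n d : ℕ} {y x e : Fin n → ℝ} {z : Fin n → Fin d → ℝ} {θ₀ : ℝ} {β₀ : Fin d → ℝ}
  {u : Draw d} {r ρ T τ : ℝ}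

/-- Summing the expansions leaves `n` quadratic remainders. The linear terms in `(θ̃, β)` are
handled by `ℓ¹`-`ℓ^∞` duality, with `ρ` the size of the error and `T` a bound on the coefficient
sums; the propensity term is carried along as `τ`, since it is not a linear function of finitely
many errors. -/
lemma score_close (he : ∀ i, e i ∈ Set.Ioo (0 : ℝ) 1) (hx : ∀ i, x i ∈ Set.Icc (0 : ℝ) 1)
    (hy : ∀ i, y i ∈ Set.Icc (0 : ℝ) 1) (hθ : |u.1.1 - θ₀| ≤ r)
    (hk : ∀ i, |z i ⬝ᵥ u.1.2 - z i ⬝ᵥ β₀| ≤ r)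
    (hb : ∀ i, |logit (Real.sigmoid (z i ⬝ᵥ u.2)) - logit (e i)| ≤ r)
    (hρ : l1Dist u.1 (θ₀, β₀) ≤ ρ)
    (hT0 : |∑ i, crossTheta θ₀ (z i ⬝ᵥ β₀) (e i) (x i) (y i)| ≤ T)
    (hT : ∀ j, |∑ i, crossPred θ₀ (z i ⬝ᵥ β₀) (e i) (x i) (y i) * z i j| ≤ T)
    (hB : |∑ i, (logit (Real.sigmoid (z i ⬝ᵥ u.2)) - logit (e i)) *
      crossOdds θ₀ (z i ⬝ᵥ β₀) (e i) (x i) (y i)| ≤ τ) :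
    |(∑ i, (x i - projEst z u i) *
        (y i - Real.sigmoid (θ₀ * (x i - projEst z u i) + phiEst z u i)))
      - ∑ i, scoreTerm θ₀ (z i ⬝ᵥ β₀) (e i) (x i) (y i)| ≤ n * (42 * r ^ 2) + ρ * T + τ := by
  have hT' : 0 ≤ T := (abs_nonneg _).trans hT0
  have hσ : ∀ t, Real.sigmoid t ∈ Set.Ioo (0 : ℝ) 1 := fun t =>
    ⟨Real.sigmoid_pos t, Real.sigmoid_lt_one t⟩
  have hexp : ∀ i, |(x i - projEst z u i) *
        (y i - Real.sigmoid (θ₀ * (x i - projEst z u i) + phiEst z u i))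
      - scoreTerm θ₀ (z i ⬝ᵥ β₀) (e i) (x i) (y i)
      + ((u.1.1 - θ₀) * crossTheta θ₀ (z i ⬝ᵥ β₀) (e i) (x i) (y i)
        + (z i ⬝ᵥ u.1.2 - z i ⬝ᵥ β₀) * crossPred θ₀ (z i ⬝ᵥ β₀) (e i) (x i) (y i)
        + (logit (Real.sigmoid (z i ⬝ᵥ u.2)) - logit (e i)) *
            crossOdds θ₀ (z i ⬝ᵥ β₀) (e i) (x i) (y i))| ≤ 42 * r ^ 2 := fun i =>
    score_expansion (he i) (hσ _) (hx i) (hy i) hθ (hk i) (hb i)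
  have hsum := (Finset.abs_sum_le_sum_abs _ Finset.univ).trans
    (Finset.sum_le_sum fun i (_ : i ∈ Finset.univ) => hexp i)
  rw [Finset.sum_add_distrib, Finset.sum_sub_distrib, Finset.sum_add_distrib,
    Finset.sum_add_distrib, ← Finset.mul_sum] at hsum
  simp only [Finset.sum_const, Finset.card_univ, Fintype.card_fin, nsmul_eq_mul] at hsum
  -- Exchanging the sums separates the error in `β`, which depends on the draw, from sums that
  -- depend only on the data and can be bounded once for all draws.
  have hpred : ∑ i, (z i ⬝ᵥ u.1.2 - z i ⬝ᵥ β₀) * crossPred θ₀ (z i ⬝ᵥ β₀) (e i) (x i) (y i)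
      = ∑ j, (u.1.2 j - β₀ j) * ∑ i, crossPred θ₀ (z i ⬝ᵥ β₀) (e i) (x i) (y i) * z i j := by
    simp_rw [Finset.mul_sum]
    rw [Finset.sum_comm]
    refine Finset.sum_congr rfl fun i _ => ?_
    rw [← dotProduct_sub, dotProduct, Finset.sum_mul]
    refine Finset.sum_congr rfl fun j _ => ?_
    simp only [Pi.sub_apply]; ring
  have hlin : |(u.1.1 - θ₀) * ∑ i, crossTheta θ₀ (z i ⬝ᵥ β₀) (e i) (x i) (y i)
      + ∑ i, (z i ⬝ᵥ u.1.2 - z i ⬝ᵥ β₀) * crossPred θ₀ (z i ⬝ᵥ β₀) (e i) (x i) (y i)|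
      ≤ ρ * T := by
    rw [hpred]
    refine (abs_add_le _ _).trans ?_
    have h1 : |(u.1.1 - θ₀) * ∑ i, crossTheta θ₀ (z i ⬝ᵥ β₀) (e i) (x i) (y i)|
        ≤ |u.1.1 - θ₀| * T := by rw [abs_mul]; gcongr
    have h2 : |∑ j, (u.1.2 j - β₀ j) *
        ∑ i, crossPred θ₀ (z i ⬝ᵥ β₀) (e i) (x i) (y i) * z i j|
        ≤ (∑ j, |u.1.2 j - β₀ j|) * T := by
      rw [Finset.sum_mul]
      refine (Finset.abs_sum_le_sum_abs _ _).trans (Finset.sum_le_sum fun j _ => ?_)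
      rw [abs_mul]
      exact mul_le_mul_of_nonneg_left (hT j) (abs_nonneg _)
    calc _ ≤ l1Dist u.1 (θ₀, β₀) * T := by rw [l1Dist, add_mul]; exact add_le_add h1 h2
      _ ≤ _ := by gcongr
  rw [abs_le] at hsum hlin hB ⊢
  constructor <;> linarith [hsum.1, hsum.2, hlin.1, hlin.2, hB.1, hB.2]

lemma info_close (he : ∀ i, e i ∈ Set.Ioo (0 : ℝ) 1) (hx : ∀ i, x i ∈ Set.Icc (0 : ℝ) 1)
    (hθ : |u.1.1 - θ₀| ≤ r) (hk : ∀ i, |z i ⬝ᵥ u.1.2 - z i ⬝ᵥ β₀| ≤ r)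
    (hb : ∀ i, |logit (Real.sigmoid (z i ⬝ᵥ u.2)) - logit (e i)| ≤ r) :
    |(∑ i, (x i - projEst z u i) ^ 2 *
        bernoulliVar (θ₀ * (x i - projEst z u i) + phiEst z u i))
      - ∑ i, infoTerm θ₀ (z i ⬝ᵥ β₀) (e i) (x i)| ≤ n * (10 * r) := by
  rw [← Finset.sum_sub_distrib]
  refine (Finset.abs_sum_le_sum_abs _ _).trans ?_
  have : ∀ i ∈ Finset.univ, |(x i - projEst z u i) ^ 2 *
        bernoulliVar (θ₀ * (x i - projEst z u i) + phiEst z u i)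
      - infoTerm θ₀ (z i ⬝ᵥ β₀) (e i) (x i)| ≤ 10 * r := fun i _ =>
    info_perturbation (he i) ⟨Real.sigmoid_pos _, Real.sigmoid_lt_one _⟩ (hx i) hθ (hk i) (hb i)
  refine (Finset.sum_le_sum this).trans (le_of_eq ?_)
  simp

lemma abs_sub_projEst_le (hx : ∀ i, x i ∈ Set.Icc (0 : ℝ) 1) (i : Fin n) :
    |x i - projEst z u i| ≤ 1 :=
  abs_sub_varProj_le ⟨Real.sigmoid_pos _, Real.sigmoid_lt_one _⟩ (hx i)

lemma abs_dotProduct_sub_le {C : ℝ} (hC : 0 ≤ C) (hz : ∀ i j, |z i j| ≤ C) (i : Fin n) :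
    |z i ⬝ᵥ u.1.2 - z i ⬝ᵥ β₀| ≤ C * l1Dist u.1 (θ₀, β₀) := by
  rw [← dotProduct_sub, dotProduct]
  refine (Finset.abs_sum_le_sum_abs _ _).trans ?_
  have : ∑ j, |z i j * (u.1.2 - β₀) j| ≤ C * ∑ j, |u.1.2 j - β₀ j| := by
    rw [Finset.mul_sum]
    refine Finset.sum_le_sum fun j _ => ?_
    rw [abs_mul]
    exact mul_le_mul_of_nonneg_right (hz i j) (abs_nonneg _)
  refine this.trans (mul_le_mul_of_nonneg_left ?_ hC)
  rw [l1Dist]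
  exact le_add_of_nonneg_left (abs_nonneg _)

lemma abs_fst_sub_le_l1Dist : |u.1.1 - θ₀| ≤ l1Dist u.1 (θ₀, β₀) := by
  rw [l1Dist]
  exact le_add_of_nonneg_right (Finset.sum_nonneg fun _ _ => abs_nonneg _)

end Deterministic

/-- On the exceptional set the integrand is off by at most `1`. That set need not be measurable, so
its measurable hull takes its place. The lemma serves for averages over posterior draws and, at the
end, for the average over the sample. -/
lemma abs_integral_sub_le {α : Type*} [MeasurableSpace α] {μ : Measure α} [IsProbabilityMeasure μ]
    {f : α → ℝ} (hf : Measurable f) (hf01 : ∀ a, f a ∈ Set.Icc (0 : ℝ) 1) {v ε η : ℝ}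
    (hv : v ∈ Set.Icc (0 : ℝ) 1) (hε : 0 ≤ ε) {N : Set α} (hN : ∀ a, a ∉ N → |f a - v| ≤ ε)
    (hη : μ.real N ≤ η) : |∫ a, f a ∂μ - v| ≤ ε + η := by
  have hfi : Integrable f μ := Integrable.of_bound hf.aestronglyMeasurable 1
    (Eventually.of_forall fun a => by
      rw [Real.norm_of_nonneg (hf01 a).1]; exact (hf01 a).2)
  have hM := measurableSet_toMeasurable μ N
  have e : ∫ a, f a ∂μ - v = ∫ a, (f a - v) ∂μ := by
    rw [integral_sub hfi (integrable_const v)]; simp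
  have hi2 : Integrable (fun a => ε + (toMeasurable μ N).indicator (fun _ => (1 : ℝ)) a) μ :=
    (integrable_const ε).add ((integrable_const 1).indicator hM)
  rw [e]
  calc |∫ a, (f a - v) ∂μ| ≤ ∫ a, |f a - v| ∂μ := abs_integral_le_integral_abs
    _ ≤ ∫ a, (ε + (toMeasurable μ N).indicator (fun _ => (1 : ℝ)) a) ∂μ := by
        refine integral_mono ((hfi.sub (integrable_const v)).abs) hi2 fun a => ?_
        by_cases ha : a ∈ toMeasurable μ N
        · simp only [Set.indicator_of_mem ha]
          have : |f a - v| ≤ 1 := by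
            rw [abs_le]; constructor <;> linarith [(hf01 a).1, (hf01 a).2, hv.1, hv.2]
          linarith
        · simp only [Set.indicator_of_notMem ha, add_zero]
          exact hN a fun h => ha (subset_toMeasurable μ N h)
    _ = ε + μ.real N := by
        rw [integral_add (integrable_const ε) ((integrable_const 1).indicator hM),
          integral_indicator hM, setIntegral_const, smul_eq_mul, mul_one, measureReal_def,
          measure_toMeasurable]
        simp [measureReal_def]
    _ ≤ ε + η := by linarith

lemma stdCdf_mem (t : ℝ) : stdCdf t ∈ Set.Icc (0 : ℝ) 1 := ⟨measureReal_nonneg, measureReal_le_one⟩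

/-- The posterior probability of `(-∞, θ₀]` is close to its normal approximation as soon as the
posterior of the nuisance parameters concentrates. -/
lemma marginalPosterior_close {π : ℝ → ℝ} (hπ : IsProbDensity π) {n d : ℕ}
    (priorβ priorγ : Measure (Fin d → ℝ)) [IsProbabilityMeasure priorβ]
    [IsProbabilityMeasure priorγ] {y x : Fin n → ℝ} (hy : ∀ i, y i ∈ Set.Icc (0 : ℝ) 1)
    (hx : ∀ i, x i ∈ Set.Icc (0 : ℝ) 1) (z : Fin n → Fin d → ℝ) {θ₀ v ε η₁ η₂ : ℝ}
    (hv : v ∈ Set.Icc (0 : ℝ) 1) (hε : 0 ≤ ε) {N₁ : Set (ℝ × (Fin d → ℝ))} {N₂ : Set (Fin d → ℝ)}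
    (h₁ : (outcomePosterior π priorβ y x z).real N₁ ≤ η₁)
    (h₂ : (propensityPosterior priorγ x z).real N₂ ≤ η₂)
    (h : ∀ u : Draw d, u.1 ∉ N₁ → u.2 ∉ N₂ → |condCdf π y x z θ₀ u - v| ≤ ε) :
    |(marginalPosterior π priorβ priorγ y x z).real (Set.Iic θ₀) - v| ≤ ε + (η₁ + η₂) := by
  have i1 := isProbabilityMeasure_outcomePosterior hπ priorβ hy x z
  have i2 := isProbabilityMeasure_propensityPosterior priorγ hx z
  rw [marginalPosterior_real_Iic _ _ hπ hy]
  have i3 : IsProbabilityMeasure (drawPosterior π priorβ priorγ y x z) := by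
    unfold drawPosterior; infer_instance
  refine abs_integral_sub_le (measurable_condCdf hπ y x z θ₀)
    (condCdf_mem hπ hy x z θ₀) hv hε (N := N₁ ×ˢ Set.univ ∪ Set.univ ×ˢ N₂) (fun u hu => ?_) ?_
  · simp only [Set.mem_union, Set.mem_prod, Set.mem_univ, and_true, true_and, not_or] at hu
    exact h u hu.1 hu.2
  · refine (measureReal_union_le _ _).trans (add_le_add ?_ ?_)
    · unfold drawPosterior
      rwa [measureReal_prod_prod, probReal_univ, mul_one]
    · unfold drawPosterior
      rwa [measureReal_prod_prod, probReal_univ, one_mul]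

/-! ### Tail bounds for the sums in the expansion of the efficient score -/

section Measurability

variable {E : Type*} [MeasurableSpace E] {l e x y : E → ℝ} (θ : ℝ)

lemma Measurable.varProj_comp (hl : Measurable l) (he : Measurable e) :
    Measurable fun w => varProj θ (l w) (e w) :=
  measurable_varProj.comp (g := fun v : ℝ × ℝ × ℝ => varProj v.1 v.2.1 v.2.2)
    (f := fun w => (θ, l w, e w)) (measurable_const.prodMk (hl.prodMk he))

lemma Measurable.sigmoid_comp (hl : Measurable l) : Measurable fun w => Real.sigmoid (l w) :=
  measurable_sigmoid_real.comp hl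

lemma Measurable.bernoulliVar_comp (hl : Measurable l) : Measurable fun w => bernoulliVar (l w) :=
  continuous_bernoulliVar.measurable.comp hl

lemma Measurable.thetaWeight (hl : Measurable l) (he : Measurable e) :
    Measurable fun w => varProj θ (l w) (e w) * (1 - varProj θ (l w) (e w)) *
      (1 - 2 * Real.sigmoid (θ + l w)) :=
  have h := Measurable.varProj_comp θ hl he
  (h.mul (h.const_sub 1)).mul (((Measurable.sigmoid_comp (hl.const_add θ)).const_mul 2).const_sub 1)

lemma Measurable.predWeight (hl : Measurable l) (he : Measurable e) :
    Measurable fun w => varProj θ (l w) (e w) * (1 - varProj θ (l w) (e w)) *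
      (2 * Real.sigmoid (l w) - 2 * Real.sigmoid (θ + l w)) :=
  have h := Measurable.varProj_comp θ hl he
  (h.mul (h.const_sub 1)).mul (((Measurable.sigmoid_comp hl).const_mul 2).sub
    ((Measurable.sigmoid_comp (hl.const_add θ)).const_mul 2))

lemma Measurable.resp_sub (hl : Measurable l) (hx : Measurable x) (hy : Measurable y) :
    Measurable fun w => y w - Real.sigmoid (x w * θ + l w) :=
  hy.sub (Measurable.sigmoid_comp ((hx.mul_const θ).add hl))

lemma Measurable.residual (hl : Measurable l) (he : Measurable e) (hx : Measurable x) :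
    Measurable fun w => (x w - varProj θ (l w) (e w)) * bernoulliVar (x w * θ + l w) :=
  (hx.sub (Measurable.varProj_comp θ hl he)).mul
    (Measurable.bernoulliVar_comp ((hx.mul_const θ).add hl))

lemma Measurable.crossTheta (hl : Measurable l) (he : Measurable e) (hx : Measurable x)
    (hy : Measurable y) : Measurable fun w => crossTheta θ (l w) (e w) (x w) (y w) :=
  ((Measurable.resp_sub θ hl hx hy).mul (Measurable.thetaWeight θ hl he)).add
    ((Measurable.residual θ hl he hx).mul (Measurable.varProj_comp θ hl he))

lemma Measurable.crossPred (hl : Measurable l) (he : Measurable e) (hx : Measurable x)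
    (hy : Measurable y) : Measurable fun w => crossPred θ (l w) (e w) (x w) (y w) :=
  ((Measurable.resp_sub θ hl hx hy).mul (Measurable.predWeight θ hl he)).add
    (Measurable.residual θ hl he hx)

lemma Measurable.crossOdds (hl : Measurable l) (he : Measurable e) (hx : Measurable x)
    (hy : Measurable y) : Measurable fun w => crossOdds θ (l w) (e w) (x w) (y w) :=
  have h := Measurable.varProj_comp θ hl he
  (Measurable.resp_sub θ hl hx hy).mul (h.mul (h.const_sub 1))

lemma Measurable.scoreTerm (hl : Measurable l) (he : Measurable e) (hx : Measurable x)
    (hy : Measurable y) : Measurable fun w => scoreTerm θ (l w) (e w) (x w) (y w) :=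
  (hx.sub (Measurable.varProj_comp θ hl he)).mul (Measurable.resp_sub θ hl hx hy)

lemma Measurable.infoTerm (hl : Measurable l) (he : Measurable e) (hx : Measurable x) :
    Measurable fun w => infoTerm θ (l w) (e w) (x w) :=
  ((hx.sub (Measurable.varProj_comp θ hl he)).pow_const 2).mul
    (Measurable.bernoulliVar_comp ((hx.mul_const θ).add hl))

end Measurability

section Sample

variable {Ω : Type*} [MeasurableSpace Ω] {P : Measure Ω}
  {n d : ℕ} {Y X : Fin n → Ω → ℝ} {Z : Fin n → Ω → Fin d → ℝ} {θ₀ : ℝ} {β₀ : Fin d → ℝ}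
  {e : Fin n → (Fin d → ℝ) → ℝ}

lemma IsPropensityVersion.fisherInfo_eq (he : IsPropensityVersion P X Z e) (i : Fin n) :
    fisherInfo P (X i) (Z i) θ₀ β₀
      = ∫ ω, infoTerm θ₀ (Z i ω ⬝ᵥ β₀) (e i (Z i ω)) (X i ω) ∂P := by
  refine integral_congr_ae ?_
  filter_upwards [he.ae_eq i] with ω hω
  rw [oracleProj, hω, infoTerm, mul_comm]

variable [IsProbabilityMeasure P]

lemma IsLogisticSample.tail (hs : IsLogisticSample P Y X Z θ₀ β₀)
    {f : Fin n → ℝ × ℝ × (Fin d → ℝ) → ℝ} (hf : ∀ i, Measurable (f i)) {B : ℝ}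
    (hB : ∀ i, ∀ᵐ ω ∂P, |f i (Y i ω, X i ω, Z i ω)| ≤ B)
    (h0 : ∀ i, ∫ ω, f i (Y i ω, X i ω, Z i ω) ∂P = 0) {t : ℝ} (ht : 0 ≤ t) :
    P.real {ω | t ≤ |∑ i, f i (Y i ω, X i ω, Z i ω)|}
      ≤ 2 * Real.exp (-t ^ 2 / (2 * (n * B ^ 2))) :=
  measureReal_abs_sum_ge_le (ξ := fun i ω => f i (Y i ω, X i ω, Z i ω)) (hs.indep.comp f hf)
    (fun i => (hf i).comp ((hs.measurable_Y i).prodMk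
      ((hs.measurable_X i).prodMk (hs.measurable_Z i)))) hB h0 ht

lemma measurable_fst_snd_snd_dot (β₀ : Fin d → ℝ) :
    Measurable fun v : ℝ × ℝ × (Fin d → ℝ) => v.2.2 ⬝ᵥ β₀ :=
  (measurable_dotProduct_const β₀).comp (measurable_snd.comp measurable_snd)

lemma measurable_snd_dot (β₀ : Fin d → ℝ) :
    Measurable fun v : ℝ × (Fin d → ℝ) => v.2 ⬝ᵥ β₀ :=
  (measurable_dotProduct_const β₀).comp measurable_snd

lemma integral_add_eq_zero {f g : Ω → ℝ} (hf : Measurable f) (hg : Measurable g) {B : ℝ}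
    (hfB : ∀ᵐ ω ∂P, |f ω| ≤ B) (hgB : ∀ᵐ ω ∂P, |g ω| ≤ B) (hf0 : ∫ ω, f ω ∂P = 0)
    (hg0 : ∫ ω, g ω ∂P = 0) : ∫ ω, (f ω + g ω) ∂P = 0 := by
  rw [integral_add (Integrable.of_bound hf.aestronglyMeasurable B hfB)
    (Integrable.of_bound hg.aestronglyMeasurable B hgB), hf0, hg0, add_zero]

/-- The coefficient is centred for two separate reasons: its first summand is an outcome residual
times a function of `Z_i`, its second is the orthogonal residual times a function of `Z_i`.
Multiplying by a bounded coordinate of `Z_i` preserves both, which gives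
`IsLogisticSample.tail_crossPred`. -/
lemma IsLogisticSample.tail_crossTheta (hs : IsLogisticSample P Y X Z θ₀ β₀)
    (he : IsPropensityVersion P X Z e) {t : ℝ} (ht : 0 ≤ t) :
    P.real {ω | t ≤ |∑ i, crossTheta θ₀ (Z i ω ⬝ᵥ β₀) (e i (Z i ω)) (X i ω) (Y i ω)|}
      ≤ 2 * Real.exp (-t ^ 2 / (2 * (n * 3 ^ 2))) := by
  have hZ := fun i => hs.measurable_Z i
  have hl := fun i => (measurable_dotProduct_const β₀).comp (hZ i)
  have hez := fun i => (he.measurable i).comp (hZ i)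
  refine hs.tail (f := fun i v => crossTheta θ₀ (v.2.2 ⬝ᵥ β₀) (e i v.2.2) v.2.1 v.1)
    (fun i => Measurable.crossTheta θ₀ (measurable_fst_snd_snd_dot β₀)
      ((he.measurable i).comp (measurable_snd.comp measurable_snd))
      (measurable_fst.comp measurable_snd) measurable_fst)
    (fun i => Eventually.of_forall fun ω =>
      abs_crossTheta_le (he.mem i _) (hs.mem_Icc_X i ω) (hs.mem_Icc_Y i ω))
    (fun i => ?_) ht
  refine integral_add_eq_zero (B := 1)
    ((Measurable.resp_sub θ₀ (hl i) (hs.measurable_X i) (hs.measurable_Y i)).mul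
      (Measurable.thetaWeight θ₀ (hl i) (hez i)))
    ((Measurable.residual θ₀ (hl i) (hez i) (hs.measurable_X i)).mul
      (Measurable.varProj_comp θ₀ (hl i) (hez i)))
    (Eventually.of_forall fun ω => ?_) (Eventually.of_forall fun ω => ?_) ?_ ?_
  · rw [abs_mul]
    exact mul_le_one₀ (abs_resp_sub_le _ (hs.mem_Icc_Y i ω)) (abs_nonneg _)
      (abs_thetaWeight_le (he.mem i _))
  · obtain ⟨h0, h1⟩ := varProj_mem_Ioo θ₀ (Z i ω ⬝ᵥ β₀) (he.mem i (Z i ω))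
    rw [abs_mul]
    exact mul_le_one₀ (abs_sub_varProj_mul_le (he.mem i _) (hs.mem_Icc_X i ω)) (abs_nonneg _)
      (by change |varProj _ _ _| ≤ 1; rw [abs_of_pos h0]; exact h1.le)
  · exact hs.integral_outcome_sub_mul i
      (g := fun v => varProj θ₀ (v.2 ⬝ᵥ β₀) (e i v.2) * (1 - varProj θ₀ (v.2 ⬝ᵥ β₀) (e i v.2)) *
        (1 - 2 * Real.sigmoid (θ₀ + v.2 ⬝ᵥ β₀)))
      (Measurable.thetaWeight θ₀ (measurable_snd_dot β₀) ((he.measurable i).comp measurable_snd))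
      (Eventually.of_forall fun ω => abs_thetaWeight_le (he.mem i _))
  · exact hs.integral_residual_mul he i
      (g := fun z => varProj θ₀ (z ⬝ᵥ β₀) (e i z))
      (Measurable.varProj_comp θ₀ (measurable_dotProduct_const β₀) (he.measurable i)) (B := 1)
      (Eventually.of_forall fun ω => by
        obtain ⟨h0, h1⟩ := varProj_mem_Ioo θ₀ (Z i ω ⬝ᵥ β₀) (he.mem i (Z i ω))
        rw [abs_of_pos h0]; exact h1.le)

lemma IsLogisticSample.tail_crossPred (hs : IsLogisticSample P Y X Z θ₀ β₀)
    (he : IsPropensityVersion P X Z e) {C : ℝ} (hC : 0 ≤ C) (j : Fin d)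
    (hZC : ∀ i, ∀ᵐ ω ∂P, |Z i ω j| ≤ C) {t : ℝ} (ht : 0 ≤ t) :
    P.real {ω | t ≤ |∑ i, crossPred θ₀ (Z i ω ⬝ᵥ β₀) (e i (Z i ω)) (X i ω) (Y i ω) * Z i ω j|}
      ≤ 2 * Real.exp (-t ^ 2 / (2 * (n * (3 * C) ^ 2))) := by
  have hZ := fun i => hs.measurable_Z i
  have hl := fun i => (measurable_dotProduct_const β₀).comp (hZ i)
  have hez := fun i => (he.measurable i).comp (hZ i)
  have hZj := fun i => (measurable_pi_apply j).comp (hZ i)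
  refine hs.tail (f := fun i v => crossPred θ₀ (v.2.2 ⬝ᵥ β₀) (e i v.2.2) v.2.1 v.1 * v.2.2 j)
    (fun i => (Measurable.crossPred θ₀ (measurable_fst_snd_snd_dot β₀)
      ((he.measurable i).comp (measurable_snd.comp measurable_snd))
      (measurable_fst.comp measurable_snd) measurable_fst).mul
        ((measurable_pi_apply j).comp (measurable_snd.comp measurable_snd)))
    (fun i => (hZC i).mono fun ω hω => ?_)
    (fun i => ?_) ht
  · rw [abs_mul]
    exact mul_le_mul (abs_crossPred_le (he.mem i _) (hs.mem_Icc_X i ω) (hs.mem_Icc_Y i ω)) hω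
      (abs_nonneg _) (by norm_num)
  simp only [crossPred]
  simp_rw [add_mul, mul_assoc ((_ : ℝ) - Real.sigmoid _)]
  refine integral_add_eq_zero (B := 2 * C)
    ((Measurable.resp_sub θ₀ (hl i) (hs.measurable_X i) (hs.measurable_Y i)).mul
      ((Measurable.predWeight θ₀ (hl i) (hez i)).mul (hZj i)))
    ((Measurable.residual θ₀ (hl i) (hez i) (hs.measurable_X i)).mul (hZj i))
    ((hZC i).mono fun ω hω => ?_) ((hZC i).mono fun ω hω => ?_) ?_ ?_
  · rw [abs_mul, abs_mul]
    refine (mul_le_of_le_one_left (by positivity) (abs_resp_sub_le _ (hs.mem_Icc_Y i ω))).trans ?_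
    exact mul_le_mul (abs_predWeight_le (he.mem i _)) hω (abs_nonneg _) zero_le_two
  · rw [abs_mul]
    refine (mul_le_of_le_one_left (abs_nonneg _)
      (abs_sub_varProj_mul_le (he.mem i _) (hs.mem_Icc_X i ω))).trans ?_
    exact hω.trans (by linarith)
  · exact hs.integral_outcome_sub_mul i
      (g := fun v => varProj θ₀ (v.2 ⬝ᵥ β₀) (e i v.2) * (1 - varProj θ₀ (v.2 ⬝ᵥ β₀) (e i v.2)) *
        (2 * Real.sigmoid (v.2 ⬝ᵥ β₀) - 2 * Real.sigmoid (θ₀ + v.2 ⬝ᵥ β₀)) * v.2 j)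
      ((Measurable.predWeight θ₀ (measurable_snd_dot β₀)
        ((he.measurable i).comp measurable_snd)).mul ((measurable_pi_apply j).comp measurable_snd))
      (B := 2 * C) ((hZC i).mono fun ω hω => by
        rw [abs_mul]
        exact mul_le_mul (abs_predWeight_le (he.mem i _)) hω (abs_nonneg _) zero_le_two)
  · exact hs.integral_residual_mul he i (g := fun z => z j) (measurable_pi_apply j) (hZC i)

lemma IsLogisticSample.tail_score (hs : IsLogisticSample P Y X Z θ₀ β₀)
    (he : IsPropensityVersion P X Z e) {t : ℝ} (ht : 0 ≤ t) :
    P.real {ω | t ≤ |∑ i, scoreTerm θ₀ (Z i ω ⬝ᵥ β₀) (e i (Z i ω)) (X i ω) (Y i ω)|}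
      ≤ 2 * Real.exp (-t ^ 2 / (2 * (n * 1 ^ 2))) := by
  refine hs.tail (f := fun i v => scoreTerm θ₀ (v.2.2 ⬝ᵥ β₀) (e i v.2.2) v.2.1 v.1)
    (fun i => Measurable.scoreTerm θ₀ (measurable_fst_snd_snd_dot β₀)
      ((he.measurable i).comp (measurable_snd.comp measurable_snd))
      (measurable_fst.comp measurable_snd) measurable_fst)
    (fun i => Eventually.of_forall fun ω =>
      abs_scoreTerm_le (he.mem i _) (hs.mem_Icc_X i ω) (hs.mem_Icc_Y i ω))
    (fun i => ?_) ht
  simp only [scoreTerm]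
  simp_rw [mul_comm ((_ : ℝ) - varProj _ _ _)]
  exact hs.integral_outcome_sub_mul i (g := fun v => v.1 - varProj θ₀ (v.2 ⬝ᵥ β₀) (e i v.2))
    (measurable_fst.sub (Measurable.varProj_comp θ₀ (measurable_snd_dot β₀)
      ((he.measurable i).comp measurable_snd))) (B := 1)
    (Eventually.of_forall fun ω => abs_sub_varProj_le (he.mem i _) (hs.mem_Icc_X i ω))

lemma IsLogisticSample.tail_info (hs : IsLogisticSample P Y X Z θ₀ β₀)
    (he : IsPropensityVersion P X Z e) {t : ℝ} (ht : 0 ≤ t) :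
    P.real {ω | t ≤ |∑ i, infoTerm θ₀ (Z i ω ⬝ᵥ β₀) (e i (Z i ω)) (X i ω)
        - ∑ i, fisherInfo P (X i) (Z i) θ₀ β₀|}
      ≤ 2 * Real.exp (-t ^ 2 / (2 * (n * 1 ^ 2))) := by
  have hmem := fun i ω => infoTerm_mem (θ := θ₀) (l := Z i ω ⬝ᵥ β₀) (he.mem i (Z i ω))
    (hs.mem_Icc_X i ω)
  have hint : ∀ i, Integrable (fun ω => infoTerm θ₀ (Z i ω ⬝ᵥ β₀) (e i (Z i ω)) (X i ω)) P :=
    fun i => Integrable.of_bound (Measurable.infoTerm θ₀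
      ((measurable_dotProduct_const β₀).comp (hs.measurable_Z i))
      ((he.measurable i).comp (hs.measurable_Z i)) (hs.measurable_X i)).aestronglyMeasurable 1
      (Eventually.of_forall fun ω => by
        rw [Real.norm_of_nonneg (hmem i ω).1]; exact (hmem i ω).2)
  have hmean : ∀ i, fisherInfo P (X i) (Z i) θ₀ β₀ ∈ Set.Icc (0 : ℝ) 1 := fun i => by
    rw [he.fisherInfo_eq i]
    refine ⟨integral_nonneg fun ω => (hmem i ω).1, ?_⟩
    refine (integral_mono (hint i) (integrable_const 1) fun ω => (hmem i ω).2).trans ?_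
    simp
  simp_rw [← Finset.sum_sub_distrib]
  refine hs.tail (f := fun i v => infoTerm θ₀ (v.2.2 ⬝ᵥ β₀) (e i v.2.2) v.2.1
      - fisherInfo P (X i) (Z i) θ₀ β₀)
    (fun i => (Measurable.infoTerm θ₀ (measurable_fst_snd_snd_dot β₀)
      ((he.measurable i).comp (measurable_snd.comp measurable_snd))
      (measurable_fst.comp measurable_snd)).sub_const _)
    (fun i => Eventually.of_forall fun ω => ?_) (fun i => ?_) ht
  · rw [abs_le]; constructor <;> linarith [(hmem i ω).1, (hmem i ω).2, (hmean i).1, (hmean i).2]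
  · rw [integral_sub (hint i) (integrable_const _), he.fisherInfo_eq i]
    simp

/-! ### The contribution of the propensity scores to the score -/

/-- The sum of the first-order contributions of the propensity log-odds to the score. -/
noncomputable def oddsScore (θ₀ : ℝ) (β₀ : Fin d → ℝ) (e : Fin n → (Fin d → ℝ) → ℝ)
    (y : Fin n → ℝ) (w : Cov n d) (γ : Fin d → ℝ) : ℝ :=
  ∑ i, (logit (Real.sigmoid (w.2 i ⬝ᵥ γ)) - logit (e i (w.2 i))) *
    crossOdds θ₀ (w.2 i ⬝ᵥ β₀) (e i (w.2 i)) (w.1 i) (y i)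

/-- Propensity parameters with log-odds close to the true ones but a large contribution to the
score. -/
def oddsBad (θ₀ : ℝ) (β₀ : Fin d → ℝ) (e : Fin n → (Fin d → ℝ) → ℝ) (r τ : ℝ)
    (y : Fin n → ℝ) (w : Cov n d) : Set (Fin d → ℝ) :=
  {γ | (∀ i, |logit (Real.sigmoid (w.2 i ⬝ᵥ γ)) - logit (e i (w.2 i))| ≤ r) ∧
    τ ≤ |oddsScore θ₀ β₀ e y w γ|}

lemma measurable_logitDiff (he : ∀ i, Measurable (e i)) (i : Fin n) :
    Measurable fun p : Cov n d × (Fin d → ℝ) =>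
      logit (Real.sigmoid (p.1.2 i ⬝ᵥ p.2)) - logit (e i (p.1.2 i)) := by
  have h1 : Measurable fun p : Cov n d × (Fin d → ℝ) => Real.sigmoid (p.1.2 i ⬝ᵥ p.2) :=
    measurable_sigmoid_real.comp (by unfold dotProduct; fun_prop)
  have h2 : Measurable fun p : Cov n d × (Fin d → ℝ) => e i (p.1.2 i) :=
    (he i).comp (by fun_prop)
  exact (Real.measurable_log.comp (h1.div (h1.const_sub 1))).sub
    (Real.measurable_log.comp (h2.div (h2.const_sub 1)))

lemma measurableSet_oddsBad (he : ∀ i, Measurable (e i)) (r τ : ℝ) (y : Fin n → ℝ) :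
    MeasurableSet {p : Cov n d × (Fin d → ℝ) | p.2 ∈ oddsBad θ₀ β₀ e r τ y p.1} := by
  have h1 := measurable_logitDiff (n := n) (d := d) he
  have h2 : Measurable fun p : Cov n d × (Fin d → ℝ) => oddsScore θ₀ β₀ e y p.1 p.2 := by
    refine Finset.measurable_sum _ fun i _ => (h1 i).mul ?_
    exact Measurable.crossOdds θ₀ ((measurable_dotProduct_const β₀).comp (by fun_prop))
      ((he i).comp (by fun_prop)) (by fun_prop) measurable_const
  have e1 : {p : Cov n d × (Fin d → ℝ) | p.2 ∈ oddsBad θ₀ β₀ e r τ y p.1}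
      = (⋂ i, {p | |logit (Real.sigmoid (p.1.2 i ⬝ᵥ p.2)) - logit (e i (p.1.2 i))| ≤ r}) ∩
        {p | τ ≤ |oddsScore θ₀ β₀ e y p.1 p.2|} := by
    ext p; simp [oddsBad]
  rw [e1]
  exact (MeasurableSet.iInter fun i => measurableSet_le (continuous_abs.measurable.comp (h1 i))
    measurable_const).inter (measurableSet_le measurable_const (continuous_abs.measurable.comp h2))

/-- With covariates and `γ` fixed, the odds score is a weighted sum of independent centred
responses, and Hoeffding's inequality applies. The closeness clause of `oddsBad` bounds the weights
by `r`; when it fails the event is empty. -/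
lemma outcomeLaw_oddsBad_le (he : ∀ i z, e i z ∈ Set.Ioo (0 : ℝ) 1) {r τ : ℝ} 
    (hτ : 0 ≤ τ) (w : Cov n d) (γ : Fin d → ℝ) :
    (outcomeLaw (logOdds θ₀ β₀ w)).real
        {b | γ ∈ oddsBad θ₀ β₀ e r τ (fun i => bval (b i)) w}
      ≤ 2 * Real.exp (-τ ^ 2 / (2 * (n * r ^ 2))) := by
  by_cases hγ : ∀ i, |logit (Real.sigmoid (w.2 i ⬝ᵥ γ)) - logit (e i (w.2 i))| ≤ r
  · set c : Fin n → ℝ := fun i => (logit (Real.sigmoid (w.2 i ⬝ᵥ γ)) - logit (e i (w.2 i))) *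
      (varProj θ₀ (w.2 i ⬝ᵥ β₀) (e i (w.2 i)) * (1 - varProj θ₀ (w.2 i ⬝ᵥ β₀) (e i (w.2 i))))
    have hc : ∀ i, |c i| ≤ r := fun i => by
      obtain ⟨h0, h1⟩ := varProj_mul_one_sub_mem (θ := θ₀) (l := w.2 i ⬝ᵥ β₀) (he i (w.2 i))
      rw [abs_mul, abs_of_nonneg h0]
      exact (mul_le_of_le_one_right (abs_nonneg _) h1).trans (hγ i)
    have h := measureReal_abs_sum_ge_le (P := outcomeLaw (logOdds θ₀ β₀ w))
      (ξ := fun i b => c i * (bval (b i) - Real.sigmoid (logOdds θ₀ β₀ w i)))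
      (iIndepFun_pi (μ := fun i => bernLaw (logOdds θ₀ β₀ w i))
        (X := fun i b => c i * (bval b - Real.sigmoid (logOdds θ₀ β₀ w i)))
        fun i => (measurable_of_finite _).aemeasurable)
      (fun i => measurable_of_finite _) (B := r)
      (fun i => Eventually.of_forall fun b => by
        rw [abs_mul]
        refine (mul_le_of_le_one_right (abs_nonneg _) (abs_resp_sub_le _ ?_)).trans (hc i)
        unfold bval; split_ifs <;> simp)
      (fun i => by
        rw [integral_const_mul, outcomeLaw]
        rw [integral_comp_eval (μ := fun i => bernLaw (logOdds θ₀ β₀ w i)) (i := i)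
          (f := fun b => bval b - Real.sigmoid (logOdds θ₀ β₀ w i))
          (measurable_of_finite _).aestronglyMeasurable, integral_bernLaw]
        simp [bval]; right; ring) hτ
    refine (measureReal_mono fun b hb => ?_).trans h
    refine hb.2.trans (le_of_eq (congrArg _ ?_))
    refine Finset.sum_congr rfl fun i _ => ?_
    simp only [crossOdds, c, logOdds]
    ring
  · have : {b : Fin n → Bool | γ ∈ oddsBad θ₀ β₀ e r τ (fun i => bval (b i)) w} = ∅ := by
      ext b; simp only [Set.mem_ofPred_eq, Set.mem_empty_iff_false, iff_false]
      exact fun h => hγ h.1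
    rw [this, measureReal_empty]
    positivity

/-- The posterior of `γ` depends on the covariates but not on the responses, so the two integrals
can be exchanged and the bound for fixed `γ` integrated. No union bound over `γ` is needed. -/
lemma lintegral_oddsBad_le (hem : ∀ i, Measurable (e i))
    (he : ∀ i z, e i z ∈ Set.Ioo (0 : ℝ) 1) (priorγ : Measure (Fin d → ℝ))
    [IsProbabilityMeasure priorγ] {r τ : ℝ} (hτ : 0 ≤ τ) (w : Cov n d) :
    ∫⁻ b, propensityPosterior priorγ w.1 w.2 (oddsBad θ₀ β₀ e r τ (fun i => bval (b i)) w)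
        ∂outcomeLaw (logOdds θ₀ β₀ w)
      ≤ ENNReal.ofReal (2 * Real.exp (-τ ^ 2 / (2 * (n * r ^ 2)))) := by
  set κ := propensityPosterior priorγ w.1 w.2 with hκ
  have hsec : ∀ b : Fin n → Bool,
      MeasurableSet (oddsBad θ₀ β₀ e r τ (fun i => bval (b i)) w) := fun b =>
    measurable_prodMk_left
      (measurableSet_oddsBad (θ₀ := θ₀) (β₀ := β₀) hem r τ (fun i => bval (b i)))
  have e1 : ∫⁻ b, κ (oddsBad θ₀ β₀ e r τ (fun i => bval (b i)) w) ∂outcomeLaw (logOdds θ₀ β₀ w)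
      = ∫⁻ γ, outcomeLaw (logOdds θ₀ β₀ w)
        {b | γ ∈ oddsBad θ₀ β₀ e r τ (fun i => bval (b i)) w} ∂κ := by
    have e2 : ∀ γ, outcomeLaw (logOdds θ₀ β₀ w)
        {b | γ ∈ oddsBad θ₀ β₀ e r τ (fun i => bval (b i)) w}
        = ∑ b, (oddsBad θ₀ β₀ e r τ (fun i => bval (b i)) w).indicator 1 γ
          * outcomeLaw (logOdds θ₀ β₀ w) {b} := fun γ => by
      rw [← lintegral_indicator_one (Set.toFinite _).measurableSet, lintegral_fintype]
      rfl
    simp_rw [e2]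
    rw [lintegral_fintype, lintegral_finsetSum' _ fun b _ =>
      ((measurable_one.indicator (hsec b)).mul_const _).aemeasurable]
    refine Finset.sum_congr rfl fun b _ => ?_
    rw [lintegral_mul_const _ (measurable_one.indicator (hsec b)),
      lintegral_indicator_one (hsec b)]
  have hκ1 : κ Set.univ ≤ 1 := by
    rw [hκ, propensityPosterior]; exact prob_le_one
  rw [e1]
  calc _ ≤ ∫⁻ _, ENNReal.ofReal (2 * Real.exp (-τ ^ 2 / (2 * (n * r ^ 2)))) ∂κ :=
        lintegral_mono fun γ => by
          rw [← ofReal_measureReal]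
          exact ENNReal.ofReal_le_ofReal (outcomeLaw_oddsBad_le he hτ w γ)
    _ = ENNReal.ofReal _ * κ Set.univ := lintegral_const _
    _ ≤ ENNReal.ofReal _ * 1 := by gcongr
    _ = _ := mul_one _

lemma measurable_propensityPosterior_oddsBad (he : ∀ i, Measurable (e i))
    (priorγ : Measure (Fin d → ℝ)) [IsProbabilityMeasure priorγ] (r τ : ℝ) (y : Fin n → ℝ) :
    Measurable fun w : Cov n d =>
      propensityPosterior priorγ w.1 w.2 (oddsBad θ₀ β₀ e r τ y w) := by
  have hset := measurableSet_oddsBad (θ₀ := θ₀) (β₀ := β₀) he r τ y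
  generalize oddsBad θ₀ β₀ e r τ y = S at hset ⊢
  have h := Kernel.measurable_kernel_prodMk_left
    (κ := tiltedKernel priorγ (measurable_propensity_exponent (n := n) (d := d))) hset
  exact h

/-- Markov's inequality, applied to the posterior mass of the bad set, whose mean is bounded by
`lintegral_oddsBad_le`. -/
lemma IsLogisticSample.measure_oddsBad_le (hs : IsLogisticSample P Y X Z θ₀ β₀)
    (he : IsPropensityVersion P X Z e) (priorγ : Measure (Fin d → ℝ))
    [IsProbabilityMeasure priorγ] {r τ η : ℝ} (hτ : 0 ≤ τ) (hη : 0 < η) :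
    P.real {ω | η ≤ (propensityPosterior priorγ (col X ω) (col Z ω)).real
        (oddsBad θ₀ β₀ e r τ (col Y ω) (covar X Z ω))}
      ≤ 2 * Real.exp (-τ ^ 2 / (2 * (n * r ^ 2))) / η := by
  have hmain := hs.lintegral_eq fun b =>
    measurable_propensityPosterior_oddsBad (θ₀ := θ₀) (β₀ := β₀) he.measurable priorγ r τ
      (fun i => bval (b i))
  set q := 2 * Real.exp (-τ ^ 2 / (2 * (n * r ^ 2))) with hq
  have hq0 : 0 ≤ q := by positivity
  set G : Ω → ℝ≥0∞ := fun ω => propensityPosterior priorγ (col X ω) (col Z ω)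
    (oddsBad θ₀ β₀ e r τ (col Y ω) (covar X Z ω)) with hG
  have hGe : ∀ ω, propensityPosterior priorγ (covar X Z ω).1 (covar X Z ω).2
      (oddsBad θ₀ β₀ e r τ (fun i => bval (ybool Y ω i)) (covar X Z ω)) = G ω := fun ω => by
    rw [hs.bval_ybool ω]; rfl
  simp_rw [hGe] at hmain
  have hbound : ∫⁻ ω, G ω ∂P ≤ ENNReal.ofReal q := by
    rw [hmain]
    refine (lintegral_mono fun ω => lintegral_oddsBad_le he.measurable he.mem priorγ hτ (covar X Z ω)).trans ?_
    simp [hq]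
  have hgm : Measurable G := by
    have h1 : Measurable fun p : (Fin n → Bool) × Cov n d =>
        propensityPosterior priorγ p.2.1 p.2.2
          (oddsBad θ₀ β₀ e r τ (fun i => bval (p.1 i)) p.2) :=
      measurable_from_prod_countable_right fun b =>
        measurable_propensityPosterior_oddsBad he.measurable priorγ r τ (fun i => bval (b i))
    have h2 := h1.comp (hs.measurable_ybool.prodMk hs.measurable_covar)
    exact (funext hGe) ▸ h2
  have hmarkov := mul_meas_ge_le_lintegral₀ hgm.aemeasurable (ENNReal.ofReal η) (μ := P)
  have hsubset : {ω | η ≤ (propensityPosterior priorγ (col X ω) (col Z ω)).real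
        (oddsBad θ₀ β₀ e r τ (col Y ω) (covar X Z ω))}
      ⊆ {ω | ENNReal.ofReal η ≤ G ω} := fun ω hω =>
    ENNReal.ofReal_le_of_le_toReal (b := G ω) hω
  rw [le_div_iff₀ hη, mul_comm]
  have := (mul_le_mul_right (measure_mono (μ := P) hsubset) (ENNReal.ofReal η)).trans
    (hmarkov.trans hbound)
  have h2 := ENNReal.toReal_mono ENNReal.ofReal_ne_top this
  rwa [ENNReal.toReal_mul, ENNReal.toReal_ofReal hη.le, ENNReal.toReal_ofReal hq0] at h2

end Sample

/-! ### Events of probability tending to one -/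

section Whp

variable {Ω : Type*} [MeasurableSpace Ω]

/-- The probability of the event `A n` tends to one. -/
def WithHighProb (P : Measure Ω) (A : ℕ → Ω → Prop) : Prop :=
  Tendsto (fun n => P.real {ω | ¬ A n ω}) atTop (𝓝 0)

variable {P : Measure Ω} {A B : ℕ → Ω → Prop}

lemma WithHighProb.of_le {b : ℕ → ℝ} (hb : Tendsto b atTop (𝓝 0))
    (h : ∀ᶠ n in atTop, P.real {ω | ¬ A n ω} ≤ b n) : WithHighProb P A :=
  squeeze_zero' (Eventually.of_forall fun _ => measureReal_nonneg) h hb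

lemma WithHighProb.of_ae (h : ∀ n, ∀ᵐ ω ∂P, A n ω) : WithHighProb P A := by
  refine WithHighProb.of_le tendsto_const_nhds (Eventually.of_forall fun n => ?_)
  rw [measureReal_def, ae_iff.1 (h n), ENNReal.toReal_zero]

variable [IsProbabilityMeasure P]

/-- Events are not assumed measurable here; monotonicity and subadditivity of outer measure suffice.
-/
lemma WithHighProb.and (hA : WithHighProb P A) (hB : WithHighProb P B) :
    WithHighProb P fun n ω => A n ω ∧ B n ω := by
  refine WithHighProb.of_le (by simpa using hA.add hB) (Eventually.of_forall fun n => ?_)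
  refine (measureReal_mono fun ω hω => ?_).trans (measureReal_union_le _ _)
  by_cases h : A n ω
  · exact Or.inr fun hb => hω ⟨h, hb⟩
  · exact Or.inl h

lemma WithHighProb.mono (hA : WithHighProb P A) (h : ∀ᶠ n in atTop, ∀ ω, A n ω → B n ω) :
    WithHighProb P B :=
  WithHighProb.of_le hA (h.mono fun _ hn => measureReal_mono fun _ hω ha => hω (hn _ ha))

lemma WithHighProb.of_compl_le {b : ℕ → ℝ} (hb : Tendsto b atTop (𝓝 0))
    (h : ∀ᶠ n in atTop, ∃ E : Set Ω, MeasurableSet E ∧ 1 - b n ≤ P.real E ∧ ∀ ω ∈ E, A n ω) :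
    WithHighProb P A := by
  refine WithHighProb.of_le hb (h.mono fun n ⟨E, hE, hn, hA⟩ => ?_)
  refine (measureReal_mono (s₂ := Eᶜ) fun ω (hω : ¬ A n ω) (hωE : ω ∈ E) => hω (hA ω hωE)).trans ?_
  rw [probReal_compl_eq_one_sub hE]
  linarith

end Whp

lemma le_dmax_left (d n : ℕ) : (d : ℝ) ≤ dmax d n := Nat.cast_le.2 (le_max_left d n)

lemma le_dmax_right (d n : ℕ) : (n : ℝ) ≤ dmax d n := Nat.cast_le.2 (le_max_right d n)

lemma tendsto_dmax (d : ℕ → ℕ) : Tendsto (fun n => dmax (d n) n) atTop atTop :=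
  tendsto_atTop_mono (fun n => le_dmax_right (d n) n) tendsto_natCast_atTop_atTop

lemma tendsto_dmax_rpow (d : ℕ → ℕ) {c : ℝ} (hc : 0 < c) :
    Tendsto (fun n => dmax (d n) n ^ (-c : ℝ)) atTop (𝓝 0) :=
  (tendsto_rpow_neg_atTop hc).comp (tendsto_dmax d)

lemma tendsto_const_mul_exp_neg {a b : ℝ} (hb : 0 < b) :
    Tendsto (fun n : ℕ => a * Real.exp (-(b * n))) atTop (𝓝 0) := by
  have h := (Real.tendsto_exp_neg_atTop_nhds_zero.comp
    (tendsto_natCast_atTop_atTop.const_mul_atTop hb)).const_mul a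
  simpa using h

/-! ### The score and the information of a sample -/

section Core

variable {n d : ℕ}

/-- The oracle efficient score of a sample. -/
noncomputable def scoreSum (θ₀ : ℝ) (β₀ : Fin d → ℝ) (e : Fin n → (Fin d → ℝ) → ℝ)
    (y : Fin n → ℝ) (w : Cov n d) : ℝ :=
  ∑ i, scoreTerm θ₀ (w.2 i ⬝ᵥ β₀) (e i (w.2 i)) (w.1 i) (y i)

/-- The conditional variance of the oracle efficient score given the covariates. -/
noncomputable def infoSum (θ₀ : ℝ) (β₀ : Fin d → ℝ) (e : Fin n → (Fin d → ℝ) → ℝ)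
    (w : Cov n d) : ℝ :=
  ∑ i, infoTerm θ₀ (w.2 i ⬝ᵥ β₀) (e i (w.2 i)) (w.1 i)

/-- The bounds on the sums over the sample that control the first-order error terms. -/
def CrossBound (θ₀ : ℝ) (β₀ : Fin d → ℝ) (e : Fin n → (Fin d → ℝ) → ℝ) (T : ℝ)
    (y : Fin n → ℝ) (w : Cov n d) : Prop :=
  |∑ i, crossTheta θ₀ (w.2 i ⬝ᵥ β₀) (e i (w.2 i)) (w.1 i) (y i)| ≤ T ∧
    ∀ j, |∑ i, crossPred θ₀ (w.2 i ⬝ᵥ β₀) (e i (w.2 i)) (w.1 i) (y i) * w.2 i j| ≤ T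

/-- The set of propensity parameters whose log-odds are far from the true ones. -/
def oddsFar (e : Fin n → (Fin d → ℝ) → ℝ) (r : ℝ) (z : Fin n → Fin d → ℝ) : Set (Fin d → ℝ) :=
  {γ | ∃ i, r ≤ |logit (Real.sigmoid (z i ⬝ᵥ γ)) - logit (e i (z i))|}

/-- The deterministic core, for data already in the good events. A draw outside the three
exceptional sets meets the hypotheses of the uniform Bernstein-von Mises theorem with the same `I`
and `W`, so its conditional posterior mass is close to a value independent of the draw. The radii
remain free parameters. -/
lemma marginalPosterior_normal_approx {π : ℝ → ℝ} (hπ : IsProbDensity π)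
    (priorβ priorγ : Measure (Fin d → ℝ)) [IsProbabilityMeasure priorβ]
    [IsProbabilityMeasure priorγ] {y : Fin n → ℝ} {w : Cov n d} {e : Fin n → (Fin d → ℝ) → ℝ}
    {θ₀ : ℝ} {β₀ : Fin d → ℝ} {ε δ K C r r' ρ T τ η₁ η₂ η₃ : ℝ} (hε : 0 ≤ ε)
    (happrox : ∀ (y x h φ : Fin n → ℝ) (I W : ℝ), (∀ i, |x i - h i| ≤ 1) → 1 / δ ≤ I →
      |(∑ i, (x i - h i) ^ 2 * bernoulliVar (θ₀ * (x i - h i) + φ i)) - I| ≤ δ * I →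
      |(∑ i, (x i - h i) * (y i - Real.sigmoid (θ₀ * (x i - h i) + φ i))) - W * √I| ≤ δ * √I →
      |W| ≤ K → |(∫ θ in Set.Iic θ₀, condDensity π y x h φ θ) - stdCdf (-W)| ≤ ε)
    (he : ∀ i z, e i z ∈ Set.Ioo (0 : ℝ) 1) (hx : ∀ i, w.1 i ∈ Set.Icc (0 : ℝ) 1)
    (hy : ∀ i, y i ∈ Set.Icc (0 : ℝ) 1) (hC : 0 ≤ C) (hz : ∀ i j, |w.2 i j| ≤ C)
    (hρr : ρ ≤ r) (hCr : C * ρ ≤ r) (hr' : r' ≤ r) (hcross : CrossBound θ₀ β₀ e T y w)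
    (hI0 : 0 < infoSum θ₀ β₀ e w) (hI : 1 / δ ≤ infoSum θ₀ β₀ e w)
    (hinfo : n * (10 * r) ≤ δ * infoSum θ₀ β₀ e w)
    (hscore : n * (42 * r ^ 2) + ρ * T + τ ≤ δ * √(infoSum θ₀ β₀ e w))
    (hW : |scoreSum θ₀ β₀ e y w| ≤ K * √(infoSum θ₀ β₀ e w))
    (h₁ : (outcomePosterior π priorβ y w.1 w.2).real {u | ρ ≤ l1Dist u (θ₀, β₀)} ≤ η₁)
    (h₂ : (propensityPosterior priorγ w.1 w.2).real (oddsFar e r' w.2) ≤ η₂)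
    (h₃ : (propensityPosterior priorγ w.1 w.2).real (oddsBad θ₀ β₀ e r τ y w) ≤ η₃) :
    |(marginalPosterior π priorβ priorγ y w.1 w.2).real (Set.Iic θ₀)
      - stdCdf (-(scoreSum θ₀ β₀ e y w / √(infoSum θ₀ β₀ e w)))| ≤ ε + (η₁ + (η₂ + η₃)) := by
  have hsq : 0 < √(infoSum θ₀ β₀ e w) := Real.sqrt_pos.2 hI0
  refine marginalPosterior_close hπ priorβ priorγ hy hx w.2 (stdCdf_mem _) hε h₁
    ((measureReal_union_le _ _).trans (add_le_add h₂ h₃)) fun u hu1 hu2 => ?_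
  simp only [Set.mem_ofPred_eq, not_le] at hu1
  simp only [Set.mem_union, not_or] at hu2
  have hfar : ∀ i, |logit (Real.sigmoid (w.2 i ⬝ᵥ u.2)) - logit (e i (w.2 i))| ≤ r := fun i => by
    by_contra! h
    exact hu2.1 ⟨i, hr'.trans h.le⟩
  have hτ : |∑ i, (logit (Real.sigmoid (w.2 i ⬝ᵥ u.2)) - logit (e i (w.2 i))) *
      crossOdds θ₀ (w.2 i ⬝ᵥ β₀) (e i (w.2 i)) (w.1 i) (y i)| ≤ τ := by
    by_contra! h
    exact hu2.2 ⟨hfar, h.le⟩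
  have hθ : |u.1.1 - θ₀| ≤ r :=
    ((abs_fst_sub_le_l1Dist (β₀ := β₀)).trans hu1.le).trans hρr
  have hk : ∀ i, |w.2 i ⬝ᵥ u.1.2 - w.2 i ⬝ᵥ β₀| ≤ r := fun i =>
    ((abs_dotProduct_sub_le (θ₀ := θ₀) hC hz i).trans
      (mul_le_mul_of_nonneg_left hu1.le hC)).trans hCr
  refine happrox y w.1 _ _ _ _ (abs_sub_projEst_le hx) hI ?_ ?_ ?_
  · exact (info_close (e := fun i => e i (w.2 i)) (fun i => he i _) hx hθ hk hfar).trans hinfo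
  · rw [div_mul_cancel₀ _ hsq.ne']
    exact (score_close (e := fun i => e i (w.2 i)) (fun i => he i _) hx hy hθ hk hfar hu1.le
      hcross.1 hcross.2 hτ).trans hscore
  · rw [abs_div, abs_of_pos hsq]
    exact (div_le_iff₀ hsq).2 hW

end Core

/-! ### High-probability bounds for the sample sums and the nuisance posteriors. -/

section Asymptotic

variable {Ω : Type*} [MeasurableSpace Ω] {P : Measure Ω} [IsProbabilityMeasure P]
  {d : ℕ → ℕ} {Y X : (n : ℕ) → Fin n → Ω → ℝ} {Z : (n : ℕ) → Fin n → Ω → Fin (d n) → ℝ}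
  {θ₀ : ℝ} {β₀ : (n : ℕ) → Fin (d n) → ℝ} {e : (n : ℕ) → Fin n → (Fin (d n) → ℝ) → ℝ}

lemma withHighProb_infoSum (hs : ∀ n, IsLogisticSample P (Y n) (X n) (Z n) θ₀ (β₀ n))
    (he : ∀ n, IsPropensityVersion P (X n) (Z n) (e n)) {c : ℝ} (hc : 0 < c)
    (hinfo : ∀ᶠ n : ℕ in atTop,
      c ≤ (1 / (n : ℝ)) * ∑ i, fisherInfo P (X n i) (Z n i) θ₀ (β₀ n)) :
    WithHighProb P fun n ω => c / 2 * n ≤ infoSum θ₀ (β₀ n) (e n) (covar (X n) (Z n) ω) := by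
  refine WithHighProb.of_le
    (tendsto_const_mul_exp_neg (a := 2) (b := (c / 2) ^ 2 / 2) (by positivity)) ?_
  filter_upwards [hinfo, eventually_gt_atTop 0] with n hn hn0
  have hn0' : (0 : ℝ) < n := Nat.cast_pos.2 hn0
  have ht : 0 ≤ c / 2 * n := by positivity
  have hmean : c * n ≤ ∑ i, fisherInfo P (X n i) (Z n i) θ₀ (β₀ n) := by
    rw [one_div, inv_mul_eq_div, le_div_iff₀ hn0'] at hn
    exact hn
  refine (measureReal_mono fun ω hω => ?_).trans
    (((hs n).tail_info (he n) ht).trans (le_of_eq ?_))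
  · simp only [Set.mem_ofPred_eq, not_le] at hω ⊢
    rw [abs_sub_comm]
    refine le_trans ?_ (le_abs_self _)
    simp only [infoSum, covar, col] at hω
    linarith
  · congr 2
    field_simp

/-- With `D = d ∨ n`, the constant `6C` makes the Hoeffding exponent at least `2 log D`, so each sum
fails with probability at most `2 / D²`; the `d + 1 ≤ 2D` sums together fail with probability at
most `4 / D`. -/
lemma withHighProb_crossBound (hs : ∀ n, IsLogisticSample P (Y n) (X n) (Z n) θ₀ (β₀ n))
    (he : ∀ n, IsPropensityVersion P (X n) (Z n) (e n)) {C : ℝ} (hC : 1 ≤ C)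
    (hZ : ∀ n i j, ∀ᵐ ω ∂P, |Z n i ω j| ≤ C) :
    WithHighProb P fun n ω => CrossBound θ₀ (β₀ n) (e n)
      (6 * C * √(n * Real.log (dmax (d n) n))) (col (Y n) ω) (covar (X n) (Z n) ω) := by
  have hlim : Tendsto (fun n => 4 * (dmax (d n) n)⁻¹) atTop (𝓝 0) := by
    simpa using (tendsto_inv_atTop_zero.comp (tendsto_dmax d)).const_mul 4
  refine WithHighProb.of_le hlim ?_
  filter_upwards [eventually_ge_atTop 1] with n hn
  have hn0 : (1 : ℝ) ≤ n := by exact_mod_cast hn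
  set D := dmax (d n) n with hD
  have hD1 : 1 ≤ D := hn0.trans (le_dmax_right _ _)
  have hD0 : 0 < D := by linarith
  have hL : 0 ≤ Real.log D := Real.log_nonneg hD1
  set T := 6 * C * √(n * Real.log D) with hT
  have hT0 : 0 ≤ T := by positivity
  have hT2 : T ^ 2 = 36 * C ^ 2 * (n * Real.log D) := by
    rw [hT, mul_pow, Real.sq_sqrt (by positivity)]; ring
  have hexp : ∀ B : ℝ, 0 < B → B ≤ 3 * C →
      2 * Real.exp (-T ^ 2 / (2 * (n * B ^ 2))) ≤ 2 * (D⁻¹) ^ 2 := fun B hB0 hB => by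
    have e1 : (D⁻¹) ^ 2 = Real.exp (-(2 * Real.log D)) := by
      rw [Real.exp_neg, two_mul, Real.exp_add, Real.exp_log hD0, inv_pow, sq]
    rw [e1]
    refine mul_le_mul_of_nonneg_left (Real.exp_le_exp.2 ?_) zero_le_two
    rw [neg_div, neg_le_neg_iff, le_div_iff₀ (by positivity), hT2]
    have h1 : B ^ 2 ≤ (3 * C) ^ 2 := pow_le_pow_left₀ hB0.le hB 2
    have h2 : 0 ≤ (n : ℝ) * Real.log D := by positivity
    nlinarith [mul_le_mul_of_nonneg_left h1 h2]
  have h1 := ((hs n).tail_crossTheta (he n) hT0).trans (hexp 3 (by norm_num) (by linarith))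
  have h2 := fun j => ((hs n).tail_crossPred (he n) (zero_le_one.trans hC) j
    (fun i => hZ n i j) hT0).trans (hexp (3 * C) (by positivity) le_rfl)
  set S₁ := {ω | T ≤ |∑ i, crossTheta θ₀ (Z n i ω ⬝ᵥ β₀ n) (e n i (Z n i ω)) (X n i ω) (Y n i ω)|}
  set S₂ : Fin (d n) → Set Ω := fun j => {ω | T ≤ |∑ i, crossPred θ₀ (Z n i ω ⬝ᵥ β₀ n)
    (e n i (Z n i ω)) (X n i ω) (Y n i ω) * Z n i ω j|}
  have hsub : {ω | ¬ CrossBound θ₀ (β₀ n) (e n) T (col (Y n) ω) (covar (X n) (Z n) ω)}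
      ⊆ S₁ ∪ ⋃ j, S₂ j := fun ω hω => by
    by_contra hcon
    simp only [Set.mem_union, Set.mem_iUnion, not_or, not_exists] at hcon
    exact hω ⟨(not_le.1 hcon.1).le, fun j => (not_le.1 (hcon.2 j)).le⟩
  calc _ ≤ P.real S₁ + ∑ j, P.real (S₂ j) :=
        (measureReal_mono hsub).trans ((measureReal_union_le _ _).trans
          (add_le_add_right (measureReal_iUnion_fintype_le _) _))
    _ ≤ 2 * (D⁻¹) ^ 2 + ∑ _j : Fin (d n), 2 * (D⁻¹) ^ 2 :=
        add_le_add h1 (Finset.sum_le_sum fun j _ => h2 j)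
    _ = 2 * (1 + d n) * (D⁻¹) ^ 2 := by
        rw [Finset.sum_const, Finset.card_univ, Fintype.card_fin, nsmul_eq_mul]; ring
    _ ≤ 2 * (2 * D) * (D⁻¹) ^ 2 := by
        have := le_dmax_left (d n) n
        gcongr
        linarith
    _ = 4 * D⁻¹ := by field_simp; norm_num

/-- Tightness of the score at scale `√n`: at the level `√m * √n` the Hoeffding bound is `2 exp (-m /
2)`, whatever the sample size. -/
lemma exists_abs_scoreSum_le (hs : ∀ n, IsLogisticSample P (Y n) (X n) (Z n) θ₀ (β₀ n))
    (he : ∀ n, IsPropensityVersion P (X n) (Z n) (e n)) {η : ℝ} (hη : 0 < η) :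
    ∃ K > 0, ∀ n > 0, P.real {ω | ¬ |scoreSum θ₀ (β₀ n) (e n) (col (Y n) ω)
      (covar (X n) (Z n) ω)| ≤ K * √(n : ℝ)} ≤ η := by
  have hlim := (tendsto_const_mul_exp_neg (a := 2) (b := 1 / 2) (by norm_num)).eventually_le_const hη
  obtain ⟨m, hm, hm0⟩ := (hlim.and (eventually_gt_atTop 0)).exists
  have hm0' : (0 : ℝ) < m := Nat.cast_pos.2 hm0
  refine ⟨√m, Real.sqrt_pos.2 hm0', fun n hn => ?_⟩
  have hn' : (0 : ℝ) < n := Nat.cast_pos.2 hn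
  refine (measureReal_mono fun ω hω => ?_).trans
    (((hs n).tail_score (he n) (t := √m * √n) (by positivity)).trans (le_trans (le_of_eq ?_) hm))
  · exact (not_le.1 hω).le
  · congr 2
    rw [mul_pow, Real.sq_sqrt hm0'.le, Real.sq_sqrt hn'.le]
    field_simp

lemma withHighProb_oddsBad (hs : ∀ n, IsLogisticSample P (Y n) (X n) (Z n) θ₀ (β₀ n))
    (he : ∀ n, IsPropensityVersion P (X n) (Z n) (e n))
    (priorγ : (n : ℕ) → Measure (Fin (d n) → ℝ)) [∀ n, IsProbabilityMeasure (priorγ n)]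
    {r τ : ℕ → ℝ} (hτ : ∀ n, 0 ≤ τ n)
    (hr : Tendsto (fun n => τ n ^ 2 / (2 * (n * r n ^ 2))) atTop atTop) {η : ℝ} (hη : 0 < η) :
    WithHighProb P fun n ω => (propensityPosterior (priorγ n) (col (X n) ω) (col (Z n) ω)).real
        (oddsBad θ₀ (β₀ n) (e n) (r n) (τ n) (col (Y n) ω) (covar (X n) (Z n) ω)) ≤ η := by
  have hlim : Tendsto (fun n : ℕ => 2 * Real.exp (-τ n ^ 2 / (2 * (n * r n ^ 2))) / η) atTop
      (𝓝 0) := by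
    have h := ((Real.tendsto_exp_neg_atTop_nhds_zero.comp hr).const_mul 2).div_const η
    simpa [neg_div] using h
  refine WithHighProb.of_le hlim (Eventually.of_forall fun n => ?_)
  refine (measureReal_mono fun ω hω => ?_).trans
    ((hs n).measure_oddsBad_le (he n) (priorγ n) (hτ n) hη)
  exact (not_le.1 hω).le

lemma withHighProb_outcomePosterior {π : ℝ → ℝ} (hπ : IsProbDensity π)
    {priorβ : (n : ℕ) → Measure (Fin (d n) → ℝ)} [∀ n, IsProbabilityMeasure (priorβ n)]
    (hs : ∀ n, IsLogisticSample P (Y n) (X n) (Z n) θ₀ (β₀ n))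
    (hs_pos : ∀ᶠ n in atTop, 1 ≤ sparsity (β₀ n))
    (h : OutcomeConcentration P d Y X Z π priorβ θ₀ β₀) :
    ∃ M > 0, ∀ η > 0, WithHighProb P fun n ω =>
      (outcomePosterior π (priorβ n) (col (Y n) ω) (col (X n) ω) (col (Z n) ω)).real
        {u | M * (sparsity (β₀ n) * √(Real.log (dmax (d n) n) / n)) ≤ l1Dist u (θ₀, β₀ n)}
        ≤ η := by
  obtain ⟨M, hM, C, hC, c, hc, h⟩ := h
  refine ⟨M, hM, fun η hη => ?_⟩
  have hlim := (tendsto_dmax_rpow d hc).const_mul C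
  rw [mul_zero] at hlim
  refine WithHighProb.of_compl_le (tendsto_dmax_rpow d hc) ?_
  filter_upwards [h, hs_pos, hlim.eventually_le_const hη] with n ⟨E, h1, h2, h3⟩ hsn hηn
  refine ⟨E, h1, h2, fun ω hω => ?_⟩
  have := isProbabilityMeasure_outcomePosterior hπ (priorβ n)
    (y := col (Y n) ω) (fun i => (hs n).mem_Icc_Y i ω) (col (X n) ω) (col (Z n) ω)
  refine (measureReal_mono (h₂ := measure_ne_top _ _) fun u hu => ?_).trans ((h3 ω hω).trans hηn)
  simp only [Set.mem_ofPred_eq] at hu ⊢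
  refine le_max_of_le_left ?_
  have hs0 : (0 : ℝ) < sparsity (β₀ n) := by exact_mod_cast hsn
  rw [le_div_iff₀ hs0]
  linarith

lemma withHighProb_propensityPosterior
    {priorγ : (n : ℕ) → Measure (Fin (d n) → ℝ)}
    (he : ∀ n, IsPropensityVersion P (X n) (Z n) (e n))
    (h : PropensityConcentration P d X Z priorγ) :
    ∃ M > 0, ∀ η > 0, WithHighProb P fun n ω =>
      (propensityPosterior (priorγ n) (col (X n) ω) (col (Z n) ω)).real
        (oddsFar (e n) (M * √(Real.log (dmax (d n) n) / n)) (col (Z n) ω)) ≤ η := by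
  obtain ⟨M, hM, C, hC, c, hc, h⟩ := h
  refine ⟨M, hM, fun η hη => ?_⟩
  have hlim := (tendsto_dmax_rpow d hc).const_mul C
  rw [mul_zero] at hlim
  have h1 := WithHighProb.of_compl_le (tendsto_dmax_rpow d hc) h
  have h2 : WithHighProb P fun n ω => ∀ i, propensity P (X n i) (Z n i) ω = e n i (Z n i ω) :=
    WithHighProb.of_ae fun n => ae_all_iff.2 fun i => (he n).ae_eq i
  refine (h1.and h2).mono ((hlim.eventually_le_const hη).mono fun n hn ω hω => ?_)
  refine le_trans (le_of_eq (congrArg _ ?_)) (hω.1.trans hn)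
  ext γ
  refine exists_congr fun i => ?_
  obtain ⟨h0, h1⟩ := (he n).mem i (Z n i ω)
  have hσ0 := Real.sigmoid_pos (Z n i ω ⬝ᵥ γ)
  have hσ1 := Real.sigmoid_lt_one (Z n i ω ⬝ᵥ γ)
  rw [hω.2 i, Real.log_div (div_pos hσ0 (sub_pos.2 hσ1)).ne' (div_pos h0 (sub_pos.2 h1)).ne']
  rfl

end Asymptotic

/-! ### Normal approximation of the posterior probability of `(-∞, θ₀]` -/

/-- The bound on the standardized score must be fixed before the Bernstein-von Mises tolerance is
chosen, but it depends on the admitted failure probability `η`. The claim is therefore shown on an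
event of probability about `1 - η`, with `η` arbitrary. -/
lemma WithHighProb.of_tight {Ω : Type*} [MeasurableSpace Ω] {P : Measure Ω}
    [IsProbabilityMeasure P] {A : ℕ → Ω → Prop}
    (h : ∀ η > 0, ∃ B : ℕ → Ω → Prop, (∀ᶠ n in atTop, P.real {ω | ¬ B n ω} ≤ η) ∧
      WithHighProb P fun n ω => B n ω → A n ω) : WithHighProb P A := by
  refine tendsto_order.2 ⟨fun a ha => Eventually.of_forall fun n => ha.trans_le measureReal_nonneg,
    fun η hη => ?_⟩
  obtain ⟨B, hB, hAB⟩ := h (η / 2) (half_pos hη)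
  filter_upwards [hB, hAB.eventually_lt_const (half_pos hη)] with n h1 h2
  refine lt_of_le_of_lt ((measureReal_mono fun ω hω => ?_).trans (measureReal_union_le _ _))
    ((add_lt_add_of_le_of_lt h1 h2).trans_eq (add_halves η))
  by_cases hb : B n ω
  · exact Or.inr fun hab => hω (hab hb)
  · exact Or.inl hb

/-! ### Arithmetic of the convergence rates. -/

lemma tendsto_natCast_div_atTop {S : ℕ → ℝ} (hS : S =o[atTop] fun n : ℕ => √(n : ℝ))
    (hpos : ∀ᶠ n in atTop, 0 < S n) : Tendsto (fun n : ℕ => n / S n) atTop atTop := by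
  refine tendsto_atTop.2 fun b => ?_
  have hb : 0 < (|b| + 1)⁻¹ := by positivity
  filter_upwards [hS.bound hb, hpos, eventually_ge_atTop 1] with n h1 h2 hn
  have hn1 : (1 : ℝ) ≤ n := by exact_mod_cast hn
  rw [Real.norm_of_nonneg h2.le, Real.norm_of_nonneg (Real.sqrt_nonneg _)] at h1
  have h3 : √(n : ℝ) ≤ n := Real.sqrt_le_self_iff.2 (Or.inr hn1)
  rw [le_div_iff₀ h2]
  have h4 : S n ≤ (|b| + 1)⁻¹ * n := h1.trans (mul_le_mul_of_nonneg_left h3 hb.le)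
  calc b * S n ≤ (|b| + 1) * S n := mul_le_mul_of_nonneg_right (by linarith [le_abs_self b]) h2.le
    _ ≤ (|b| + 1) * ((|b| + 1)⁻¹ * n) := mul_le_mul_of_nonneg_left h4 (by positivity)
    _ = n := mul_inv_cancel_left₀ (by positivity) _

lemma natCast_mul_rate_sq {n s L R : ℝ} (hn : 0 < n) (hL : 0 ≤ L) :
    n * (R * (s * √(L / n))) ^ 2 = R ^ 2 * (s ^ 2 * L) := by
  rw [mul_pow, mul_pow, Real.sq_sqrt (by positivity)]
  field_simp

/-- For the information: when `I ≥ κ² n`, a radius of at most `δ κ² / 10` turns the error `10 n r`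
into at most `δ I`. -/
lemma rate_le {n s L R δ q κ : ℝ} (hn : 1 ≤ n) (hL : 0 ≤ L) (hδ : 0 ≤ δ) (hq : 0 ≤ q)
    (hS : s ^ 2 * L ≤ q * √n) (hqR : R ^ 2 * q ≤ (δ * κ ^ 2 / 10) ^ 2) :
    R * (s * √(L / n)) ≤ δ * κ ^ 2 / 10 := by
  have hn0 : 0 < n := by linarith
  refine (abs_le_of_sq_le_sq' (le_of_mul_le_mul_left (a := n) ?_ hn0) (by positivity)).2
  rw [natCast_mul_rate_sq hn0 hL]
  have h1 : s ^ 2 * L ≤ q * n :=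
    hS.trans (mul_le_mul_of_nonneg_left (Real.sqrt_le_self_iff.2 (Or.inr hn)) hq)
  calc R ^ 2 * (s ^ 2 * L) ≤ R ^ 2 * (q * n) := mul_le_mul_of_nonneg_left h1 (sq_nonneg R)
    _ = n * (R ^ 2 * q) := by ring
    _ ≤ _ := mul_le_mul_of_nonneg_left hqR hn0.le

/-- The allowance `δ √I ≥ δ κ √n` is spent in halves. One pays for the propensity term; the other
pays for the quadratic remainder `42 R² s² L` and the cross term, which is `6 M C s L` because
`√(L/n) * √(n L) = L`. -/
lemma score_error_le {n s L M R C δ q κ I : ℝ} (hn : 0 < n) (hs : 1 ≤ s) (hL : 0 ≤ L) (hM : 0 ≤ M)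
    (hC : 0 ≤ C) (hδ : 0 ≤ δ) (hS : s ^ 2 * L ≤ q * √n)
    (hq : (42 * R ^ 2 + 6 * M * C) * q ≤ δ * κ / 2) (hI : κ * √n ≤ √I) :
    n * (42 * (R * (s * √(L / n))) ^ 2) + M * (s * √(L / n)) * (6 * C * √(n * L))
      + δ * κ / 2 * √n ≤ δ * √I := by
  have hrt : √(L / n) * √(n * L) = L := by
    rw [← Real.sqrt_mul (by positivity), show L / n * (n * L) = L ^ 2 by field_simp,
      Real.sqrt_sq hL]
  have h1 : M * (s * √(L / n)) * (6 * C * √(n * L)) ≤ 6 * M * C * (s ^ 2 * L) := by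
    calc _ = 6 * M * C * (s * (√(L / n) * √(n * L))) := by ring
      _ = 6 * M * C * (s * L) := by rw [hrt]
      _ ≤ _ := mul_le_mul_of_nonneg_left
        (mul_le_mul_of_nonneg_right (le_self_pow₀ hs two_ne_zero) hL) (by positivity)
  have h2 := mul_le_mul_of_nonneg_left hS (show 0 ≤ 42 * R ^ 2 + 6 * M * C by positivity)
  have h3 := mul_le_mul_of_nonneg_right hq (Real.sqrt_nonneg n)
  have h4 := mul_le_mul_of_nonneg_left hI hδ
  have h5 := natCast_mul_rate_sq (s := s) (R := R) hn hL
  nlinarith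

section Asymptotic

variable {Ω : Type*} [MeasurableSpace Ω] {P : Measure Ω} [IsProbabilityMeasure P]
  {d : ℕ → ℕ} {Y X : (n : ℕ) → Fin n → Ω → ℝ} {Z : (n : ℕ) → Fin n → Ω → Fin (d n) → ℝ}
  {θ₀ : ℝ} {β₀ : (n : ℕ) → Fin (d n) → ℝ} {e : (n : ℕ) → Fin n → (Fin (d n) → ℝ) → ℝ}

theorem withHighProb_normal_approx {π : ℝ → ℝ} (hπ : IsProbDensity π)
    (hπ_cont : ContinuousAt π θ₀) (hπ_pos : 0 < π θ₀)
    {priorβ priorγ : (n : ℕ) → Measure (Fin (d n) → ℝ)}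
    [∀ n, IsProbabilityMeasure (priorβ n)] [∀ n, IsProbabilityMeasure (priorγ n)]
    (hs : ∀ n, IsLogisticSample P (Y n) (X n) (Z n) θ₀ (β₀ n))
    (he : ∀ n, IsPropensityVersion P (X n) (Z n) (e n))
    (hinfo : ∃ c > 0, ∀ᶠ n : ℕ in atTop,
      c ≤ (1 / (n : ℝ)) * ∑ i, fisherInfo P (X n i) (Z n i) θ₀ (β₀ n))
    (hdesign : ∃ C > 0, ∀ n i j, ∀ᵐ ω ∂P, |Z n i ω j| ≤ C)
    (hs_pos : ∀ᶠ n in atTop, 1 ≤ sparsity (β₀ n))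
    (hsparse : (fun n => (sparsity (β₀ n) : ℝ) ^ 2 * Real.log (dmax (d n) n))
      =o[atTop] fun n => √(n : ℝ))
    (hconc : OutcomeConcentration P d Y X Z π priorβ θ₀ β₀)
    (hprop : PropensityConcentration P d X Z priorγ) {ε : ℝ} (hε : 0 < ε) :
    WithHighProb P fun n ω =>
      |(marginalPosterior π (priorβ n) (priorγ n) (col (Y n) ω) (covar (X n) (Z n) ω).1
          (covar (X n) (Z n) ω).2).real (Set.Iic θ₀)
        - stdCdf (-(scoreSum θ₀ (β₀ n) (e n) (col (Y n) ω) (covar (X n) (Z n) ω)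
          / √(infoSum θ₀ (β₀ n) (e n) (covar (X n) (Z n) ω))))| ≤ ε := by
  obtain ⟨c, hc, hinfo⟩ := hinfo
  obtain ⟨C₀, -, hC₀⟩ := hdesign
  obtain ⟨C, hC, hZ⟩ : ∃ C : ℝ, 1 ≤ C ∧ ∀ n i j, ∀ᵐ ω ∂P, |Z n i ω j| ≤ C :=
    ⟨max C₀ 1, le_max_right _ _, fun n i j => (hC₀ n i j).mono fun ω h => h.trans (le_max_left _ _)⟩
  obtain ⟨M₁, hM₁, hout⟩ := withHighProb_outcomePosterior hπ hs hs_pos hconc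
  obtain ⟨M₂, hM₂, hpr⟩ := withHighProb_propensityPosterior he hprop
  have hC0 : 0 < C := by linarith
  obtain ⟨κ, hκ0, hκ2⟩ : ∃ κ > 0, κ ^ 2 = c / 2 :=
    ⟨√(c / 2), Real.sqrt_pos.2 (by positivity), Real.sq_sqrt (by positivity)⟩
  -- One radius `R s √(L/n)` for every error: it dominates the `ℓ¹` error, the resulting error `C`
  -- times as large in the linear predictors, and, as `s ≥ 1`, the error in the propensity log-odds.
  obtain ⟨R, hR0, hR⟩ : ∃ R > 0, R = M₁ * C + M₂ := ⟨_, by positivity, rfl⟩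
  obtain ⟨s, hsdef⟩ : ∃ s : ℕ → ℝ, ∀ n, (sparsity (β₀ n) : ℝ) = s n := ⟨_, fun _ => rfl⟩
  obtain ⟨L, hLdef⟩ : ∃ L : ℕ → ℝ, ∀ n, Real.log (dmax (d n) n) = L n := ⟨_, fun _ => rfl⟩
  simp only [hsdef, hLdef] at hout hpr hsparse
  have hcross := withHighProb_crossBound hs he hC hZ
  simp only [hLdef] at hcross
  have hspos' : ∀ᶠ n in atTop, 1 ≤ s n := hs_pos.mono fun n h => by
    rw [← hsdef]; exact_mod_cast h
  have hLpos : ∀ᶠ n in atTop, 0 < L n := by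
    filter_upwards [(tendsto_dmax d).eventually_gt_atTop 1] with n hn
    rw [← hLdef]
    exact Real.log_pos hn
  have hSpos : ∀ᶠ n in atTop, 0 < s n ^ 2 * L n := by
    filter_upwards [hspos', hLpos] with n h1 h2
    positivity
  refine WithHighProb.of_tight fun η hη => ?_
  obtain ⟨K, hK, hKη⟩ := exists_abs_scoreSum_le hs he hη
  have hπi : Integrable π := by
    refine ⟨hπ.measurable.aestronglyMeasurable, ?_⟩
    rw [hasFiniteIntegral_iff_ofReal (Eventually.of_forall hπ.nonneg), hπ.lintegral_eq_one]
    exact ENNReal.one_lt_top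
  -- On the event `|S| ≤ K √n` the bound `√I ≥ κ √n` gives `|W| ≤ K / κ`. The normal approximation
  -- and each of the three exceptional sets of draws receive `ε / 4`.
  obtain ⟨δ, hδ, happrox⟩ := condDensity_cdf_approx hπ.measurable hπ.nonneg hπi hπ_cont hπ_pos
    (show 0 < ε / 4 by positivity) (K / κ)
  refine ⟨_, (eventually_gt_atTop 0).mono hKη, ?_⟩
  -- With `τ` half the score allowance, the Hoeffding exponent is a constant times `n / (s² L)`,
  -- which tends to infinity by sparsity.
  have hodds := withHighProb_oddsBad hs he priorγ (r := fun n => R * (s n * √(L n / n)))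
    (τ := fun n => δ * κ / 2 * √(n : ℝ)) (fun n => by positivity) (by
    refine ((tendsto_natCast_div_atTop hsparse hSpos).const_mul_atTop
      (show 0 < (δ * κ / 2) ^ 2 / (2 * R ^ 2) by positivity)).congr' ?_
    filter_upwards [eventually_gt_atTop 0, hLpos] with n hn hLn
    rw [natCast_mul_rate_sq (Nat.cast_pos.2 hn) hLn.le, mul_pow, Real.sq_sqrt (Nat.cast_nonneg n)]
    ring) (show 0 < ε / 4 by positivity)
  have hZ' : WithHighProb P fun n ω => ∀ i j, |Z n i ω j| ≤ C :=
    WithHighProb.of_ae fun n => ae_all_iff.2 fun i => ae_all_iff.2 fun j => hZ n i j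
  have hall := ((hout (ε / 4) (by positivity)).and (hpr (ε / 4) (by positivity))).and
    (((withHighProb_infoSum hs he hc hinfo).and hcross).and (hodds.and hZ'))
  obtain ⟨q, hq, hq1, hq2⟩ : ∃ q > 0, R ^ 2 * q ≤ (δ * κ ^ 2 / 10) ^ 2 ∧
      (42 * R ^ 2 + 6 * M₁ * C) * q ≤ δ * κ / 2 := by
    refine ⟨min ((δ * κ ^ 2 / 10) ^ 2 / R ^ 2) (δ * κ / 2 / (42 * R ^ 2 + 6 * M₁ * C)),
      by positivity, ?_, ?_⟩
    · rw [mul_comm, ← le_div_iff₀ (by positivity)]; exact min_le_left _ _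
    · rw [mul_comm, ← le_div_iff₀ (by positivity)]; exact min_le_right _ _
  refine hall.mono ?_
  filter_upwards [hspos', hLpos, hsparse.bound hq, eventually_ge_atTop 1,
    (tendsto_natCast_atTop_atTop (R := ℝ)).eventually_ge_atTop (1 / δ / κ ^ 2)]
    with n hsn hLn hqn hn hnδ ω ⟨⟨ho, hp⟩, ⟨hi, hcr⟩, hod, hz⟩ hsc
  have hn1 : (1 : ℝ) ≤ n := by exact_mod_cast hn
  have hn0 : (0 : ℝ) < n := by linarith
  have hrate0 : 0 ≤ √(L n / n) := Real.sqrt_nonneg _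
  have hsr0 : 0 ≤ s n * √(L n / n) := mul_nonneg (by linarith) hrate0
  rw [Real.norm_of_nonneg (by positivity), Real.norm_of_nonneg (Real.sqrt_nonneg _)] at hqn
  rw [← hκ2] at hi
  have hI0 : 0 < infoSum θ₀ (β₀ n) (e n) (covar (X n) (Z n) ω) :=
    lt_of_lt_of_le (by positivity) hi
  have hsI : κ * √(n : ℝ) ≤ √(infoSum θ₀ (β₀ n) (e n) (covar (X n) (Z n) ω)) := by
    refine (le_of_eq ?_).trans (Real.sqrt_le_sqrt hi)
    rw [Real.sqrt_mul (by positivity), Real.sqrt_sq hκ0.le]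
  have hMC : 0 ≤ M₁ * C := by positivity
  have hM₁R : M₁ ≤ R := by rw [hR]; nlinarith
  have hCR : C * M₁ ≤ R := by rw [hR]; linarith
  have hM₂R : M₂ ≤ R := by rw [hR]; linarith
  have key := marginalPosterior_normal_approx (n := n) (d := d n) (r := R * (s n * √(L n / n))) hπ
    (priorβ n) (priorγ n) (show 0 ≤ ε / 4 by positivity) (happrox n) (he n).mem
    (fun i => (hs n).mem_Icc_X i ω) (fun i => (hs n).mem_Icc_Y i ω) hC0.le hz
    (mul_le_mul_of_nonneg_right hM₁R hsr0)
    ((mul_assoc _ _ _).symm.trans_le (mul_le_mul_of_nonneg_right hCR hsr0))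
    (mul_le_mul hM₂R (le_mul_of_one_le_left hrate0 hsn) hrate0 hR0.le)
    hcr hI0 (le_trans ((div_le_iff₀ (by positivity)).1 hnδ |>.trans_eq (mul_comm _ _)) hi)
    ((mul_le_mul_of_nonneg_left (mul_le_mul_of_nonneg_left
      (rate_le hn1 hLn.le hδ.le hq.le hqn hq1) (by norm_num)) hn0.le).trans
      (le_trans (le_of_eq (by ring)) (mul_le_mul_of_nonneg_left hi hδ.le)))
    (score_error_le hn0 hsn hLn.le hM₁.le hC0.le hδ.le hqn hq2 hsI)
    (hsc.trans (le_trans (le_of_eq (by field_simp))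
      (mul_le_mul_of_nonneg_left hsI (show 0 ≤ K / κ by positivity)))) ho hp hod
  exact key.trans (le_of_eq (by ring))

end Asymptotic

/-! ### Coverage of the credible interval -/

lemma stdScore_neg {n : ℕ} (η a : Fin n → ℝ) (b : Fin n → Bool) :
    stdScore η (-a) b = -stdScore η a b := by
  simp [stdScore, neg_div]

/-- Outside the event where `G` is far from `Φ(-W)`, membership in `A` is squeezed between two
events placing `-W` in an interval with normal quantiles as endpoints. Shifting the levels costs at
most `4ε`, the central limit theorem `ε` and the exceptional event `ε`. Only the open and closed
versions of the condition on `G` are compared with `A`, so ties at the endpoints are harmless. -/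
lemma coverage_close {α : ℝ} (hα : α ∈ Set.Ioo (0 : ℝ) 1) {ε : ℝ} (hε : 0 < ε)
    (hεα : 4 * ε < α) (hεα' : 2 * ε < 1 - α) :
    ∃ δ > 0, ∀ (n : ℕ) (η a : Fin n → ℝ) (G : (Fin n → Bool) → ℝ) (A : Set (Fin n → Bool)),
      (∀ i, |a i| ≤ 1) → 1 / δ ≤ ∑ i, a i ^ 2 * bernoulliVar (η i) →
      (∀ b, G b ∈ Set.Ioo (α / 2) (1 - α / 2) → b ∈ A) →
      (∀ b ∈ A, G b ∈ Set.Icc (α / 2) (1 - α / 2)) →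
      (outcomeLaw η).real {b | ε < |G b - stdCdf (-stdScore η a b)|} ≤ ε →
      |(outcomeLaw η).real A - (1 - α)| ≤ 6 * ε := by
  obtain ⟨hα0, hα1⟩ := hα
  obtain ⟨z₁, hz₁⟩ := exists_stdCdf_eq (p := α / 2 + ε) ⟨by linarith, by linarith⟩
  obtain ⟨z₂, hz₂⟩ := exists_stdCdf_eq (p := 1 - α / 2 - ε) ⟨by linarith, by linarith⟩
  -- The outer levels move by `2 * ε`, one `ε` more than the inner ones: `G` satisfies only weak
  -- inequalities here, while the target interval is open.
  obtain ⟨z₃, hz₃⟩ := exists_stdCdf_eq (p := α / 2 - 2 * ε) ⟨by linarith, by linarith⟩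
  obtain ⟨z₄, hz₄⟩ := exists_stdCdf_eq (p := 1 - α / 2 + 2 * ε) ⟨by linarith, by linarith⟩
  have h12 : z₁ < z₂ := strictMono_stdCdf.lt_iff_lt.1 (by linarith)
  have h34 : z₃ < z₄ := strictMono_stdCdf.lt_iff_lt.1 (by linarith)
  obtain ⟨δ₁, hδ₁, H₁⟩ := stdScore_clt hε h12
  obtain ⟨δ₂, hδ₂, H₂⟩ := stdScore_clt hε h34
  refine ⟨min δ₁ δ₂, lt_min hδ₁ hδ₂, fun n η a G A ha hI hinner houter hN => ?_⟩
  have ha' : ∀ i, |(-a) i| ≤ 1 := fun i => by rw [Pi.neg_apply, abs_neg]; exact ha i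
  have hI' : ∑ i, (-a) i ^ 2 * bernoulliVar (η i) = ∑ i, a i ^ 2 * bernoulliVar (η i) := by simp
  -- The variable of interest is `-W`, which is the standardized score with weights `-a`.
  have h1 := H₁ n η (-a) ha' (by
    rw [hI']
    exact (one_div_le_one_div_of_le (lt_min hδ₁ hδ₂) (min_le_left _ _)).trans hI)
  have h2 := H₂ n η (-a) ha' (by
    rw [hI']
    exact (one_div_le_one_div_of_le (lt_min hδ₁ hδ₂) (min_le_right _ _)).trans hI)
  simp_rw [stdScore_neg] at h1 h2
  set N := {b | ε < |G b - stdCdf (-stdScore η a b)|}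
  have hlow : (outcomeLaw η).real {b | -stdScore η a b ∈ Set.Ioo z₁ z₂}
      ≤ (outcomeLaw η).real A + ε := by
    refine (measureReal_mono fun b hb => ?_).trans ((measureReal_union_le A N).trans
      (add_le_add_right hN _))
    by_cases hbN : b ∈ N
    · exact Or.inr hbN
    · refine Or.inl (hinner b ?_)
      have h := abs_le.1 (not_lt.1 (show ¬ ε < |G b - stdCdf (-stdScore η a b)| from hbN))
      have hb1 := strictMono_stdCdf hb.1
      have hb2 := strictMono_stdCdf hb.2
      constructor <;> linarith [h.1, h.2]
  have hupp : (outcomeLaw η).real A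
      ≤ (outcomeLaw η).real {b | -stdScore η a b ∈ Set.Ioo z₃ z₄} + ε := by
    refine (measureReal_mono fun b hb => ?_).trans ((measureReal_union_le _ N).trans
      (add_le_add_right hN _))
    by_cases hbN : b ∈ N
    · exact Or.inr hbN
    · refine Or.inl ?_
      have h := abs_le.1 (not_lt.1 (show ¬ ε < |G b - stdCdf (-stdScore η a b)| from hbN))
      have hA := houter b hb
      exact ⟨strictMono_stdCdf.lt_iff_lt.1 (by linarith [h.1, h.2, hA.1]),
        strictMono_stdCdf.lt_iff_lt.1 (by linarith [h.1, h.2, hA.2])⟩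
  rw [abs_le] at h1 h2 ⊢
  constructor <;> linarith [h1.1, h1.2, h2.1, h2.2]

section Events

variable {n d : ℕ}

/-- Covariates for which `θ₀` lies in the credible interval at the responses `b`. -/
def coverSet (π : ℝ → ℝ) (priorβ priorγ : Measure (Fin d → ℝ)) (α θ₀ : ℝ) (b : Fin n → Bool) :
    Set (Cov n d) :=
  {w | (∃ q : ℚ, (q : ℝ) < θ₀ ∧ α / 2 ≤
      (marginalPosterior π priorβ priorγ (fun i => bval (b i)) w.1 w.2).real (Set.Iic (q : ℝ))) ∧
    (marginalPosterior π priorβ priorγ (fun i => bval (b i)) w.1 w.2).real (Set.Iic θ₀)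
      < 1 - α / 2}

/-- Covariates for which the normal approximation fails at the responses `b`. -/
def approxFail (π : ℝ → ℝ) (priorβ priorγ : Measure (Fin d → ℝ)) (θ₀ : ℝ) (β₀ : Fin d → ℝ)
    (e : Fin n → (Fin d → ℝ) → ℝ) (ε : ℝ) (b : Fin n → Bool) : Set (Cov n d) :=
  {w | ε < |(marginalPosterior π priorβ priorγ (fun i => bval (b i)) w.1 w.2).real (Set.Iic θ₀)
    - stdCdf (-(scoreSum θ₀ β₀ e (fun i => bval (b i)) w / √(infoSum θ₀ β₀ e w)))|}

variable {π : ℝ → ℝ} (priorβ priorγ : Measure (Fin d → ℝ)) [IsProbabilityMeasure priorβ]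
  [IsProbabilityMeasure priorγ] {θ₀ : ℝ} {β₀ : Fin d → ℝ} {e : Fin n → (Fin d → ℝ) → ℝ}

lemma measurableSet_coverSet (hπ : IsProbDensity π) (α : ℝ) (b : Fin n → Bool) :
    MeasurableSet (coverSet π priorβ priorγ α θ₀ b) := by
  have h := fun t => measurable_marginalPosterior_Iic priorβ priorγ hπ (fun i => bval (b i)) t
  have h1 : MeasurableSet {w : Cov n d | ∃ q : ℚ, (q : ℝ) < θ₀ ∧ α / 2 ≤
      (marginalPosterior π priorβ priorγ (fun i => bval (b i)) w.1 w.2).real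
        (Set.Iic (q : ℝ))} := by
    simp only [Set.ofPred_exists]
    exact MeasurableSet.iUnion fun q =>
      (MeasurableSet.const _).inter (measurableSet_le measurable_const (h q))
  exact h1.inter (measurableSet_lt (h θ₀) measurable_const)

lemma measurable_infoSum (he : ∀ i, Measurable (e i)) : Measurable (infoSum θ₀ β₀ e) :=
  Finset.measurable_sum _ fun i _ => Measurable.infoTerm θ₀
    ((measurable_dotProduct_const β₀).comp (by fun_prop)) ((he i).comp (by fun_prop)) (by fun_prop)

lemma measurable_scoreSum (he : ∀ i, Measurable (e i)) (y : Fin n → ℝ) :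
    Measurable (scoreSum θ₀ β₀ e y) :=
  Finset.measurable_sum _ fun i _ => Measurable.scoreTerm θ₀
    ((measurable_dotProduct_const β₀).comp (by fun_prop)) ((he i).comp (by fun_prop)) (by fun_prop)
    measurable_const

lemma measurableSet_approxFail (hπ : IsProbDensity π) (he : ∀ i, Measurable (e i)) (ε : ℝ)
    (b : Fin n → Bool) : MeasurableSet (approxFail π priorβ priorγ θ₀ β₀ e ε b) :=
  measurableSet_lt measurable_const (continuous_abs.measurable.comp
    ((measurable_marginalPosterior_Iic priorβ priorγ hπ _ θ₀).sub
      (continuous_stdCdf.measurable.comp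
        ((measurable_scoreSum he _).div (measurable_infoSum he).sqrt).neg)))

lemma bval_mem (b : Bool) : bval b ∈ Set.Icc (0 : ℝ) 1 := by cases b <;> simp [bval]

lemma mem_coverSet_iff (hπ : IsProbDensity π) {α : ℝ} (hα : α ∈ Set.Ioo (0 : ℝ) 1)
    (b : Fin n → Bool) {w : Cov n d} (hw : ∀ i, w.1 i ∈ Set.Icc (0 : ℝ) 1) :
    w ∈ coverSet π priorβ priorγ α θ₀ b ↔
      θ₀ ∈ credibleInterval π priorβ priorγ α (fun i => bval (b i)) w.1 w.2 := by
  have := isProbabilityMeasure_marginalPosterior priorβ priorγ hπ (fun i => bval_mem (b i)) hw w.2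
  obtain ⟨h0, h1⟩ := hα
  rw [credibleInterval, Set.mem_Ioo, quantile_lt_iff (by linarith) (by linarith),
    lt_quantile_iff (marginalPosterior_singleton priorβ priorγ _ _ _) (by linarith) (by linarith)]
  rfl

lemma mem_coverSet_of_mem_Ioo (hπ : IsProbDensity π) {α : ℝ} (hα : α ∈ Set.Ioo (0 : ℝ) 1)
    (b : Fin n → Bool) {w : Cov n d} (hw : ∀ i, w.1 i ∈ Set.Icc (0 : ℝ) 1)
    (h : (marginalPosterior π priorβ priorγ (fun i => bval (b i)) w.1 w.2).real (Set.Iic θ₀)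
      ∈ Set.Ioo (α / 2) (1 - α / 2)) : w ∈ coverSet π priorβ priorγ α θ₀ b := by
  have := isProbabilityMeasure_marginalPosterior priorβ priorγ hπ (fun i => bval_mem (b i)) hw w.2
  have h0 := hα.1
  have h1 := hα.2
  exact ⟨(quantile_lt_iff (by linarith) (by linarith) θ₀).1 (quantile_lt_of_lt
    (marginalPosterior_singleton priorβ priorγ _ _ _) (by linarith) h.1), h.2⟩

lemma mem_Icc_of_mem_coverSet (hπ : IsProbDensity π) {α : ℝ} (hα : α ∈ Set.Ioo (0 : ℝ) 1)
    (b : Fin n → Bool) {w : Cov n d} (hw : ∀ i, w.1 i ∈ Set.Icc (0 : ℝ) 1)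
    (h : w ∈ coverSet π priorβ priorγ α θ₀ b) :
    (marginalPosterior π priorβ priorγ (fun i => bval (b i)) w.1 w.2).real (Set.Iic θ₀)
      ∈ Set.Icc (α / 2) (1 - α / 2) := by
  have := isProbabilityMeasure_marginalPosterior priorβ priorγ hπ (fun i => bval_mem (b i)) hw w.2
  have h0 := hα.1
  have h1 := hα.2
  exact ⟨le_of_quantile_lt (by linarith) (by linarith)
    ((quantile_lt_iff (by linarith) (by linarith) θ₀).2 h.1), h.2.le⟩

end Events

section Asymptotic

variable {Ω : Type*} [MeasurableSpace Ω] {P : Measure Ω} [IsProbabilityMeasure P]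
  {d : ℕ → ℕ} {Y X : (n : ℕ) → Fin n → Ω → ℝ} {Z : (n : ℕ) → Fin n → Ω → Fin (d n) → ℝ}
  {θ₀ : ℝ} {β₀ : (n : ℕ) → Fin (d n) → ℝ} {e : (n : ℕ) → Fin n → (Fin (d n) → ℝ) → ℝ}

/-- Markov's inequality for the conditional probability given the covariates, whose mean is the
unconditional probability of the event. -/
lemma withHighProb_outcomeLaw_le (hs : ∀ n, IsLogisticSample P (Y n) (X n) (Z n) θ₀ (β₀ n))
    {N : (n : ℕ) → (Fin n → Bool) → Set (Cov n (d n))} (hN : ∀ n b, MeasurableSet (N n b))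
    (h : WithHighProb P fun n ω => covar (X n) (Z n) ω ∉ N n (ybool (Y n) ω)) {ε : ℝ}
    (hε : 0 < ε) :
    WithHighProb P fun n ω => (outcomeLaw (logOdds θ₀ (β₀ n) (covar (X n) (Z n) ω))).real
      {b | covar (X n) (Z n) ω ∈ N n b} ≤ ε := by
  have h' := h.div_const ε
  rw [zero_div] at h'
  refine WithHighProb.of_le h' (Eventually.of_forall fun n => ?_)
  simp only [not_not, not_le]
  rw [(hs n).measureReal_event (hN n), le_div_iff₀ hε, mul_comm]
  have hm := (measurable_outcomeLaw_real (θ₀ := θ₀) (β₀ := β₀ n) (N n) (hN n)).comp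
    (hs n).measurable_covar
  have hi : Integrable (fun ω => (outcomeLaw (logOdds θ₀ (β₀ n) (covar (X n) (Z n) ω))).real
      {b | covar (X n) (Z n) ω ∈ N n b}) P :=
    Integrable.of_bound hm.aestronglyMeasurable 1 (Eventually.of_forall fun ω => by
      rw [Real.norm_of_nonneg measureReal_nonneg]
      exact measureReal_le_one)
  refine le_trans ?_ (mul_meas_ge_le_integral_of_nonneg
    (Eventually.of_forall fun ω => measureReal_nonneg) hi ε)
  exact mul_le_mul_of_nonneg_left (measureReal_mono fun ω (hω : ε < _) => hω.le) hε.le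

/-- With high probability, the conditional coverage given the covariates is close to nominal. -/
theorem withHighProb_coverage {π : ℝ → ℝ} (hπ : IsProbDensity π)
    (priorβ priorγ : (n : ℕ) → Measure (Fin (d n) → ℝ))
    [∀ n, IsProbabilityMeasure (priorβ n)] [∀ n, IsProbabilityMeasure (priorγ n)]
    (hs : ∀ n, IsLogisticSample P (Y n) (X n) (Z n) θ₀ (β₀ n))
    (he : ∀ n, IsPropensityVersion P (X n) (Z n) (e n)) {c : ℝ} (hc : 0 < c)
    (hinfo : ∀ᶠ n : ℕ in atTop,
      c ≤ (1 / (n : ℝ)) * ∑ i, fisherInfo P (X n i) (Z n i) θ₀ (β₀ n))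
    (happrox : ∀ ε > 0, WithHighProb P fun n ω =>
      |(marginalPosterior π (priorβ n) (priorγ n) (col (Y n) ω) (covar (X n) (Z n) ω).1
          (covar (X n) (Z n) ω).2).real (Set.Iic θ₀)
        - stdCdf (-(scoreSum θ₀ (β₀ n) (e n) (col (Y n) ω) (covar (X n) (Z n) ω)
          / √(infoSum θ₀ (β₀ n) (e n) (covar (X n) (Z n) ω))))| ≤ ε)
    {α : ℝ} (hα : α ∈ Set.Ioo (0 : ℝ) 1) {ε : ℝ} (hε : 0 < ε) :
    WithHighProb P fun n ω => |(outcomeLaw (logOdds θ₀ (β₀ n) (covar (X n) (Z n) ω))).real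
      {b | covar (X n) (Z n) ω ∈ coverSet π (priorβ n) (priorγ n) α θ₀ b} - (1 - α)| ≤ ε := by
  obtain ⟨ε', hε', h1, h2, h3⟩ : ∃ ε' > 0, 4 * ε' < α ∧ 2 * ε' < 1 - α ∧ 6 * ε' ≤ ε := by
    have h0 := hα.1
    have h1 := sub_pos.2 hα.2
    refine ⟨min (α / 8) (min ((1 - α) / 4) (ε / 6)), by positivity, ?_, ?_, ?_⟩
    · linarith [min_le_left (α / 8) (min ((1 - α) / 4) (ε / 6))]
    · linarith [(min_le_right (α / 8) (min ((1 - α) / 4) (ε / 6))).trans (min_le_left _ _)]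
    · linarith [(min_le_right (α / 8) (min ((1 - α) / 4) (ε / 6))).trans (min_le_right _ _)]
  obtain ⟨δ, hδ, H⟩ := coverage_close hα hε' h1 h2
  have hfail : WithHighProb P fun n ω => covar (X n) (Z n) ω ∉ approxFail π (priorβ n) (priorγ n)
      θ₀ (β₀ n) (e n) ε' (ybool (Y n) ω) :=
    (happrox ε' hε').mono (Eventually.of_forall fun n ω h => by
      rw [approxFail, (hs n).bval_ybool ω]
      exact not_lt.2 h)
  have hN := withHighProb_outcomeLaw_le hs (fun n b =>
    measurableSet_approxFail (priorβ n) (priorγ n) hπ (he n).measurable ε' b) hfail hε'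
  refine ((withHighProb_infoSum hs he hc hinfo).and hN).mono ?_
  filter_upwards [(tendsto_natCast_atTop_atTop (R := ℝ)).eventually_ge_atTop (1 / δ / (c / 2))]
    with n hn ω ⟨hi, hNω⟩
  have hx : ∀ i, (covar (X n) (Z n) ω).1 i ∈ Set.Icc (0 : ℝ) 1 := fun i => (hs n).mem_Icc_X i ω
  -- With weights `x_i - h₀`, the quotient of `scoreSum` by `√infoSum` is `stdScore` by unfolding,
  -- so the failure event of the normal approximation has the form that `H` expects.
  refine (H n _ (fun i => (covar (X n) (Z n) ω).1 i - varProj θ₀ ((covar (X n) (Z n) ω).2 i ⬝ᵥ β₀ n)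
    (e n i ((covar (X n) (Z n) ω).2 i))) (fun b => (marginalPosterior π (priorβ n) (priorγ n)
      (fun i => bval (b i)) (covar (X n) (Z n) ω).1 (covar (X n) (Z n) ω).2).real (Set.Iic θ₀)) _
    (fun i => abs_sub_varProj_le ((he n).mem i _) (hx i)) ?_
    (fun b => mem_coverSet_of_mem_Ioo (priorβ n) (priorγ n) hπ hα b hx)
    (fun b => mem_Icc_of_mem_coverSet (priorβ n) (priorγ n) hπ hα b hx) hNω).trans h3
  refine le_trans ?_ hi
  rw [div_le_iff₀ (by positivity)] at hn
  linarith

end Asymptotic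

end CondPosterior

theorem corollary1 {Ω : Type*} [MeasurableSpace Ω] (P : Measure Ω) [IsProbabilityMeasure P]
    -- the dimension and the data, for every sample size
    (d : ℕ → ℕ) (Y X : (n : ℕ) → Fin n → Ω → ℝ) (Z : (n : ℕ) → Fin n → Ω → Fin (d n) → ℝ)
    -- the true parameters
    (θ₀ : ℝ) (β₀ : (n : ℕ) → Fin (d n) → ℝ)
    -- the priors
    (π : ℝ → ℝ) (priorβ priorγ : (n : ℕ) → Measure (Fin (d n) → ℝ))
    [∀ n, IsProbabilityMeasure (priorβ n)] [∀ n, IsProbabilityMeasure (priorγ n)]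
    (hπ_meas : Measurable π) (hπ_nonneg : ∀ t, 0 ≤ π t) (hπ_int : ∫⁻ t, ENNReal.ofReal (π t) = 1)
    -- the logistic model
    (hmodel : ∀ n, IsLogisticSample P (Y n) (X n) (Z n) θ₀ (β₀ n))
    -- the average Fisher information about `θ` does not degenerate
    (hinfo : ∃ c > 0, ∀ᶠ n : ℕ in atTop,
      c ≤ (1 / (n : ℝ)) * ∑ i, fisherInfo P (X n i) (Z n i) θ₀ (β₀ n))
    -- dimension, bounded design, sparsity
    (hdim : (fun n => Real.log (d n)) =o[atTop] fun n => (n : ℝ))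
    (hdesign : ∃ C > 0, ∀ n i j, ∀ᵐ ω ∂P, |Z n i ω j| ≤ C)
    (hs_pos : ∀ᶠ n in atTop, 1 ≤ sparsity (β₀ n))
    (hsparse : (fun n => (sparsity (β₀ n) : ℝ) ^ 2 * Real.log (dmax (d n) n))
      =o[atTop] fun n => √(n : ℝ))
    -- concentration of the nuisance posteriors
    (hconc : OutcomeConcentration P d Y X Z π priorβ θ₀ β₀)
    (hprop : PropensityConcentration P d X Z priorγ)
    -- the prior density at the true value
    (hπ_cont : ContinuousAt π θ₀) (hπ_pos : 0 < π θ₀)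
    (α : ℝ) (hα : α ∈ Set.Ioo (0 : ℝ) 1) :
    -- coverage given the covariates tends to `1 - α` in probability
    TendstoInMeasure P
      (fun n => P⟦{ω | θ₀ ∈ credibleInterval π (priorβ n) (priorγ n) α
          (col (Y n) ω) (col (X n) ω) (col (Z n) ω)} |
        MeasurableSpace.comap (fun ω => (col (X n) ω, col (Z n) ω)) inferInstance⟧)
      atTop (fun _ => 1 - α) ∧
    -- unconditional coverage tends to `1 - α`
    Tendsto
      (fun n => P.real {ω | θ₀ ∈ credibleInterval π (priorβ n) (priorγ n) α
        (col (Y n) ω) (col (X n) ω) (col (Z n) ω)})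
      atTop (𝓝 (1 - α)) := by
  have hπ : IsProbDensity π := ⟨hπ_meas, hπ_nonneg, hπ_int⟩
  choose e he using fun n => (hmodel n).exists_propensityVersion
  obtain ⟨c, hc, hinfo'⟩ := hinfo
  have hcov := fun ε (hε : 0 < ε) => withHighProb_coverage hπ priorβ priorγ hmodel he hc hinfo'
    (fun ε' hε' => withHighProb_normal_approx hπ hπ_cont hπ_pos hmodel he ⟨c, hc, hinfo'⟩ hdesign
      hs_pos hsparse hconc hprop hε') hα hε
  have hA := fun n b => measurableSet_coverSet (n := n) (θ₀ := θ₀) (priorβ n) (priorγ n) hπ α b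
  have hevent : ∀ n, {ω | θ₀ ∈ credibleInterval π (priorβ n) (priorγ n) α
        (col (Y n) ω) (col (X n) ω) (col (Z n) ω)}
      = {ω | covar (X n) (Z n) ω ∈ coverSet π (priorβ n) (priorγ n) α θ₀ (ybool (Y n) ω)} :=
    fun n => by
      ext ω
      have h := mem_coverSet_iff (θ₀ := θ₀) (priorβ n) (priorγ n) hπ hα (ybool (Y n) ω)
        (w := covar (X n) (Z n) ω) fun i => (hmodel n).mem_Icc_X i ω
      rw [(hmodel n).bval_ybool ω] at h
      exact h.symm
  simp_rw [hevent]
  constructor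
  · rw [tendstoInMeasure_iff_measureReal_norm]
    intro ε hε
    -- Convergence in measure concerns the event of a deviation of at least `ε`, while `hcov` bounds
    -- strict excess; passing to `ε / 2` bridges the two. The explicit conditional coverage is a
    -- version of the conditional probability, hence the almost sure inclusion.
    refine squeeze_zero (fun _ => measureReal_nonneg) (fun n => ?_) (hcov (ε / 2) (half_pos hε))
    refine ENNReal.toReal_mono (measure_ne_top _ _) (measure_mono_ae ?_)
    filter_upwards [(hmodel n).condProb_eq (hA n)] with ω hω hle
    change ε ≤ |_ - (1 - α)| at hle
    rw [← hω] at hle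
    exact fun h => absurd (hle.trans h) (by linarith)
  -- Unconditional coverage is the mean of the conditional coverage. The latter lies in `[0, 1]`, so
  -- its convergence in probability carries over to the mean.
  · have hQ : ∀ n, P.real {ω | covar (X n) (Z n) ω ∈ coverSet π (priorβ n) (priorγ n) α θ₀
        (ybool (Y n) ω)} = _ := fun n => (hmodel n).measureReal_event (hA n)
    rw [Metric.tendsto_atTop']
    intro ε hε
    obtain ⟨n₀, hn₀⟩ := eventually_atTop.1
      ((hcov (ε / 4) (by positivity)).eventually_lt_const (show 0 < ε / 4 by positivity))
    refine ⟨n₀, fun n hn => ?_⟩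
    rw [Real.dist_eq, hQ n]
    refine lt_of_le_of_lt (abs_integral_sub_le
      ((measurable_outcomeLaw_real _ (hA n)).comp (hmodel n).measurable_covar)
      (fun ω => ⟨measureReal_nonneg, measureReal_le_one⟩) (ε := ε / 4)
      ⟨by linarith [hα.2], by linarith [hα.1]⟩ (by positivity)
      (fun ω hω => not_not.1 hω) (hn₀ n hn.le).le) ?_
    linarith
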